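/- Let $\mathbb{F}$ be a finite field with $q$ elements, $\psi\colon\mathbb{F}\to\mathbb{C}^\times$ a non-trivial additive character, and $k,c\ge 1$ integers; all representations are finite-dimensional and complex. **Zelevinsky vectors and $(k,c)$ type.** For a composition $\lambda=(n_1,\dots,n_r)$ of $n$, a $\psi$-Zelevinsky vector of type $\lambda$ of a representation $\Sigma$ of $\mathrm{GL}_n(\mathbb{F})$ is a vector $v\neq 0$ with $\Sigma(u)v=\psi\big(\sum_{j} u_{j,j+1}\big)v$ for every upper triangular unipotent $u$, where $j$ runs over the integers $1\le j\le n-1$ not in $\{n_1,n_1+n_2,\dots,n_1+\dots+n_r\}$. A representation $\Sigma$ of $\mathrm{GL}_{kc}(\mathbb{F})$ is of $(k,c)$ type if it has a $\psi$-Zelevinsky vector of type $(k^c)=(k,\dots,k)$, unique up to scalar, and has no $\psi$-Zelevinsky vector of type $\lambda$ for any composition $\lambda$ of $kc$ which is greater than or not comparable with $(k^c)$ in the dominance order (compositions are compared after rearranging their parts in non-increasing order). **$(k,c)_\psi$ vectors and Bessel–Speh functions.** Let $N_{(c^k)}\subset\mathrm{GL}_{kc}(\mathbb{F})$ be the group of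 block upper unipotent matrices with $k\times k$ blocks of size $c\times c$, and let $\psi_{k,c}(u)=\psi\big(\sum_{j=1}^{k-1}\mathrm{tr}\,X_j\big)$ where $X_1,\dots,X_{k-1}$ are the blocks of $u$ just above the diagonal blocks. A $(k,c)_\psi$ vector of $\Sigma$ is a vector $v\ne0$ with $\Sigma(u)v=\psi_{k,c}(u)v$ for all $u\in N_{(c^k)}$. A normalized Bessel–Speh function of $\Sigma$ is $$\mathcal{BS}_{\Sigma}(g)=\frac{\langle\Sigma(g)v,v\rangle}{\langle v,v\rangle},\qquad g\in \mathrm{GL}_{kc}(\mathbb{F}),$$ for a $\mathrm{GL}_{kc}(\mathbb{F})$-invariant inner product and a $(k,c)_\psi$ vector $v$ of $\Sigma$. Its special value at $h\in\mathrm{GL}_c(\mathbb{F})$ is $$\mathcal{J}_{\Sigma}(h)=\begin{cases}\mathcal{BS}_\Sigma\begin{pmatrix}0&I_{(k-1)c}\\h&0\end{pmatrix}&k\ge2,\\ \mathcal{BS}_\Sigma(h)\,\psi(\mathrm{tr}\,h^{-1})&k=1.\end{cases}$$ **Statement.** Let $k_1,k_2,c\ge1$, let $\Sigma_1$ and $\Sigma_2$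 be irreducible representations of $\mathrm{GL}_{k_1c}(\mathbb{F})$ and $\mathrm{GL}_{k_2c}(\mathbb{F})$ of $(k_1,c)$ and $(k_2,c)$ type, respectively, and let $k=k_1+k_2$. Let $\Sigma_1\circ\Sigma_2$ be the parabolic induction, that is, the space of functions $f\colon\mathrm{GL}_{kc}(\mathbb{F})\to\Sigma_1\otimes\Sigma_2$ satisfying $f\big(\begin{pmatrix}g_1&*\\0&g_2\end{pmatrix}g\big)=(\Sigma_1(g_1)\otimes\Sigma_2(g_2))f(g)$ for $g_1\in\mathrm{GL}_{k_1c}(\mathbb{F})$ and $g_2\in\mathrm{GL}_{k_2c}(\mathbb{F})$, with $\mathrm{GL}_{kc}(\mathbb{F})$ acting by right translation. Let $\Sigma\subset\Sigma_1\circ\Sigma_2$ be an irreducible subrepresentation admitting a $(k,c)_\psi$ vector. Then each of $\Sigma_1$, $\Sigma_2$ and $\Sigma$ has exactly one normalized Bessel–Speh function, and for every $h\in\mathrm{GL}_c(\mathbb{F})$ $$\mathcal{J}_{\Sigma}(h)=q^{-c^2}\sum_{\substack{x,y\in\mathrm{GL}_c(\mathbb{F})\\xy=-h}}\mathcal{J}_{\Sigma_1}(x)\,\mathcal{J}_{\Sigma_2}(y).$$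 -/

import Mathlib

open scoped TensorProduct MatrixGroups

namespace BesselSpeh

section Induction

variable {F : Type*} [Field F]

/-- `IsParabolicWith h p g₁ g₂` says that `p ∈ GL_n(F)`, `n = n₁ + n₂`, is the block upper triangular
matrix `(g₁ *; 0 g₂)`, i.e. that `p` lies in the standard parabolic subgroup of type `(n₁, n₂)`
and has Levi part `diag(g₁, g₂)`. -/
def IsParabolicWith {n₁ n₂ n : ℕ} (h : n₁ + n₂ = n) (p : GL (Fin n) F)
    (g₁ : GL (Fin n₁) F) (g₂ : GL (Fin n₂) F) : Prop :=
  ∃ X : Matrix (Fin n₁) (Fin n₂) F,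
    (p : Matrix (Fin n) (Fin n) F) =
      Matrix.reindex (finSumFinEquiv.trans (finCongr h)) (finSumFinEquiv.trans (finCongr h))
        (Matrix.fromBlocks (g₁ : Matrix (Fin n₁) (Fin n₁) F) X 0
          (g₂ : Matrix (Fin n₂) (Fin n₂) F))

variable {V₁ V₂ : Type*} [AddCommGroup V₁] [Module ℂ V₁] [AddCommGroup V₂] [Module ℂ V₂]

/-- The space of the parabolic induction `σ₁ ∘ σ₂`: functions `f : GL_n(F) → V₁ ⊗ V₂` with
`f (p g) = (σ₁ g₁ ⊗ σ₂ g₂) (f g)` for `p = (g₁ *; 0 g₂)`. -/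
def parabolicSpace {n₁ n₂ n : ℕ} (h : n₁ + n₂ = n)
    (σ₁ : Representation ℂ (GL (Fin n₁) F) V₁) (σ₂ : Representation ℂ (GL (Fin n₂) F) V₂) :
    Submodule ℂ (GL (Fin n) F → V₁ ⊗[ℂ] V₂) where
  carrier := {f | ∀ p g₁ g₂, IsParabolicWith h p g₁ g₂ →
    ∀ g, f (p * g) = TensorProduct.map (σ₁ g₁) (σ₂ g₂) (f g)}
  zero_mem' := by
    intro p g₁ g₂ _ g
    simp
  add_mem' := by
    intro a b ha hb p g₁ g₂ hp g
    simp [ha p g₁ g₂ hp g, hb p g₁ g₂ hp g]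
  smul_mem' := by
    intro t a ha p g₁ g₂ hp g
    simp [ha p g₁ g₂ hp g]

/-- The parabolic induction `σ₁ ∘ σ₂`: `GL_n(F)` acts on `parabolicSpace` by right translation. -/
def parabolicInduction {n₁ n₂ n : ℕ} (h : n₁ + n₂ = n)
    (σ₁ : Representation ℂ (GL (Fin n₁) F) V₁) (σ₂ : Representation ℂ (GL (Fin n₂) F) V₂) :
    Representation ℂ (GL (Fin n) F) (parabolicSpace h σ₁ σ₂) where
  toFun x :=
    { toFun := fun f => ⟨fun g => (f : GL (Fin n) F → V₁ ⊗[ℂ] V₂) (g * x), by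
        intro p g₁ g₂ hp g
        change f.1 (p * g * x) = _
        rw [mul_assoc]
        exact f.2 p g₁ g₂ hp (g * x)⟩
      map_add' := fun _ _ => rfl
      map_smul' := fun _ _ => rfl }
  map_one' := by
    ext f g
    simp
  map_mul' x y := by
    ext f g
    simp [mul_assoc]

end Induction

section Zelevinsky

variable {F : Type*} [Field F] {V : Type*} [AddCommGroup V] [Module ℂ V]

/-- Membership in the group of upper triangular unipotent matrices of `GL_n(F)`. -/
def IsUpperUnipotent {n : ℕ} (u : GL (Fin n) F) : Prop :=
  (∀ i, (u : Matrix (Fin n) (Fin n) F) i i = 1) ∧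
    ∀ i j, j < i → (u : Matrix (Fin n) (Fin n) F) i j = 0

/-- The set `{n₁, n₁ + n₂, …, n₁ + ⋯ + n_r}` attached to a composition `(n₁, …, n_r)`. -/
def partialSums (l : List ℕ) : Finset ℕ :=
  (Finset.Icc 1 l.length).image fun j => (l.take j).sum

/-- The Zelevinsky character of type `l`: `u ↦ ψ (∑ u_{j, j+1})` over the `1 ≤ j ≤ n - 1` that are
not in `partialSums l`. The 1-based index `j` is `i + 1` for the 0-based row index `i`. -/
def zelevinskyChar (ψ : AddChar F ℂ) (l : List ℕ) {n : ℕ} (u : GL (Fin n) F) : ℂ :=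
  ψ (∑ i : Fin n, if hi : (i : ℕ) + 1 < n then
      (if (i : ℕ) + 1 ∈ partialSums l then 0
        else (u : Matrix (Fin n) (Fin n) F) i ⟨(i : ℕ) + 1, hi⟩)
    else 0)

/-- The space consisting of `0` and the `ψ`-Zelevinsky vectors of type `l`. -/
def zelevinskySpace (ψ : AddChar F ℂ) (l : List ℕ) {n : ℕ}
    (ρ : Representation ℂ (GL (Fin n) F) V) : Submodule ℂ V where
  carrier := {v | ∀ u, IsUpperUnipotent u → ρ u v = zelevinskyChar ψ l u • v}
  zero_mem' := by
    intro u _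
    simp
  add_mem' := by
    intro a b ha hb u hu
    simp [ha u hu, hb u hu]
  smul_mem' := by
    intro t a ha u hu
    simp [ha u hu, smul_comm t]

/-- The dominance relation `l ≥ l'` of compositions: after rearranging both in non-increasing
order, the partial sums of `l` are at least those of `l'`, as far as both are defined. -/
def Dominates (l l' : List ℕ) : Prop :=
  ∀ j, 1 ≤ j → j ≤ min l.length l'.length →
    ((l'.insertionSort (· ≥ ·)).take j).sum ≤ ((l.insertionSort (· ≥ ·)).take j).sum

/-- `ρ` is a representation of `(k, c)` type: its `ψ`-Zelevinsky vector of type `(k^c)` exists and is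
unique up to scalars, and it has no `ψ`-Zelevinsky vector of type `l` for the compositions `l`
of `kc` that are greater than or not comparable with `(k^c)`, i.e. that `(k^c)` does not
dominate. -/
def IsKCType (ψ : AddChar F ℂ) (k c : ℕ) (ρ : Representation ℂ (GL (Fin (k * c)) F) V) : Prop :=
  Module.finrank ℂ (zelevinskySpace ψ (List.replicate c k) ρ) = 1 ∧
    ∀ l : Composition (k * c), ¬ Dominates (List.replicate c k) l.blocks →
      zelevinskySpace ψ l.blocks ρ = ⊥

end Zelevinsky

section Bessel

variable {F : Type*} [Field F] {V : Type*} [AddCommGroup V] [Module ℂ V]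

/-- The `kc × kc` matrix with the given `k × k` array of `c × c` blocks. -/
def ofBlocks {k c : ℕ} (M : Matrix (Fin k) (Fin k) (Matrix (Fin c) (Fin c) F)) :
    Matrix (Fin (k * c)) (Fin (k * c)) F :=
  Matrix.reindex finProdFinEquiv finProdFinEquiv (Matrix.comp _ _ _ _ _ M)

theorem ofBlocks_mul {k c : ℕ} (M N : Matrix (Fin k) (Fin k) (Matrix (Fin c) (Fin c) F)) :
    ofBlocks (M * N) = ofBlocks M * ofBlocks N := by
  have h := (Matrix.compRingEquiv (Fin k) (Fin c) F).map_mul M N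
  simp only [Matrix.compRingEquiv_apply] at h
  simp [ofBlocks, h, Matrix.submatrix_mul_equiv]

theorem ofBlocks_one {k c : ℕ} :
    ofBlocks (1 : Matrix (Fin k) (Fin k) (Matrix (Fin c) (Fin c) F)) = 1 := by
  have h := (Matrix.compRingEquiv (Fin k) (Fin c) F).map_one
  simp only [Matrix.compRingEquiv_apply] at h
  simp [ofBlocks, h]

/-- The `(a, b)` block, of size `c × c`, of an element of `GL_{kc}(F)`. -/
def block {k c : ℕ} (u : GL (Fin (k * c)) F) (a b : Fin k) : Matrix (Fin c) (Fin c) F :=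
  Matrix.of fun i j =>
    (u : Matrix (Fin (k * c)) (Fin (k * c)) F) (finProdFinEquiv (a, i)) (finProdFinEquiv (b, j))

/-- Membership in the unipotent radical of the standard parabolic subgroup of `GL_{kc}(F)` attached
to the composition `(c^k)`. -/
def IsKCUnipotent {k c : ℕ} (u : GL (Fin (k * c)) F) : Prop :=
  (∀ a, block u a a = 1) ∧ ∀ a b, b < a → block u a b = 0

/-- The character `ψ_{k,c} (u) = ψ (∑ tr X_j)`, where `X_1, …, X_{k-1}` are the blocks of `u` just
above the block diagonal. -/
def kcChar (ψ : AddChar F ℂ) {k c : ℕ} (u : GL (Fin (k * c)) F) : ℂ :=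
  ψ (∑ a : Fin k, if ha : (a : ℕ) + 1 < k then (block u a ⟨(a : ℕ) + 1, ha⟩).trace else 0)

/-- The space consisting of `0` and the `(k, c)_ψ` vectors of `ρ`. -/
def kcSpace (ψ : AddChar F ℂ) {k c : ℕ} (ρ : Representation ℂ (GL (Fin (k * c)) F) V) :
    Submodule ℂ V where
  carrier := {v | ∀ u, IsKCUnipotent u → ρ u v = kcChar ψ u • v}
  zero_mem' := by
    intro u _
    simp
  add_mem' := by
    intro a b ha hb u hu
    simp [ha u hu, hb u hu]
  smul_mem' := by
    intro t a ha u hu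
    simp [ha u hu, smul_comm t]

/-- `J` is a normalized Bessel–Speh function of `ρ` with respect to `ψ`: for some invariant inner
product and some `(k, c)_ψ` vector `v ≠ 0`, `J g = ⟨ρ g v, v⟩ / ⟨v, v⟩`. Mathlib's inner products
are linear in the second argument, so `⟨x, y⟩` is written `B.inner y x`. -/
def IsBesselSpehFunction (ψ : AddChar F ℂ) {k c : ℕ}
    (ρ : Representation ℂ (GL (Fin (k * c)) F) V) (J : GL (Fin (k * c)) F → ℂ) : Prop :=
  ∃ B : InnerProductSpace.Core ℂ V,
    (∀ g x y, B.inner (ρ g x) (ρ g y) = B.inner x y) ∧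
    ∃ v ∈ kcSpace ψ ρ, v ≠ 0 ∧ ∀ g, J g = B.inner v (ρ g v) / B.inner v v

/-- The array of blocks of `(0 I_{(k-1)c}; h 0)`. -/
def voronoiBlocks (k : ℕ) {c : ℕ} (h : Matrix (Fin c) (Fin c) F) :
    Matrix (Fin k) (Fin k) (Matrix (Fin c) (Fin c) F) :=
  Matrix.of fun a b =>
    if (a : ℕ) + 1 = b then 1 else if (a : ℕ) + 1 = k ∧ (b : ℕ) = 0 then h else 0

/-- The array of blocks of `(0 h; I_{(k-1)c} 0)`, with `h` of size `c × c`. -/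
def voronoiInvBlocks (k : ℕ) {c : ℕ} (h : Matrix (Fin c) (Fin c) F) :
    Matrix (Fin k) (Fin k) (Matrix (Fin c) (Fin c) F) :=
  Matrix.of fun a b =>
    if (b : ℕ) + 1 = a then 1 else if (b : ℕ) + 1 = k ∧ (a : ℕ) = 0 then h else 0

theorem voronoiBlocks_mul (k : ℕ) {c : ℕ} (h h' : Matrix (Fin c) (Fin c) F) (hh : h * h' = 1) :
    voronoiBlocks k h * voronoiInvBlocks k h' = 1 := by
  ext1 a b
  rw [Matrix.mul_apply, Matrix.one_apply]
  by_cases ha : (a : ℕ) + 1 < k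
  · rw [Finset.sum_eq_single (⟨(a : ℕ) + 1, ha⟩ : Fin k)]
    · by_cases hab : a = b
      · simp [voronoiBlocks, voronoiInvBlocks, hab]
      · have h2 : ¬ (b : ℕ) = a := fun e => hab (Fin.ext e.symm)
        simp [voronoiBlocks, voronoiInvBlocks, hab, h2]
    · intro x _ hx
      have h1 : ¬ (a : ℕ) + 1 = x := fun e => hx (Fin.ext e.symm)
      have h2 : ¬ (a : ℕ) + 1 = k := by omega
      simp [voronoiBlocks, h1, h2]
    · simp
  · have hk : (a : ℕ) + 1 = k := by omega
    rw [Finset.sum_eq_single (⟨0, by omega⟩ : Fin k)]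
    · have hk0 : k ≠ 0 := by omega
      by_cases hab : a = b
      · simp [voronoiBlocks, voronoiInvBlocks, ← hab, hk, hk0, hh]
      · have h2 : ¬ (b : ℕ) + 1 = k := fun e => hab (Fin.ext (by omega))
        simp [voronoiBlocks, voronoiInvBlocks, hab, h2]
    · intro x _ hx
      have h1 : ¬ (a : ℕ) + 1 = x := by omega
      have h2 : ¬ (x : ℕ) = 0 := fun e => hx (Fin.ext e)
      simp [voronoiBlocks, h1, h2]
    · simp

theorem voronoiInvBlocks_mul (k : ℕ) {c : ℕ} (h h' : Matrix (Fin c) (Fin c) F) (hh : h' * h = 1) :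
    voronoiInvBlocks k h' * voronoiBlocks k h = 1 := by
  have e := voronoiBlocks_mul k h h' (mul_eq_one_comm.mp hh)
  have e2 := congrArg (fun M => ofBlocks M) e
  simp only [ofBlocks_mul, ofBlocks_one] at e2
  have e3 := mul_eq_one_comm.mp e2
  rw [← ofBlocks_mul, ← ofBlocks_one] at e3
  exact ((Matrix.reindex finProdFinEquiv finProdFinEquiv).injective.comp
    (Matrix.comp _ _ _ _ _).injective) e3

/-- The element `(0 I_{(k-1)c}; h 0)` of `GL_{kc}(F)`, which is `h` itself if `k = 1`. -/
def voronoi (k : ℕ) {c : ℕ} (h : GL (Fin c) F) : GL (Fin (k * c)) F where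
  val := ofBlocks (voronoiBlocks k (h : Matrix (Fin c) (Fin c) F))
  inv := ofBlocks (voronoiInvBlocks k ((h⁻¹ : GL (Fin c) F) : Matrix (Fin c) (Fin c) F))
  val_inv := by
    rw [← ofBlocks_mul, voronoiBlocks_mul k _ _ (Units.mul_inv h), ofBlocks_one]
  inv_val := by
    rw [← ofBlocks_mul, voronoiInvBlocks_mul k _ _ (Units.inv_mul h), ofBlocks_one]

/-- The special value at `h ∈ GL_c(F)` of the Bessel–Speh function `J` on `GL_{kc}(F)`: it is
`J (0 I_{(k-1)c}; h 0)` for `k ≥ 2`, and `J h * ψ (tr h⁻¹)` for `k = 1`. -/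
def specialValue (ψ : AddChar F ℂ) {k c : ℕ} (J : GL (Fin (k * c)) F → ℂ) (h : GL (Fin c) F) : ℂ :=
  if k = 1 then
    J (voronoi k h) * ψ (((h⁻¹ : GL (Fin c) F) : Matrix (Fin c) (Fin c) F).trace)
  else J (voronoi k h)

end Bessel

end BesselSpeh

/-! The theorem rests on a multiplicity one statement: the `(k, c)_ψ` vectors of the whole induced
representation form at most a line. Let `charAvg` be the projection onto vectors that transform
under the block unipotent group by `ψ_{k,c}`. When these vectors form a line, `charAvg (ρ g v) = J g
• v` for every `v` on it (`IsBesselSpehFunction.charAvg_eq`). This describes `J` without the inner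
product and without a choice of `v`. Hence `J` is unique, and the Bessel–Speh function of the
subrepresentation can be computed inside the induction, with any convenient nonzero vector.

Multiplicity one. The `(k, c)` type condition is used through two consequences: the Zelevinsky
vectors of type `(k^c)` form a line, and no Zelevinsky character with `k` consecutive nontrivial
simple roots occurs (`IsKCType.runVanish`). Under the second condition the `(k, c)_ψ` vectors and
the Zelevinsky vectors of type `(k^c)` span spaces of equal dimension (`finrank_kcSpace`). To see
this, label the indices by pairs (position, line). One unipotent group compares positions, the other
compares lines first, and both characters live on neighbours on a line. Root exchange
(`finrank_patSpace_row_exchange`) turns the first group into the second one line at a time, except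
for the last row of each line. That row acts trivially: otherwise `exists_next_prefix` and
`exists_of_prefix` would produce a vector with a forbidden run. Mackey theory over the shuffles
representing the double cosets carries both properties to the induction
(`runVanish_parabolicInduction`, `finrank_zelevinsky_parabolicInduction_le`): the forbidden run has
length `k₁ + k₂`, and only one shuffle supports a Zelevinsky vector of rectangular type.

The formula. On the open cell there are an explicit `(k, c)_ψ` vector `cellVector` and an explicit
equivariant functional `cellFunctional`, which takes the value `1` on it. Therefore `J g` is the
functional applied to the translate of the vector by `g` (`apply_voronoi_eq`). The functional is a
sum over the matrices `(0 I; I X)`, and the product of such a matrix with `(0 I; h 0)` lies in the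
open cell exactly when the bottom right block `D` of `X` is invertible. In that case its Levi parts
are, up to unipotent factors, the Voronoi elements of `-D⁻¹` and `D h` (`cellUnit_mul_voronoiUnit`).
The characters of the unipotent factors cancel, except that for `k₁ = 1` or `k₂ = 1` they leave
precisely the extra factor in the definition of the special value (`trace_upper`, `trace_lower`).
Each term thus depends only on `D`, the arguments `x = -D⁻¹` and `y = D h` satisfy `x y = -h`, and
averaging over all `X` leaves the constant `q^{-c²}`. -/

namespace BesselSpeh

/-! ### Elementary matrices and their commutator relations. -/

section Transvections

variable {ι F : Type*} [Fintype ι] [DecidableEq ι] [Field F]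

/-- The elementary matrix `1 + t E_{ij}` as an element of `GL`; it is `1` if `i = j`. -/
def tv (i j : ι) (t : F) : GL ι F :=
  if h : i ≠ j then
    ⟨Matrix.transvection i j t, Matrix.transvection i j (-t),
      by rw [Matrix.transvection_mul_transvection_same _ _ h]; simp,
      by rw [Matrix.transvection_mul_transvection_same _ _ h]; simp⟩
  else 1

theorem coe_tv {i j : ι} (h : i ≠ j) (t : F) :
    (tv i j t : Matrix ι ι F) = 1 + Matrix.single i j t := by
  simp [tv, h, Matrix.transvection]

@[simp]
theorem tv_zero (i j : ι) : tv i j (0 : F) = 1 := by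
  by_cases h : i = j
  · simp [tv, h]
  · ext a b
    simp [coe_tv h]

theorem tv_mul_tv_same (i j : ι) (s t : F) : tv i j s * tv i j t = tv i j (s + t) := by
  by_cases h : i = j
  · simp [tv, h]
  · apply Units.ext
    simp only [Units.val_mul, tv, ne_eq, h, not_false_eq_true, dite_true]
    exact Matrix.transvection_mul_transvection_same i j h s t

theorem tv_mul_comm {i j k l : ι} (hij : i ≠ j) (hkl : k ≠ l) (h₁ : j ≠ k) (h₂ : l ≠ i) (s t : F) :
    tv i j s * tv k l t = tv k l t * tv i j s := by
  apply Units.ext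
  simp only [Units.val_mul, coe_tv hij, coe_tv hkl]
  simp [mul_add, add_mul, h₁, h₂]
  abel

theorem tv_mul_tv {i j k : ι} (hij : i ≠ j) (hjk : j ≠ k) (hik : i ≠ k) (s t : F) :
    tv i j s * tv j k t = tv j k t * tv i j s * tv i k (s * t) := by
  apply Units.ext
  simp only [Units.val_mul, coe_tv hij, coe_tv hjk, coe_tv hik]
  simp [mul_add, add_mul, hij.symm, hik.symm]
  abel

theorem tv_mul_tv' {i j k : ι} (hij : i ≠ j) (hjk : j ≠ k) (hik : i ≠ k) (s t : F) :
    tv j k t * tv i j s = tv i j s * tv j k t * tv i k (-(s * t)) := by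
  apply Units.ext
  simp only [Units.val_mul, coe_tv hij, coe_tv hjk, coe_tv hik]
  simp [mul_add, add_mul, hij.symm, hik.symm, ← Matrix.single_neg]
  abel

end Transvections

/-! ### Eigenspaces of families of root subgroups, and the exchange of two roots. -/

section PatternSpace

variable {ι F : Type*} [Fintype ι] [DecidableEq ι] [Field F]
  {V : Type*} [AddCommGroup V] [Module ℂ V]

/-- The vectors on which the root subgroups of the pairs in the relation `R` act through the
character with weights `w`. -/
def patSpace (ψ : AddChar F ℂ) (ρ : Representation ℂ (GL ι F) V) (R : ι → ι → Prop)
    (w : ι → ι → F) : Submodule ℂ V where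
  carrier := {v | ∀ i j, R i j → ∀ t, ρ (tv i j t) v = ψ (w i j * t) • v}
  zero_mem' := by
    intro i j _ t
    simp
  add_mem' := by
    intro a b ha hb i j h t
    simp [ha i j h t, hb i j h t]
  smul_mem' := by
    intro r a ha i j h t
    simp [ha i j h t, smul_comm r]

variable {ψ : AddChar F ℂ} {ρ : Representation ℂ (GL ι F) V} {R : ι → ι → Prop} {w : ι → ι → F}

theorem mem_patSpace {v : V} :
    v ∈ patSpace ψ ρ R w ↔ ∀ i j, R i j → ∀ t, ρ (tv i j t) v = ψ (w i j * t) • v := Iff.rfl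

theorem patSpace_congr {R' : ι → ι → Prop} {w' : ι → ι → F} (hR : ∀ i j, R i j ↔ R' i j)
    (hw : ∀ i j, R i j → w i j = w' i j) : patSpace ψ ρ R w = patSpace ψ ρ R' w' := by
  ext v
  rw [mem_patSpace, mem_patSpace]
  constructor
  · intro h i j hij t
    rw [← hw i j ((hR i j).2 hij)]
    exact h i j ((hR i j).2 hij) t
  · intro h i j hij t
    rw [hw i j hij]
    exact h i j ((hR i j).1 hij) t

theorem patSpace_anti {R' : ι → ι → Prop} {w' : ι → ι → F} (hR : ∀ i j, R' i j → R i j)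
    (hw : ∀ i j, R' i j → w i j = w' i j) : patSpace ψ ρ R w ≤ patSpace ψ ρ R' w' := by
  intro v h i j hij t
  rw [← hw i j hij]
  exact h i j (hR i j hij) t

/-- The root subgroup of `(p, q)` normalizes the group generated by the root subgroups of `R` and
preserves its character with weights `w`. -/
structure Normalizes (R : ι → ι → Prop) (w : ι → ι → F) (p q : ι) : Prop where
  irrefl : ∀ i, ¬ R i i
  ne : p ≠ q
  left : ∀ i, R i p → i ≠ q ∧ R i q ∧ w i q = 0
  right : ∀ j, R q j → j ≠ p ∧ R p j ∧ w p j = 0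

/-- Moving `tv p q t` past a root element of `R` costs at most one commutator, which is a root
element of `R` of weight zero and hence acts trivially. -/
theorem Normalizes.map_mem {p q : ι} (h : Normalizes R w p q) {v : V} (hv : v ∈ patSpace ψ ρ R w)
    (t : F) : ρ (tv p q t) v ∈ patSpace ψ ρ R w := by
  intro i j hij s
  have hne : i ≠ j := fun e => h.irrefl i (e ▸ hij)
  rw [← Module.End.mul_apply, ← map_mul ρ]
  by_cases h₁ : j = p
  · subst h₁
    obtain ⟨h₂, h₃, h₄⟩ := h.left i hij
    rw [tv_mul_tv hne h.ne h₂, map_mul ρ, map_mul ρ, Module.End.mul_apply, Module.End.mul_apply,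
      hv _ _ h₃, h₄, zero_mul, AddChar.map_zero_eq_one, one_smul, hv _ _ hij, map_smul]
  by_cases h₂ : i = q
  · subst h₂
    obtain ⟨h₂, h₃, h₄⟩ := h.right j hij
    rw [tv_mul_tv' h.ne hne (Ne.symm h₂), map_mul ρ, map_mul ρ, Module.End.mul_apply,
      Module.End.mul_apply, hv _ _ h₃, h₄, zero_mul, AddChar.map_zero_eq_one, one_smul,
      hv _ _ hij, map_smul]
  · rw [tv_mul_comm hne h.ne h₁ (Ne.symm h₂), map_mul ρ, Module.End.mul_apply, hv _ _ hij, map_smul]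

variable [Fintype F] [DecidableEq F]

/-- The sum over the root subgroup of `(p, q)` against the character `t ↦ ψ (b t)`. -/
noncomputable def rootSum (ψ : AddChar F ℂ) (ρ : Representation ℂ (GL ι F) V) (p q : ι) (b : F) :
    V →ₗ[ℂ] V :=
  ∑ t, ψ (-(b * t)) • ρ (tv p q t)

theorem rootSum_apply (p q : ι) (b : F) (v : V) :
    rootSum ψ ρ p q b v = ∑ t, ψ (-(b * t)) • ρ (tv p q t) v := by
  simp [rootSum]

theorem tv_rootSum (p q : ι) (b s : F) (v : V) :
    ρ (tv p q s) (rootSum ψ ρ p q b v) = ψ (b * s) • rootSum ψ ρ p q b v := by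
  rw [rootSum_apply, map_sum, Finset.smul_sum]
  refine Fintype.sum_equiv (Equiv.addLeft s) _ _ fun t => ?_
  rw [map_smul, ← Module.End.mul_apply, ← map_mul ρ, tv_mul_tv_same, smul_smul,
    ← AddChar.map_add_eq_mul]
  congr 2
  simp
  ring

theorem sum_char_mul (hψ : ψ ≠ 1) (t : F) :
    ∑ b, ψ (b * t) = if t = 0 then (Fintype.card F : ℂ) else 0 := by
  have := AddChar.sum_mulShift t (AddChar.IsPrimitive.of_ne_one hψ)
  simpa using this

/-- Fourier inversion on the additive group of `F`: a vector is recovered from its components for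
the characters of one root subgroup. -/
theorem sum_rootSum (hψ : ψ ≠ 1) (p q : ι) (v : V) :
    ∑ b, rootSum ψ ρ p q b v = (Fintype.card F : ℂ) • v := by
  simp_rw [rootSum_apply]
  rw [Finset.sum_comm]
  simp_rw [← Finset.sum_smul, ← mul_neg, sum_char_mul hψ]
  simp

theorem Normalizes.rootSum_mem {p q : ι} (h : Normalizes R w p q) {v : V}
    (hv : v ∈ patSpace ψ ρ R w) (b : F) : rootSum ψ ρ p q b v ∈ patSpace ψ ρ R w := by
  rw [rootSum_apply]
  exact Submodule.sum_mem _ fun t _ => Submodule.smul_mem _ _ (h.map_mem hv t)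

/-- A vector of a pattern space has a nonzero component of some weight for every root subgroup that
normalizes the pattern; if the root subgroup acts non-trivially, the weight can be taken nonzero. -/
theorem Normalizes.exists_weight (hψ : ψ ≠ 1) {p q : ι} (h : Normalizes R w p q) {v : V}
    (hv : v ∈ patSpace ψ ρ R w) (hv₀ : v ≠ 0) :
    ∃ b, ∃ v' ∈ patSpace ψ ρ R w, v' ≠ 0 ∧ (∀ t, ρ (tv p q t) v' = ψ (b * t) • v') ∧
      ((∃ t, ρ (tv p q t) v ≠ v) → b ≠ 0) := by
  have hq : (Fintype.card F : ℂ) ≠ 0 := by simp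
  by_cases hex : ∃ b, b ≠ 0 ∧ rootSum ψ ρ p q b v ≠ 0
  · obtain ⟨b, hb, hne⟩ := hex
    exact ⟨b, _, h.rootSum_mem hv b, hne, fun t => tv_rootSum p q b t v, fun _ => hb⟩
  · push Not at hex
    -- With no component of nonzero weight left, `v` is a multiple of its weight zero component, so
    -- the root subgroup fixes it.
    have hs := sum_rootSum (ρ := ρ) hψ p q v
    rw [Finset.sum_eq_single 0 (fun b _ hb => hex b hb) (by simp)] at hs
    refine ⟨0, _, h.rootSum_mem hv 0, ?_, fun t => tv_rootSum p q 0 t v, ?_⟩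
    · rw [hs]
      exact smul_ne_zero hq hv₀
    · rintro ⟨t, ht⟩
      refine absurd ?_ ht
      have h₁ := tv_rootSum (ψ := ψ) (ρ := ρ) p q 0 t v
      rw [hs, map_smul] at h₁
      simpa [hq] using h₁

/-- Root exchange: averaging over the subgroup of `(q, r)` is injective on vectors fixed by that of
`(p, q)`. The commutator of the two subgroups lies in that of `(p, r)`, where the character is
nontrivial, so acting by `tv p q s` twists the terms of the average by all additive characters, and
orthogonality isolates the term of `1`, which is `v`. -/
theorem finrank_patSpace_le_of_exchange [FiniteDimensional ℂ V] (hψ : ψ ≠ 1) {p q r : ι}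
    (hβ : Normalizes R w q r) (hpr : p ≠ r) (hpq : p ≠ q) (hR : R p r) (hw : w p r ≠ 0)
    (hwα : w p q = 0) (hwβ : w q r = 0) :
    Module.finrank ℂ (patSpace ψ ρ (fun i j => R i j ∨ (i = p ∧ j = q)) w) ≤
      Module.finrank ℂ (patSpace ψ ρ (fun i j => R i j ∨ (i = q ∧ j = r)) w) := by
  have hmem : ∀ v ∈ patSpace ψ ρ (fun i j => R i j ∨ (i = p ∧ j = q)) w, v ∈ patSpace ψ ρ R w :=
    fun v hv => patSpace_anti (fun i j h => Or.inl h) (fun _ _ _ => rfl) hv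
  refine LinearMap.finrank_le_finrank_of_injective
    (f := (rootSum ψ ρ q r 0).restrict (p := patSpace ψ ρ (fun i j => R i j ∨ (i = p ∧ j = q)) w)
      (q := patSpace ψ ρ (fun i j => R i j ∨ (i = q ∧ j = r)) w) ?_) ?_
  · rintro v hv i j (hij | ⟨rfl, rfl⟩) t
    · exact hβ.rootSum_mem (hmem v hv) 0 i j hij t
    · rw [tv_rootSum, hwβ]
  · rw [← LinearMap.ker_eq_bot, LinearMap.ker_eq_bot']
    rintro ⟨v, hv⟩ h₀
    have h₀ : rootSum ψ ρ q r 0 v = 0 := congrArg Subtype.val h₀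
    -- Applying `tv p q s` to a vanishing average gives all of its twists; their sum over `s` is
    -- `|F| • v`.
    have key : ∀ s, ∑ t, ψ (s * (w p r * t)) • ρ (tv q r t) v = 0 := by
      intro s
      rw [← map_zero (ρ (tv p q s)), ← h₀, rootSum_apply, map_sum]
      refine Finset.sum_congr rfl fun t _ => ?_
      rw [map_smul, ← Module.End.mul_apply, ← map_mul ρ, tv_mul_tv hpq hβ.ne hpr, map_mul ρ, map_mul ρ,
        Module.End.mul_apply, Module.End.mul_apply, hv p r (Or.inl hR), map_smul,
        hv p q (Or.inr ⟨rfl, rfl⟩), hwα]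
      simp
      congr 2
      ring
    have h₁ : ∑ s, ∑ t, ψ (s * (w p r * t)) • ρ (tv q r t) v = 0 :=
      Finset.sum_eq_zero fun s _ => key s
    rw [Finset.sum_comm] at h₁
    simp_rw [← Finset.sum_smul, sum_char_mul hψ] at h₁
    simpa [hw] using h₁

/-- The same argument with the two roots interchanged; the opposite commutator accounts for the sign
of the weight. -/
theorem finrank_patSpace_le_of_exchange' [FiniteDimensional ℂ V] (hψ : ψ ≠ 1) {p q r : ι}
    (hα : Normalizes R w p q) (hpr : p ≠ r) (hqr : q ≠ r) (hR : R p r) (hw : w p r ≠ 0)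
    (hwα : w p q = 0) (hwβ : w q r = 0) :
    Module.finrank ℂ (patSpace ψ ρ (fun i j => R i j ∨ (i = q ∧ j = r)) w) ≤
      Module.finrank ℂ (patSpace ψ ρ (fun i j => R i j ∨ (i = p ∧ j = q)) w) := by
  have hmem : ∀ v ∈ patSpace ψ ρ (fun i j => R i j ∨ (i = q ∧ j = r)) w, v ∈ patSpace ψ ρ R w :=
    fun v hv => patSpace_anti (fun i j h => Or.inl h) (fun _ _ _ => rfl) hv
  refine LinearMap.finrank_le_finrank_of_injective
    (f := (rootSum ψ ρ p q 0).restrict (p := patSpace ψ ρ (fun i j => R i j ∨ (i = q ∧ j = r)) w)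
      (q := patSpace ψ ρ (fun i j => R i j ∨ (i = p ∧ j = q)) w) ?_) ?_
  · rintro v hv i j (hij | ⟨rfl, rfl⟩) t
    · exact hα.rootSum_mem (hmem v hv) 0 i j hij t
    · rw [tv_rootSum, hwα]
  · rw [← LinearMap.ker_eq_bot, LinearMap.ker_eq_bot']
    rintro ⟨v, hv⟩ h₀
    have h₀ : rootSum ψ ρ p q 0 v = 0 := congrArg Subtype.val h₀
    have key : ∀ s, ∑ t, ψ (s * (-w p r * t)) • ρ (tv p q t) v = 0 := by
      intro s
      rw [← map_zero (ρ (tv q r s)), ← h₀, rootSum_apply, map_sum]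
      refine Finset.sum_congr rfl fun t _ => ?_
      rw [map_smul, ← Module.End.mul_apply, ← map_mul ρ, tv_mul_tv' hα.ne hqr hpr, map_mul ρ, map_mul ρ,
        Module.End.mul_apply, Module.End.mul_apply, hv p r (Or.inl hR), map_smul,
        hv q r (Or.inr ⟨rfl, rfl⟩), hwβ]
      simp
      congr 2
      ring
    have h₁ : ∑ s, ∑ t, ψ (s * (-w p r * t)) • ρ (tv p q t) v = 0 :=
      Finset.sum_eq_zero fun s _ => key s
    rw [Finset.sum_comm] at h₁
    simp_rw [← Finset.sum_smul, sum_char_mul hψ] at h₁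
    simpa [hw] using h₁

end PatternSpace

/-! ### Pattern groups of strict orders and their characters. -/

section PatternGroup

variable {ι F : Type*} [Fintype ι] [DecidableEq ι] [Field F]

/-- Membership in the pattern group of the relation `R`: the diagonal entries are `1`, and the
off-diagonal entries vanish outside `R`. -/
def InPattern (R : ι → ι → Prop) (u : GL ι F) : Prop :=
  (∀ i, (u : Matrix ι ι F) i i = 1) ∧ ∀ i j, i ≠ j → (u : Matrix ι ι F) i j ≠ 0 → R i j

theorem tv_apply {i j : ι} (h : i ≠ j) (t : F) (a b : ι) :
    (tv i j t : Matrix ι ι F) a b = (if a = b then 1 else 0) + if a = i ∧ b = j then t else 0 := by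
  simp [coe_tv h, Matrix.one_apply, Matrix.single_apply, eq_comm]

theorem mul_tv_apply {i j : ι} (h : i ≠ j) (t : F) (u : GL ι F) (a b : ι) :
    ((u * tv i j t : GL ι F) : Matrix ι ι F) a b =
      (u : Matrix ι ι F) a b + if b = j then (u : Matrix ι ι F) a i * t else 0 := by
  rw [Matrix.GeneralLinearGroup.coe_mul, coe_tv h, mul_add, mul_one, Matrix.add_apply]
  congr 1
  by_cases hb : b = j
  · subst hb
    simp
  · simp [hb, Matrix.mul_single_apply_of_ne _ _ _ _ _ hb]

variable {R : ι → ι → Prop}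

theorem inPattern_one : InPattern R (1 : GL ι F) :=
  ⟨fun i => by simp, fun i j h h' => absurd (by simp [h]) h'⟩

theorem inPattern_tv (hR : ∀ i, ¬ R i i) {i j : ι} (hij : R i j) (t : F) :
    InPattern R (tv i j t) := by
  have hne : i ≠ j := fun e => hR i (e ▸ hij)
  constructor
  · intro a
    have : ¬ (a = i ∧ a = j) := fun h => hne (h.1.symm.trans h.2)
    simp [tv_apply hne, this]
  · intro a b hab h
    rw [tv_apply hne, if_neg hab, zero_add] at h
    obtain ⟨rfl, rfl⟩ := by_contra fun h' => h (if_neg h')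
    exact hij

theorem InPattern.mul (hR : ∀ i, ¬ R i i) (hT : ∀ i j k, R i j → R j k → R i k) {u v : GL ι F}
    (hu : InPattern R u) (hv : InPattern R v) : InPattern R (u * v) := by
  have key : ∀ i j k, (u : Matrix ι ι F) i j * (v : Matrix ι ι F) j k ≠ 0 →
      (i = j ∨ R i j) ∧ (j = k ∨ R j k) := by
    intro i j k h
    have h₁ := left_ne_zero_of_mul h
    have h₂ := right_ne_zero_of_mul h
    exact ⟨or_iff_not_imp_left.2 fun e => hu.2 _ _ e h₁,
      or_iff_not_imp_left.2 fun e => hv.2 _ _ e h₂⟩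
  constructor
  · intro i
    rw [Matrix.GeneralLinearGroup.coe_mul, Matrix.mul_apply, Finset.sum_eq_single i]
    · rw [hu.1, hv.1, one_mul]
    · intro j _ hj
      by_contra h
      obtain ⟨h₁ | h₁, h₂ | h₂⟩ := key i j i h
      · exact hj h₁.symm
      · exact hj h₁.symm
      · exact hj h₂
      · exact hR i (hT _ _ _ h₁ h₂)
    · simp
  · intro i k hik h
    rw [Matrix.GeneralLinearGroup.coe_mul, Matrix.mul_apply] at h
    obtain ⟨j, _, hj⟩ := Finset.exists_ne_zero_of_sum_ne_zero h
    obtain ⟨h₁ | h₁, h₂ | h₂⟩ := key i j k hj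
    · exact absurd (h₁.trans h₂) hik
    · exact h₁ ▸ h₂
    · exact h₂ ▸ h₁
    · exact hT _ _ _ h₁ h₂

-- A pair with nothing between its members can be removed from a transitive relation without
-- destroying transitivity. It is found by minimising the number of intermediate elements.
open Classical in
theorem exists_cover (hR : ∀ i, ¬ R i i) (hT : ∀ i j k, R i j → R j k → R i k)
    (hne : ∃ i j, R i j) : ∃ i j, R i j ∧ ∀ k, R i k → ¬ R k j := by
  obtain ⟨i₀, j₀, h₀⟩ := hne
  obtain ⟨⟨i, j⟩, hij, hmin⟩ := Finset.exists_min_image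
    (Finset.univ.filter fun x : ι × ι => R x.1 x.2)
    (fun x => (Finset.univ.filter fun k => R x.1 k ∧ R k x.2).card) ⟨(i₀, j₀), by simpa using h₀⟩
  simp only [Finset.mem_filter, Finset.mem_univ, true_and] at hij
  refine ⟨i, j, hij, fun k hik hkj => ?_⟩
  refine absurd (hmin (i, k) (by simpa using hik)) (not_le.2 (Finset.card_lt_card ?_))
  rw [Finset.ssubset_iff_of_subset]
  · exact ⟨k, by simp [hik, hkj], by simp [hR]⟩
  · intro l hl
    simp only [Finset.mem_filter, Finset.mem_univ, true_and] at hl ⊢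
    exact ⟨hl.1, hT _ _ _ hl.2 hkj⟩

open Classical in
/-- The pattern group of a strict order is generated by the root subgroups in it. -/
theorem InPattern.induction {P : GL ι F → Prop} (hR : ∀ i, ¬ R i i)
    (hT : ∀ i j k, R i j → R j k → R i k) (h₁ : P 1)
    (hmul : ∀ u, InPattern R u → P u → ∀ i j, R i j → ∀ t, P (u * tv i j t)) {u : GL ι F}
    (hu : InPattern R u) : P u := by
  have key : ∀ (n : ℕ) (R' : ι → ι → Prop), (∀ i j, R' i j → R i j) →
      (∀ i j k, R' i j → R' j k → R' i k) →
      (Finset.univ.filter fun x : ι × ι => R' x.1 x.2).card = n →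
      ∀ u, InPattern R' u → P u := by
    intro n
    induction n with
    | zero =>
      intro R' _ _ hcard u hu
      rw [Finset.card_eq_zero] at hcard
      have : u = 1 := by
        ext i j
        by_cases hij : i = j
        · subst hij
          simp [hu.1]
        · have h0 : (u : Matrix ι ι F) i j = 0 := by
            by_contra h
            have : (i, j) ∈ Finset.univ.filter fun x : ι × ι => R' x.1 x.2 := by
              simpa using hu.2 i j hij h
            rw [hcard] at this
            simp at this
          simp [h0, hij]
      rw [this]
      exact h₁
    | succ n ih =>
      intro R' hsub hT' hcard u hu
      have hR' : ∀ i, ¬ R' i i := fun i h => hR i (hsub _ _ h)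
      obtain ⟨⟨i₀, j₀⟩, h₀⟩ : (Finset.univ.filter fun x : ι × ι => R' x.1 x.2).Nonempty := by
        rw [← Finset.card_pos, hcard]
        omega
      obtain ⟨i, j, hij, hcov⟩ := exists_cover hR' hT' ⟨i₀, j₀, by simpa using h₀⟩
      have hne : i ≠ j := fun e => hR' i (e ▸ hij)
      -- Multiplication by `tv i j (-t)` clears the entry of the covering pair, so the quotient lies
      -- in a smaller pattern group.
      set t := (u : Matrix ι ι F) i j with ht
      have hu' : InPattern (fun a b => R' a b ∧ ¬ (a = i ∧ b = j)) (u * tv i j (-t)) := by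
        have hu₁ := hu.mul hR' hT' (inPattern_tv hR' hij (-t))
        refine ⟨hu₁.1, fun a b hab h => ⟨hu₁.2 a b hab h, ?_⟩⟩
        rintro ⟨rfl, rfl⟩
        apply h
        rw [mul_tv_apply hne, if_pos rfl, hu.1, ← ht]
        ring
      have h := ih (fun a b => R' a b ∧ ¬ (a = i ∧ b = j)) (fun a b h => hsub _ _ h.1)
        (by
          rintro a b d ⟨hab, _⟩ ⟨hbd, _⟩
          refine ⟨hT' _ _ _ hab hbd, ?_⟩
          rintro ⟨rfl, rfl⟩
          exact hcov _ hab hbd)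
        (by
          have hc : ((Finset.univ.filter fun x : ι × ι => R' x.1 x.2).erase (i, j)).card = n := by
            rw [Finset.card_erase_of_mem (by simpa using hij), hcard]
            rfl
          refine Eq.trans (congrArg Finset.card ?_) hc
          ext ⟨a, b⟩
          simp [and_comm]) _ hu'
      have hu'' : InPattern R (u * tv i j (-t)) :=
        ⟨hu'.1, fun a b hab h => hsub _ _ (hu'.2 a b hab h).1⟩
      have := hmul _ hu'' h i j (hsub _ _ hij) t
      rwa [mul_assoc, tv_mul_tv_same, neg_add_cancel, tv_zero, mul_one] at this
  exact key _ R (fun _ _ h => h) hT rfl u hu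

/-- The linear form `u ↦ ∑ w i j * u i j`, over `i ≠ j`. -/
def patForm (w : ι → ι → F) (u : GL ι F) : F :=
  ∑ i, ∑ j, if i = j then 0 else w i j * (u : Matrix ι ι F) i j

theorem patForm_one (w : ι → ι → F) : patForm w (1 : GL ι F) = 0 := by
  refine Finset.sum_eq_zero fun i _ => Finset.sum_eq_zero fun j _ => ?_
  by_cases h : i = j <;> simp [h]

/-- Column `j` changes by `t` times column `i`. For `a ≠ i` a nonzero change at `(a, j)` requires `R
a i`; then `i` lies between `a` and `j`, and the weight there is zero. -/
theorem patForm_mul_tv {w : ι → ι → F} (hR : ∀ i, ¬ R i i)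
    (hw : ∀ i j k, R i j → R j k → w i k = 0) {u : GL ι F} (hu : InPattern R u) {i j : ι}
    (hij : R i j) (t : F) : patForm w (u * tv i j t) = patForm w u + w i j * t := by
  have hne : i ≠ j := fun e => hR i (e ▸ hij)
  have : ∀ a b, (if a = b then 0 else w a b * ((u * tv i j t : GL ι F) : Matrix ι ι F) a b) =
      (if a = b then 0 else w a b * (u : Matrix ι ι F) a b) +
        if a = i ∧ b = j then w i j * t else 0 := by
    intro a b
    rw [mul_tv_apply hne]
    by_cases hab : a = b
    · subst hab
      have : ¬ (a = i ∧ a = j) := fun h => hne (h.1.symm.trans h.2)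
      simp [this]
    by_cases hb : b = j
    · subst hb
      by_cases ha : a = i
      · subst ha
        simp [hab, hu.1, mul_add]
      · have : w a b * (u : Matrix ι ι F) a i = 0 := by
          by_contra h
          exact left_ne_zero_of_mul h (hw _ _ _ (hu.2 a i ha (right_ne_zero_of_mul h)) hij)
        simp [hab, ha, mul_add, ← mul_assoc, this]
    · simp [hab, hb]
  unfold patForm
  simp_rw [this, Finset.sum_add_distrib]
  congr 1
  rw [Finset.sum_eq_single i (fun a _ ha => Finset.sum_eq_zero fun b _ => by simp [ha]) (by simp)]
  simp

theorem patForm_mul {w : ι → ι → F} (hR : ∀ i, ¬ R i i)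
    (hT : ∀ i j k, R i j → R j k → R i k)
    (hw : ∀ i j k, R i j → R j k → w i k = 0) {u v : GL ι F} (hu : InPattern R u)
    (hv : InPattern R v) : patForm w (u * v) = patForm w u + patForm w v := by
  refine hv.induction hR hT (P := fun v => patForm w (u * v) = patForm w u + patForm w v) ?_ ?_
  · simp [patForm_one]
  · intro v hv h i j hij t
    rw [← mul_assoc, patForm_mul_tv hR hw (hu.mul hR hT hv) hij, h, patForm_mul_tv hR hw hv hij]
    ring

variable {V : Type*} [AddCommGroup V] [Module ℂ V] {ψ : AddChar F ℂ}
  {ρ : Representation ℂ (GL ι F) V}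

/-- A vector of the pattern space of a strict order transforms under the pattern group by its
character, if the weights live on covering pairs. -/
theorem apply_of_mem_patSpace {w : ι → ι → F} (hR : ∀ i, ¬ R i i)
    (hT : ∀ i j k, R i j → R j k → R i k)
    (hw : ∀ i j k, R i j → R j k → w i k = 0) {v : V} (hv : v ∈ patSpace ψ ρ R w)
    {u : GL ι F} (hu : InPattern R u) : ρ u v = ψ (patForm w u) • v := by
  refine hu.induction hR hT (P := fun u => ρ u v = ψ (patForm w u) • v) ?_ ?_
  · simp [patForm_one]
  · intro u hu h i j hij t
    rw [map_mul ρ, Module.End.mul_apply, hv i j hij, map_smul, h, patForm_mul_tv hR hw hu hij,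
      AddChar.map_add_eq_mul, smul_smul, mul_comm]

theorem patForm_tv {w : ι → ι → F} {i j : ι} (h : i ≠ j) (t : F) :
    patForm w (tv i j t) = w i j * t := by
  have := patForm_mul_tv (R := fun a b => a = i ∧ b = j) (w := w)
    (fun a e => h (e.1.symm.trans e.2)) (fun a b d e e' => absurd (e'.1.symm.trans e.2) h)
    (inPattern_one (F := F)) ⟨rfl, rfl⟩ t
  rwa [one_mul, patForm_one, zero_add] at this

theorem mem_patSpace_iff {w : ι → ι → F} (hR : ∀ i, ¬ R i i)
    (hT : ∀ i j k, R i j → R j k → R i k)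
    (hw : ∀ i j k, R i j → R j k → w i k = 0) {v : V} :
    v ∈ patSpace ψ ρ R w ↔ ∀ u, InPattern R u → ρ u v = ψ (patForm w u) • v := by
  refine ⟨fun hv u hu => apply_of_mem_patSpace hR hT hw hv hu, fun h i j hij t => ?_⟩
  have hne : i ≠ j := fun e => hR i (e ▸ hij)
  rw [h _ (inPattern_tv hR hij t), patForm_tv hne]

/-- The pattern group of a strict order. -/
def patGroup [Finite F] (R : ι → ι → Prop) (hR : ∀ i, ¬ R i i)
    (hT : ∀ i j k, R i j → R j k → R i k) : Subgroup (GL ι F) where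
  carrier := {u | InPattern R u}
  one_mem' := inPattern_one
  mul_mem' hu hv := InPattern.mul hR hT hu hv
  inv_mem' := by
    intro u hu
    -- Over a finite field the inverse is a power, so closure under products suffices.
    have hpow : ∀ n : ℕ, InPattern R (u ^ n) := by
      intro n
      induction n with
      | zero => simpa using inPattern_one
      | succ n ih =>
        rw [pow_succ]
        exact ih.mul hR hT hu
    have : Finite (GL ι F) := inferInstanceAs (Finite (Matrix ι ι F)ˣ)
    have h : u⁻¹ = u ^ (orderOf u - 1) := by
      rw [inv_eq_iff_mul_eq_one, ← pow_succ', Nat.sub_add_cancel (orderOf_pos u), pow_orderOf_eq_one]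
    change InPattern R u⁻¹
    rw [h]
    exact hpow _

end PatternGroup

/-! ### Exchange of a column segment for a row segment. -/

section RowExchange

variable {ι F : Type*} [Fintype ι] [DecidableEq ι] [Field F] [Fintype F] [DecidableEq F]
  {V : Type*} [AddCommGroup V] [Module ℂ V] [FiniteDimensional ℂ V]
  {ψ : AddChar F ℂ} {ρ : Representation ℂ (GL ι F) V}

/-- Exchange of the roots `(s, r)` for the roots `(p, s)`, `s ∈ S`, where `(p, r)` carries a nonzero
weight. -/
theorem finrank_patSpace_row_exchange (hψ : ψ ≠ 1) {R : ι → ι → Prop} {w : ι → ι → F} {p r : ι}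
    (S : Finset ι) (ht : ι → ℕ) (hR : ∀ i, ¬ R i i) (hpr : R p r) (hwpr : w p r ≠ 0)
    (hp : p ∉ S) (hr : r ∉ S) (hps : ∀ s ∈ S, w p s = 0 ∧ ¬ R p s)
    (hsr : ∀ s ∈ S, w s r = 0 ∧ ¬ R s r)
    (hht : ∀ s ∈ S, ∀ s' ∈ S, R s s' → ht s < ht s')
    (h₁ : ∀ i, ∀ s ∈ S, R i p → i ∉ S ∧ R i s ∧ w i s = 0)
    (h₂ : ∀ i, ∀ s ∈ S, R s i → i ≠ p ∧ w p i = 0 ∧ (i ∈ S ∨ R p i))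
    (h₃ : ∀ i, ∀ s ∈ S, R i s → i ≠ r ∧ w i r = 0 ∧ (i ∈ S ∨ R i r))
    (h₄ : ∀ i, ∀ s ∈ S, R r i → i ∉ S ∧ R s i ∧ w s i = 0) :
    Module.finrank ℂ (patSpace ψ ρ (fun i j => R i j ∨ (i ∈ S ∧ j = r)) w) =
      Module.finrank ℂ (patSpace ψ ρ (fun i j => R i j ∨ (i = p ∧ j ∈ S)) w) := by
  have hpr' : p ≠ r := fun e => hR p (e ▸ hpr)
  -- `D` is the part of `S` already exchanged. Elements join it in order of decreasing height, so it
  -- stays upward closed in `S`; this is what makes both exchanged roots normalize the intermediate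
  -- pattern.
  have key : ∀ D : Finset ι, D ⊆ S → (∀ s ∈ D, ∀ s' ∈ S, R s s' → s' ∈ D) →
      Module.finrank ℂ (patSpace ψ ρ (fun i j => R i j ∨ (i ∈ S ∧ j = r)) w) =
      Module.finrank ℂ (patSpace ψ ρ
        (fun i j => R i j ∨ (i = p ∧ j ∈ D) ∨ (i ∈ S ∧ i ∉ D ∧ j = r)) w) := by
    intro D
    induction D using Finset.induction_on_min_value ht with
    | empty =>
      intro _ _
      rw [patSpace_congr (R' := fun i j => R i j ∨ (i = p ∧ j ∈ (∅ : Finset ι)) ∨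
        (i ∈ S ∧ i ∉ (∅ : Finset ι) ∧ j = r)) (by simp) (fun _ _ _ => rfl)]
    | insert s D hsD hmin ih =>
      intro hDS hcl
      have hsS : s ∈ S := hDS (Finset.mem_insert_self _ _)
      have hDS' : ∀ {x}, x ∈ D → x ∈ S := fun h => hDS (Finset.mem_insert_of_mem h)
      have hcl' : ∀ s ∈ D, ∀ s' ∈ S, R s s' → s' ∈ D := by
        intro x hx x' hx' hxx'
        refine Finset.mem_of_mem_insert_of_ne (hcl x (Finset.mem_insert_of_mem hx) x' hx' hxx') ?_
        rintro rfl
        exact absurd (hht _ (hDS' hx) _ hsS hxx') (not_lt.2 (hmin x hx))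
      rw [ih (fun x hx => hDS' hx) hcl']
      set R' : ι → ι → Prop := fun i j =>
        R i j ∨ (i = p ∧ j ∈ D) ∨ (i ∈ S ∧ i ∉ insert s D ∧ j = r) with hR'
      have hsp : s ≠ p := fun e => hp (e ▸ hsS)
      have hsr' : s ≠ r := fun e => hr (e ▸ hsS)
      have hirr : ∀ i, ¬ R' i i := by
        rintro i (h | ⟨rfl, h⟩ | ⟨h, _, rfl⟩)
        · exact hR i h
        · exact hp (hDS' h)
        · exact hr h
      have hα : Normalizes R' w p s := by
        refine ⟨hirr, hsp.symm, ?_, ?_⟩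
        · rintro i (h | ⟨_, h⟩ | ⟨_, _, h⟩)
          · obtain ⟨ha, hb, hc⟩ := h₁ i s hsS h
            exact ⟨fun e => ha (e ▸ hsS), Or.inl hb, hc⟩
          · exact absurd (hDS' h) hp
          · exact absurd h hpr'
        · rintro j (h | ⟨h, _⟩ | ⟨_, h, _⟩)
          · obtain ⟨ha, hb, hc⟩ := h₂ j s hsS h
            refine ⟨ha, ?_, hb⟩
            rcases hc with hc | hc
            · refine Or.inr (Or.inl ⟨rfl, Finset.mem_of_mem_insert_of_ne
                (hcl s (Finset.mem_insert_self _ _) j hc h) ?_⟩)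
              rintro rfl
              exact hR _ h
            · exact Or.inl hc
          · exact absurd h hsp
          · simp at h
      have hβ : Normalizes R' w s r := by
        refine ⟨hirr, hsr', ?_, ?_⟩
        · rintro i (h | ⟨_, h⟩ | ⟨_, _, h⟩)
          · obtain ⟨ha, hb, hc⟩ := h₃ i s hsS h
            refine ⟨ha, ?_, hb⟩
            rcases hc with hc | hc
            · refine Or.inr (Or.inr ⟨hc, ?_, rfl⟩)
              intro hi
              rcases Finset.mem_insert.1 hi with rfl | hi
              · exact hR _ h
              · exact hsD (hcl' i hi s hsS h)
            · exact Or.inl hc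
          · exact absurd h hsD
          · exact absurd h hsr'
        · rintro j (h | ⟨h, _⟩ | ⟨h, _, _⟩)
          · obtain ⟨ha, hb, hc⟩ := h₄ j s hsS h
            exact ⟨fun e => ha (e ▸ hsS), Or.inl hb, hc⟩
          · exact absurd h hpr'.symm
          · exact absurd h hr
      have e₁ : patSpace ψ ρ (fun i j => R i j ∨ (i = p ∧ j ∈ D) ∨ (i ∈ S ∧ i ∉ D ∧ j = r)) w =
          patSpace ψ ρ (fun i j => R' i j ∨ (i = s ∧ j = r)) w := by
        refine patSpace_congr (fun i j => ?_) (fun _ _ _ => rfl)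
        simp only [hR', Finset.mem_insert, not_or]
        by_cases his : i = s
        · subst his
          tauto
        · tauto
      have e₂ : patSpace ψ ρ (fun i j => R i j ∨ (i = p ∧ j ∈ insert s D) ∨
          (i ∈ S ∧ i ∉ insert s D ∧ j = r)) w =
          patSpace ψ ρ (fun i j => R' i j ∨ (i = p ∧ j = s)) w := by
        refine patSpace_congr (fun i j => ?_) (fun _ _ _ => rfl)
        simp only [hR', Finset.mem_insert, not_or]
        tauto
      rw [e₁, e₂]
      exact le_antisymm
        (finrank_patSpace_le_of_exchange' hψ hα hpr' hsr' (Or.inl hpr) hwpr (hps s hsS).1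
          (hsr s hsS).1)
        (finrank_patSpace_le_of_exchange hψ hβ hpr' hsp.symm (Or.inl hpr) hwpr (hps s hsS).1
          (hsr s hsS).1)
  rw [key S (Finset.Subset.refl _) (fun _ _ s' hs' _ => hs')]
  refine congrArg (fun W : Submodule ℂ V => Module.finrank ℂ W) ?_
  exact patSpace_congr (fun i j => by tauto) (fun _ _ _ => rfl)

end RowExchange

/-! ### Permutation matrices and relabelling of indices. -/

section Permutations

variable {ι κ F : Type*} [Fintype ι] [DecidableEq ι] [Fintype κ] [DecidableEq κ] [Field F]

/-- The permutation matrix with `permGL σ e_j = e_{σ j}`. -/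
def permGL (σ : Equiv.Perm ι) : GL ι F where
  val := Matrix.of fun i j => if i = σ j then 1 else 0
  inv := Matrix.of fun i j => if σ i = j then 1 else 0
  val_inv := by
    ext i j
    rw [Matrix.mul_apply, Finset.sum_eq_single (σ.symm i)]
    · simp [Matrix.one_apply]
    · intro x _ hx
      have : i ≠ σ x := fun e => hx (by simp [e])
      simp [this]
    · simp
  inv_val := by
    ext i j
    rw [Matrix.mul_apply, Finset.sum_eq_single (σ i)]
    · simp [Matrix.one_apply]
    · intro x _ hx
      simp [hx.symm]
    · simp

theorem mul_permGL_apply (σ : Equiv.Perm ι) (g : GL ι F) (i j : ι) :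
    ((g * permGL σ : GL ι F) : Matrix ι ι F) i j = (g : Matrix ι ι F) i (σ j) := by
  rw [Matrix.GeneralLinearGroup.coe_mul, Matrix.mul_apply, Finset.sum_eq_single (σ j)]
  · simp [permGL]
  · intro x _ hx
    simp [permGL, hx]
  · simp

theorem permGL_mul_apply (σ : Equiv.Perm ι) (g : GL ι F) (i j : ι) :
    ((permGL σ * g : GL ι F) : Matrix ι ι F) i j = (g : Matrix ι ι F) (σ.symm i) j := by
  rw [Matrix.GeneralLinearGroup.coe_mul, Matrix.mul_apply, Finset.sum_eq_single (σ.symm i)]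
  · simp [permGL]
  · intro x _ hx
    have : i ≠ σ x := fun e => hx (by simp [e])
    simp [permGL, this]
  · simp

theorem permGL_mul_tv (σ : Equiv.Perm ι) {i j : ι} (h : i ≠ j) (t : F) :
    permGL σ * tv i j t = tv (σ i) (σ j) t * permGL σ := by
  ext a b
  rw [permGL_mul_apply, mul_permGL_apply, tv_apply h, tv_apply (σ.injective.ne h)]
  congr 1
  · simp [Equiv.symm_apply_eq]
  · simp [Equiv.symm_apply_eq, σ.injective.eq_iff]

/-- Relabelling of the indices of `GL`. -/
def glReindex (e : ι ≃ κ) : GL ι F ≃* GL κ F :=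
  Units.mapEquiv (Matrix.reindexAlgEquiv F F e).toMulEquiv

theorem glReindex_apply (e : ι ≃ κ) (g : GL ι F) (i j : κ) :
    (glReindex e g : Matrix κ κ F) i j = (g : Matrix ι ι F) (e.symm i) (e.symm j) := rfl

theorem glReindex_tv (e : ι ≃ κ) {i j : ι} (h : i ≠ j) (t : F) :
    glReindex e (tv i j t) = tv (e i) (e j) t := by
  ext a b
  rw [glReindex_apply, tv_apply h, tv_apply (e.injective.ne h)]
  congr 1
  · simp [e.symm.injective.eq_iff]
  · simp [Equiv.symm_apply_eq]

variable {V : Type*} [AddCommGroup V] [Module ℂ V] {ψ : AddChar F ℂ}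

theorem patSpace_comp_glReindex (ρ : Representation ℂ (GL κ F) V) (e : ι ≃ κ) {R : ι → ι → Prop}
    (hR : ∀ i, ¬ R i i) (w : ι → ι → F) :
    patSpace ψ (ρ.comp (glReindex e).toMonoidHom) R w =
      patSpace ψ ρ (fun i j => R (e.symm i) (e.symm j)) fun i j => w (e.symm i) (e.symm j) := by
  ext v
  rw [mem_patSpace, mem_patSpace]
  constructor
  · intro h i j hij t
    have hne : e.symm i ≠ e.symm j := fun h => hR _ (h ▸ hij)
    rw [← h _ _ hij]
    change _ = ρ (glReindex e _) v
    rw [glReindex_tv e hne]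
    simp
  · intro h i j hij t
    have hne : i ≠ j := fun h => hR _ (h ▸ hij)
    change ρ (glReindex e _) v = _
    rw [glReindex_tv e hne, h _ _ (by simpa using hij)]
    simp

/-- The two labellings differ by a permutation, and its matrix carries the first pattern space
injectively into the second. -/
theorem finrank_patSpace_comp_glReindex_le [FiniteDimensional ℂ V]
    (ρ : Representation ℂ (GL κ F) V) (e e' : ι ≃ κ) {R : ι → ι → Prop}
    (hR : ∀ i, ¬ R i i) (w : ι → ι → F) :
    Module.finrank ℂ (patSpace ψ (ρ.comp (glReindex e).toMonoidHom) R w) ≤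
      Module.finrank ℂ (patSpace ψ (ρ.comp (glReindex e').toMonoidHom) R w) := by
  refine LinearMap.finrank_le_finrank_of_injective
    (f := (ρ (permGL (e.symm.trans e'))).restrict ?_) ?_
  · intro v hv i j hij t
    have hne : i ≠ j := fun h => hR _ (h ▸ hij)
    have h := hv i j hij t
    change ρ (glReindex e _) v = _ at h
    change ρ (glReindex e' _) _ = _
    rw [glReindex_tv _ hne] at h ⊢
    have hc := permGL_mul_tv (e.symm.trans e') (e.injective.ne hne) t
    simp only [Equiv.trans_apply, Equiv.symm_apply_apply] at hc
    rw [← Module.End.mul_apply, ← map_mul ρ, ← hc, map_mul ρ, Module.End.mul_apply, h, map_smul]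
  · rintro ⟨v, hv⟩ ⟨v', hv'⟩ h
    have h' := congrArg Subtype.val h
    change ρ (permGL (e.symm.trans e')) v = ρ (permGL (e.symm.trans e')) v' at h'
    have h'' := congrArg (ρ (permGL (e.symm.trans e'))⁻¹) h'
    simp only [Representation.inv_self_apply] at h''
    exact Subtype.ext h''

theorem finrank_patSpace_comp_glReindex [FiniteDimensional ℂ V]
    (ρ : Representation ℂ (GL κ F) V) (e e' : ι ≃ κ) {R : ι → ι → Prop}
    (hR : ∀ i, ¬ R i i) (w : ι → ι → F) :
    Module.finrank ℂ (patSpace ψ (ρ.comp (glReindex e).toMonoidHom) R w) =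
      Module.finrank ℂ (patSpace ψ (ρ.comp (glReindex e').toMonoidHom) R w) :=
  le_antisymm (finrank_patSpace_comp_glReindex_le ρ e e' hR w)
    (finrank_patSpace_comp_glReindex_le ρ e' e hR w)

end Permutations

/-! ### From the order by positions to the order by lines. -/

section Chains

/-- The relation on pairs `(a, i)` (position, line) that is lexicographic, lines first, as far as
lines before `l` are involved, compares the positions on the lines after `l`, and for which the
first `m` rows of line `l` have been made full at the expense of the first columns of line `l`. -/
def chainRel {k c : ℕ} (l m : ℕ) (x y : Fin k × Fin c) : Prop :=
  ((x.2 : ℕ) < l ∧ ((x.2 : ℕ) < y.2 ∨ ((x.2 : ℕ) = y.2 ∧ (x.1 : ℕ) < y.1))) ∨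
  ((x.2 : ℕ) = l ∧ (y.2 : ℕ) = l ∧ (x.1 : ℕ) < y.1) ∨
  ((x.2 : ℕ) = l ∧ l < (y.2 : ℕ) ∧ ((x.1 : ℕ) < y.1 ∨ (x.1 : ℕ) < m)) ∨
  (l < (x.2 : ℕ) ∧ (y.2 : ℕ) = l ∧ (x.1 : ℕ) < y.1 ∧ m < (y.1 : ℕ)) ∨
  (l < (x.2 : ℕ) ∧ l < (y.2 : ℕ) ∧ (x.1 : ℕ) < y.1)

/-- The weights of consecutive positions on a line. -/
def lineWeight (F : Type*) [Field F] {k c : ℕ} (x y : Fin k × Fin c) : F :=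
  if (x.2 : ℕ) = y.2 ∧ (x.1 : ℕ) + 1 = y.1 then 1 else 0

theorem lineWeight_eq_zero {F : Type*} [Field F] {k c : ℕ} {x y : Fin k × Fin c}
    (h : ¬ ((x.2 : ℕ) = y.2 ∧ (x.1 : ℕ) + 1 = y.1)) : lineWeight F x y = 0 := if_neg h

variable {F : Type*} [Field F] [Fintype F] [DecidableEq F]
  {V : Type*} [AddCommGroup V] [Module ℂ V] [FiniteDimensional ℂ V] {ψ : AddChar F ℂ}

/-- The neighbours `p = (m, l)` and `r = (m + 1, l)` carry weight `1`. The roots from `S`, the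
positions up to `m` on later lines, into `r` are exchanged for the roots from `p` into `S`. -/
theorem finrank_chainRel_succ (hψ : ψ ≠ 1) {k c l m : ℕ} (hl : l < c) (hm : m + 1 < k)
    (ρ : Representation ℂ (GL (Fin k × Fin c) F) V) :
    Module.finrank ℂ (patSpace ψ ρ (chainRel l m) (lineWeight F)) =
      Module.finrank ℂ (patSpace ψ ρ (chainRel l (m + 1)) (lineWeight F)) := by
  obtain ⟨S, hmem⟩ : ∃ S : Finset (Fin k × Fin c), ∀ x, x ∈ S ↔ (x.1 : ℕ) ≤ m ∧ l < (x.2 : ℕ) :=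
    ⟨Finset.univ.filter fun x => (x.1 : ℕ) ≤ m ∧ l < (x.2 : ℕ), by simp⟩
  obtain ⟨p, hp1, hp2⟩ : ∃ p : Fin k × Fin c, (p.1 : ℕ) = m ∧ (p.2 : ℕ) = l :=
    ⟨(⟨m, by omega⟩, ⟨l, hl⟩), rfl, rfl⟩
  obtain ⟨r, hr1, hr2⟩ : ∃ r : Fin k × Fin c, (r.1 : ℕ) = m + 1 ∧ (r.2 : ℕ) = l :=
    ⟨(⟨m + 1, hm⟩, ⟨l, hl⟩), rfl, rfl⟩
  have hxp : ∀ x, x = p ↔ (x.1 : ℕ) = m ∧ (x.2 : ℕ) = l := fun x => by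
    rw [Prod.ext_iff, Fin.ext_iff, Fin.ext_iff, hp1, hp2]
  have hxr : ∀ x, x = r ↔ (x.1 : ℕ) = m + 1 ∧ (x.2 : ℕ) = l := fun x => by
    rw [Prod.ext_iff, Fin.ext_iff, Fin.ext_iff, hr1, hr2]
  -- The part common to the relations before and after the exchange.
  obtain ⟨R, hR⟩ : ∃ R : Fin k × Fin c → Fin k × Fin c → Prop, ∀ x y, R x y ↔
    ((x.2 : ℕ) < l ∧ ((x.2 : ℕ) < y.2 ∨ ((x.2 : ℕ) = y.2 ∧ (x.1 : ℕ) < y.1))) ∨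
    ((x.2 : ℕ) = l ∧ (y.2 : ℕ) = l ∧ (x.1 : ℕ) < y.1) ∨
    ((x.2 : ℕ) = l ∧ l < (y.2 : ℕ) ∧ ((x.1 : ℕ) < y.1 ∨ (x.1 : ℕ) < m)) ∨
    (l < (x.2 : ℕ) ∧ (y.2 : ℕ) = l ∧ (x.1 : ℕ) < y.1 ∧ m + 1 < (y.1 : ℕ)) ∨
    (l < (x.2 : ℕ) ∧ l < (y.2 : ℕ) ∧ (x.1 : ℕ) < y.1) := ⟨_, fun _ _ => Iff.rfl⟩
  rw [patSpace_congr (R' := fun x y => R x y ∨ (x ∈ S ∧ y = r)) (w' := lineWeight F)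
      (fun x y => by simp only [chainRel, hR, hmem, hxr]; grind) (fun _ _ _ => rfl),
    patSpace_congr (R := chainRel l (m + 1)) (R' := fun x y => R x y ∨ (x = p ∧ y ∈ S))
      (w' := lineWeight F)
      (fun x y => by simp only [chainRel, hR, hmem, hxp]; grind) (fun _ _ _ => rfl)]
  refine finrank_patSpace_row_exchange hψ S (fun x => (x.1 : ℕ)) ?_ ?_ ?_ ?_ ?_ ?_ ?_ ?_ ?_ ?_ ?_ ?_
  · intro x
    simp only [hR]
    omega
  · simp only [hR]
    omega
  · rw [lineWeight, if_pos (by omega)]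
    exact one_ne_zero
  · rw [hmem]
    omega
  · rw [hmem]
    omega
  · intro s hs
    rw [hmem] at hs
    exact ⟨lineWeight_eq_zero (by omega), by simp only [hR]; omega⟩
  · intro s hs
    rw [hmem] at hs
    exact ⟨lineWeight_eq_zero (by omega), by simp only [hR]; omega⟩
  · intro s hs s' hs' h
    rw [hmem] at hs hs'
    simp only [hR] at h
    omega
  · intro x s hs h
    rw [hmem] at hs
    simp only [hR] at h
    refine ⟨by rw [hmem]; omega, by simp only [hR]; omega, lineWeight_eq_zero (by omega)⟩
  · intro x s hs h
    rw [hmem] at hs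
    simp only [hR] at h
    refine ⟨by rw [ne_eq, hxp]; omega, lineWeight_eq_zero (by omega), ?_⟩
    simp only [hR, hmem]
    omega
  · intro x s hs h
    rw [hmem] at hs
    simp only [hR] at h
    refine ⟨by rw [ne_eq, hxr]; omega, lineWeight_eq_zero (by omega), ?_⟩
    simp only [hR, hmem]
    omega
  · intro x s hs h
    rw [hmem] at hs
    simp only [hR] at h
    refine ⟨by rw [hmem]; omega, by simp only [hR]; omega, lineWeight_eq_zero (by omega)⟩

theorem finrank_chainRel (hψ : ψ ≠ 1) {k c l m : ℕ} (hl : l < c) (hm : m < k)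
    (ρ : Representation ℂ (GL (Fin k × Fin c) F) V) :
    Module.finrank ℂ (patSpace ψ ρ (chainRel l 0) (lineWeight F)) =
      Module.finrank ℂ (patSpace ψ ρ (chainRel l m) (lineWeight F)) := by
  induction m with
  | zero => rfl
  | succ m ih => rw [ih (by omega), finrank_chainRel_succ hψ hl hm]

end Chains

/-! ### Extending a character from the first rows to the full unipotent group. -/

section Prefix

variable {F : Type*} [Field F] {n : ℕ}

/-- The weights `ε i` on the consecutive pairs `(i, i + 1)`. -/
def consecWeight (ε : ℕ → F) (i j : Fin n) : F := if (i : ℕ) + 1 = j then ε i else 0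

/-- The pairs `i < j` in the first `s - 1` rows. -/
def prefixRel (s : ℕ) (i j : Fin n) : Prop := (i : ℕ) < j ∧ (i : ℕ) + 1 < s

/-- A vector `b ≠ 0` supported on the indices `≥ s` can be moved to the basis vector `e_s` by an
invertible matrix that agrees with the identity in the first `s` rows and columns. -/
theorem exists_gl_mulVec_eq_single (s : Fin n) (b : Fin n → F) (hb : ∀ j < s, b j = 0)
    (hb' : b ≠ 0) : ∃ g : GL (Fin n) F, (g : Matrix (Fin n) (Fin n) F).mulVec b = Pi.single s 1 ∧
      (∀ i < s, (g : Matrix (Fin n) (Fin n) F).mulVec (Pi.single i 1) = Pi.single i 1) ∧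
      ∀ i < s, Matrix.vecMul (Pi.single i 1) (g : Matrix (Fin n) (Fin n) F) = Pi.single i 1 := by
  -- If `b s ≠ 0`, the inverse of the identity matrix with column `s` replaced by `b` does it. If `b
  -- s = 0`, a transvection first adds a later nonzero coordinate to the coordinate `s`.
  have main : ∀ b : Fin n → F, (∀ j < s, b j = 0) → b s ≠ 0 → ∃ g : GL (Fin n) F,
      (g : Matrix (Fin n) (Fin n) F).mulVec b = Pi.single s 1 ∧
      (∀ i < s, (g : Matrix (Fin n) (Fin n) F).mulVec (Pi.single i 1) = Pi.single i 1) ∧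
      ∀ i < s, Matrix.vecMul (Pi.single i 1) (g : Matrix (Fin n) (Fin n) F) = Pi.single i 1 := by
    intro b hb hs
    have hdet : ((1 : Matrix (Fin n) (Fin n) F).updateCol s b).det ≠ 0 := by
      rw [← Matrix.cramer_apply, Matrix.cramer_one]
      exact hs
    set M := Matrix.GeneralLinearGroup.mkOfDetNeZero _ hdet with hM
    have hM' : (M : Matrix (Fin n) (Fin n) F) = (1 : Matrix (Fin n) (Fin n) F).updateCol s b := rfl
    have hinv : ((M⁻¹ : GL (Fin n) F) : Matrix (Fin n) (Fin n) F) * M = 1 := Units.inv_mul M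
    have hinv' : (M : Matrix (Fin n) (Fin n) F) * (M⁻¹ : GL (Fin n) F) = 1 := Units.mul_inv M
    refine ⟨M⁻¹, ?_, fun i hi => ?_, fun i hi => ?_⟩
    · have : (M : Matrix (Fin n) (Fin n) F).mulVec (Pi.single s 1) = b := by
        ext i
        simp [hM']
      rw [← this, Matrix.mulVec_mulVec, hinv, Matrix.one_mulVec]
    · have : (M : Matrix (Fin n) (Fin n) F).mulVec (Pi.single i 1) = Pi.single i 1 := by
        ext j
        simp [hM', hi.ne, Matrix.one_apply, Pi.single_apply]
      conv_lhs => rw [← this]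
      rw [Matrix.mulVec_mulVec, hinv, Matrix.one_mulVec]
    · have : Matrix.vecMul (Pi.single i 1) (M : Matrix (Fin n) (Fin n) F) = Pi.single i 1 := by
        ext j
        by_cases hj : j = s
        · subst hj
          simp [hM', hb i hi, hi.ne']
        · simp [hM', hj, Matrix.one_apply, Pi.single_apply, eq_comm]
      conv_lhs => rw [← this]
      rw [Matrix.vecMul_vecMul, hinv', Matrix.vecMul_one]
  by_cases hs : b s = 0
  · obtain ⟨j, hj⟩ : ∃ j, b j ≠ 0 := by
      by_contra h
      push Not at h
      exact hb' (funext h)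
    have hsj : s < j := by
      rcases lt_trichotomy s j with h | h | h
      · exact h
      · exact absurd (h ▸ hs) hj
      · exact absurd (hb j h) hj
    have ht : ∀ x : Fin n → F, (tv s j (1 : F) : Matrix (Fin n) (Fin n) F).mulVec x =
        x + Pi.single s (x j) := by
      intro x
      rw [coe_tv hsj.ne, Matrix.add_mulVec, Matrix.one_mulVec]
      congr 1
      ext a
      by_cases ha : s = a
      · subst ha
        simp [Matrix.mulVec, dotProduct, Matrix.single_apply]
      · simp [Matrix.mulVec, dotProduct, ha, Ne.symm ha]
    obtain ⟨g, h₁, h₂, h₃⟩ := main ((tv s j (1 : F) : Matrix (Fin n) (Fin n) F).mulVec b)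
      (fun i hi => by simp [ht, hb i hi, hi.ne]) (by simpa [ht, hs] using hj)
    refine ⟨g * tv s j 1, ?_, fun i hi => ?_, fun i hi => ?_⟩
    · rw [Matrix.GeneralLinearGroup.coe_mul, ← Matrix.mulVec_mulVec, h₁]
    · rw [Matrix.GeneralLinearGroup.coe_mul, ← Matrix.mulVec_mulVec, ht]
      simp [(hi.trans hsj).ne', h₂ i hi]
    · rw [Matrix.GeneralLinearGroup.coe_mul, ← Matrix.vecMul_vecMul, h₃ i hi, coe_tv hsj.ne,
        Matrix.vecMul_add, Matrix.vecMul_one]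
      ext a
      simp [hi.ne']
  · exact main b hb hs

variable [Fintype F] [DecidableEq F] {V : Type*} [AddCommGroup V] [Module ℂ V] {ψ : AddChar F ℂ}
  {ρ : Representation ℂ (GL (Fin n) F) V}

/-- Row `σ` is diagonalised one column at a time. The weights on `D` are retained, so that a nonzero
weight found beforehand survives. -/
theorem exists_row_weights (hψ : ψ ≠ 1) {ε : ℕ → F} (σ : Fin n) (D : Finset (Fin n)) (b : Fin n → F)
    {v : V} (hv₀ : v ≠ 0)
    (hv : v ∈ patSpace ψ ρ (fun i j => prefixRel ((σ : ℕ) + 1) i j ∨ (i = σ ∧ σ < j ∧ j ∈ D))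
      (fun i j => if i = σ then b j else consecWeight ε i j)) (D' : Finset (Fin n)) :
    ∃ b' : Fin n → F, (∀ j ∈ D, b' j = b j) ∧ ∃ v' ≠ 0,
      v' ∈ patSpace ψ ρ
        (fun i j => prefixRel ((σ : ℕ) + 1) i j ∨ (i = σ ∧ σ < j ∧ j ∈ D ∪ D'))
        (fun i j => if i = σ then b' j else consecWeight ε i j) := by
  induction D' using Finset.induction_on with
  | empty => exact ⟨b, fun _ _ => rfl, v, hv₀, by simpa using hv⟩
  | insert q D' _ ih =>
    obtain ⟨b', hb', v', hv'₀, hv'⟩ := ih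
    by_cases hq : q ∈ D ∪ D' ∨ ¬ σ < q
    · refine ⟨b', hb', v', hv'₀, ?_⟩
      rwa [patSpace_congr (fun i j => ?_) (fun _ _ _ => rfl)]
      rw [Finset.union_insert, Finset.mem_insert]
      grind
    · push Not at hq
      obtain ⟨hqD, hq⟩ := hq
      have hnorm : Normalizes (fun i j => prefixRel ((σ : ℕ) + 1) i j ∨
          (i = σ ∧ σ < j ∧ j ∈ D ∪ D')) (fun i j => if i = σ then b' j else consecWeight ε i j)
          σ q := by
        refine ⟨?_, hq.ne, ?_, ?_⟩
        · rintro i (⟨h, _⟩ | ⟨rfl, h, _⟩)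
          · exact absurd h (lt_irrefl _)
          · exact absurd h (lt_irrefl _)
        · rintro i (⟨h, h'⟩ | ⟨_, h, _⟩)
          · have hq' : (σ : ℕ) < q := hq
            have hne : i ≠ σ := fun e => by subst e; omega
            refine ⟨fun e => by subst e; omega, Or.inl ⟨by omega, h'⟩, ?_⟩
            rw [if_neg hne, consecWeight, if_neg (by omega)]
          · exact absurd h (lt_irrefl _)
        · have hq' : (σ : ℕ) < q := hq
          rintro j (⟨h, h'⟩ | ⟨h, _, _⟩)
          · omega
          · exact absurd h hq.ne'
      obtain ⟨β, v'', hv'', hv''₀, hβ, -⟩ := hnorm.exists_weight hψ hv' hv'₀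
      refine ⟨Function.update b' q β, fun j hj => ?_, v'', hv''₀, ?_⟩
      · have : j ≠ q := by
          rintro rfl
          exact hqD (Finset.mem_union_left _ hj)
        rw [Function.update_of_ne this, hb' j hj]
      · intro i j hij t
        by_cases hjq : i = σ ∧ j = q
        · obtain ⟨rfl, rfl⟩ := hjq
          simpa using hβ t
        · have hij' : prefixRel ((σ : ℕ) + 1) i j ∨ (i = σ ∧ σ < j ∧ j ∈ D ∪ D') := by
            rw [Finset.union_insert, Finset.mem_insert] at hij
            tauto
          rw [hv'' i j hij' t]
          by_cases hi : i = σ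
          · subst hi
            have : j ≠ q := fun e => hjq ⟨rfl, e⟩
            simp [this]
          · simp [hi]

/-- The root subgroups of row `σ` commute and preserve the characters of the earlier rows, so some
vector has weights `b` under them. If `b = 0`, take `δ = 0`. Otherwise an invertible matrix fixing
the first `σ + 1` basis vectors moves `b` to the single weight `1` at `(σ, τ)`, and `δ = 1`. When
the row acts nontrivially on `v`, the weights can be chosen nonzero. -/
theorem exists_next_prefix (hψ : ψ ≠ 1) {ε : ℕ → F} (σ τ : Fin n) (hτ : (τ : ℕ) = σ + 1) {v : V}
    (hv₀ : v ≠ 0) (hv : v ∈ patSpace ψ ρ (prefixRel ((σ : ℕ) + 1)) (consecWeight ε)) :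
    ∃ δ : F, (δ = 0 ∨ δ = 1) ∧ ((∃ j > σ, ∃ t, ρ (tv σ j t) v ≠ v) → δ = 1) ∧ ∃ v' ≠ 0,
      v' ∈ patSpace ψ ρ (prefixRel ((τ : ℕ) + 1)) (consecWeight (Function.update ε σ δ)) := by
  obtain ⟨b, hb, v', hv'₀, hv'⟩ : ∃ b : Fin n → F,
      ((∃ j > σ, ∃ t, ρ (tv σ j t) v ≠ v) → ∃ j > σ, b j ≠ 0) ∧
      ∃ v' ≠ 0, v' ∈ patSpace ψ ρ (prefixRel ((τ : ℕ) + 1))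
        (fun i j => if i = σ then b j else consecWeight ε i j) := by
    have hfull : ∀ D : Finset (Fin n), ∀ i j : Fin n, prefixRel ((τ : ℕ) + 1) i j ↔
        prefixRel ((σ : ℕ) + 1) i j ∨ (i = σ ∧ σ < j ∧ j ∈ D ∪ Finset.univ) := by
      intro D i j
      simp only [prefixRel, Finset.mem_union, Finset.mem_univ, or_true, and_true, Fin.lt_def, Fin.ext_iff]
      omega
    by_cases hex : ∃ j > σ, ∃ t, ρ (tv σ j t) v ≠ v
    · obtain ⟨q, hq, ht⟩ := hex
      have hq' : (σ : ℕ) < q := hq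
      have hnorm : Normalizes (prefixRel ((σ : ℕ) + 1)) (consecWeight ε) σ q := by
        refine ⟨fun i h => lt_irrefl _ h.1, (ne_of_lt hq), ?_, ?_⟩
        · rintro i ⟨h, h'⟩
          refine ⟨fun e => by subst e; omega, ⟨by omega, h'⟩, ?_⟩
          rw [consecWeight, if_neg (by omega)]
        · rintro j ⟨_, h'⟩
          omega
      obtain ⟨β, v', hv', hv'₀, hβ, hne⟩ := hnorm.exists_weight hψ hv hv₀
      obtain ⟨b, hb, v'', hv''₀, hv''⟩ := exists_row_weights (ρ := ρ) (ε := ε) hψ σ {q}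
        (fun _ => β) hv'₀ (by
          rintro i j (hij | ⟨rfl, _, hj⟩) t
          · have : i ≠ σ := fun e => by
              have := hij.2
              subst e
              omega
            simp only [if_neg this]
            exact hv' i j hij t
          · rw [Finset.mem_singleton] at hj
            subst hj
            simp only [if_true]
            exact hβ t) Finset.univ
      refine ⟨b, fun _ => ⟨q, hq, ?_⟩, v'', hv''₀, ?_⟩
      · rw [hb q (by simp)]
        exact hne ht
      · rwa [patSpace_congr (hfull {q}) (fun _ _ _ => rfl)]
    · obtain ⟨b, _, v', hv'₀, hv'⟩ := exists_row_weights (ρ := ρ) (ε := ε) hψ σ ∅ 0 hv₀ (by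
        rintro i j (hij | ⟨_, _, hj⟩) t
        · have : i ≠ σ := fun e => by
            have := hij.2
            subst e
            omega
          simp only [if_neg this]
          exact hv i j hij t
        · simp at hj) Finset.univ
      refine ⟨b, fun h => absurd h hex, v', hv'₀, ?_⟩
      rwa [patSpace_congr (hfull ∅) (fun _ _ _ => rfl)]
  by_cases hb₀ : ∃ j > σ, b j ≠ 0
  · refine ⟨1, Or.inr rfl, fun _ => rfl, ?_⟩
    obtain ⟨j₀, hj₀, hbj₀⟩ := hb₀
    have hj₀' : (σ : ℕ) < j₀ := hj₀
    obtain ⟨g, hg₁, hg₂, hg₃⟩ := exists_gl_mulVec_eq_single τ (fun j => if σ < j then b j else 0)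
      (fun j hj => if_neg (by rw [Fin.lt_def] at hj ⊢; omega))
      (fun h => hbj₀ (by simpa [hj₀] using congrFun h j₀))
    have hcol : ∀ i < τ, ∀ j, (g : Matrix (Fin n) (Fin n) F) j i = if j = i then 1 else 0 := by
      intro i hi j
      have := congrFun (hg₂ i hi) j
      simpa [Pi.single_apply] using this
    refine ⟨ρ g v', fun h => hv'₀ ?_, ?_⟩
    · simpa using congrArg (ρ g⁻¹) h
    intro i j hij t
    have hiτ : i < τ := by
      have := hij.2
      rw [Fin.lt_def]
      omega
    have hij₁ : (i : ℕ) < j := hij.1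
    have hne : i ≠ j := fun e => by subst e; omega
    -- Since `g⁻¹` fixes `e_i`, the conjugate of `t E_{ij}` is concentrated in row `i`, where it is
    -- `t` times row `j` of `g`.
    have hgi : ((g⁻¹ : GL (Fin n) F) : Matrix (Fin n) (Fin n) F) *
        (Matrix.single i j t * (g : Matrix (Fin n) (Fin n) F)) =
        Matrix.of fun a b => if a = i then t * (g : Matrix (Fin n) (Fin n) F) j b else 0 := by
      have h₁ : ((g⁻¹ : GL (Fin n) F) : Matrix (Fin n) (Fin n) F).mulVec (Pi.single i 1) =
          Pi.single i 1 := by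
        have hinv : ((g⁻¹ : GL (Fin n) F) : Matrix (Fin n) (Fin n) F) * g = 1 := Units.inv_mul g
        conv_lhs => rw [← hg₂ i hiτ]
        rw [Matrix.mulVec_mulVec, hinv, Matrix.one_mulVec]
      ext a b
      rw [Matrix.mul_apply, Finset.sum_eq_single i]
      · have h₂ := congrFun h₁ a
        simp only [Matrix.mulVec_single_one, Matrix.col_apply, Pi.single_apply] at h₂
        rw [h₂, Matrix.single_mul_apply_same]
        simp
      · intro x _ hx
        rw [Matrix.single_mul_apply_of_ne _ _ _ _ _ hx, mul_zero]
      · simp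
    have hu : ∀ a b, ((g⁻¹ * (tv i j t * g) : GL (Fin n) F) : Matrix (Fin n) (Fin n) F) a b =
        (if a = b then 1 else 0) +
          if a = i then t * (g : Matrix (Fin n) (Fin n) F) j b else 0 := by
      intro a b
      rw [Matrix.GeneralLinearGroup.coe_mul, Matrix.GeneralLinearGroup.coe_mul, coe_tv hne,
        add_mul, one_mul, mul_add, hgi]
      have hinv : ((g⁻¹ : GL (Fin n) F) : Matrix (Fin n) (Fin n) F) * g = 1 := Units.inv_mul g
      rw [hinv]
      simp [Matrix.one_apply]
    have hji : ∀ b ≤ i, (g : Matrix (Fin n) (Fin n) F) j b = 0 := by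
      intro b hb
      rw [hcol b (lt_of_le_of_lt hb hiτ), if_neg]
      rintro rfl
      rw [Fin.le_def] at hb
      omega
    have hpat : InPattern (prefixRel ((τ : ℕ) + 1)) (g⁻¹ * (tv i j t * g)) := by
      constructor
      · intro a
        rw [hu, if_pos rfl]
        by_cases ha : a = i
        · subst ha
          simp [hji a le_rfl]
        · simp [ha]
      · intro a b hab h
        rw [hu, if_neg hab, zero_add] at h
        obtain ⟨rfl, h'⟩ : a = i ∧ t * (g : Matrix (Fin n) (Fin n) F) j b ≠ 0 := by
          by_cases ha : a = i
          · exact ⟨ha, by simpa [ha] using h⟩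
          · simp [ha] at h
        refine ⟨?_, hij.2⟩
        by_contra hba
        exact h' (by rw [hji b (by rw [Fin.le_def]; omega), mul_zero])
    -- In row `σ` the form is `t` times the `j`-th coordinate of `g b = e_τ`. In an earlier row only
    -- column `i + 1 < τ` counts, and there `g` is the identity.
    have hform : patForm (fun i j => if i = σ then b j else consecWeight ε i j)
        (g⁻¹ * (tv i j t * g)) = consecWeight (Function.update ε σ 1) i j * t := by
      unfold patForm
      rw [Finset.sum_eq_single i]
      · by_cases hiσ : i = σ
        · subst hiσ
          have h₁ : ∀ x, (if i = x then 0 else (if i = i then b x else consecWeight ε i x) *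
              ((g⁻¹ * (tv i j t * g) : GL (Fin n) F) : Matrix (Fin n) (Fin n) F) i x) =
              t * ((g : Matrix (Fin n) (Fin n) F) j x * if i < x then b x else 0) := by
            intro x
            rw [hu]
            by_cases hx : i = x
            · subst hx
              simp
            · rw [if_neg hx, if_neg hx, if_pos rfl, if_pos rfl]
              by_cases hx' : i < x
              · rw [if_pos hx']
                ring
              · rw [if_neg hx', hji x (not_lt.1 hx')]
                ring
          refine (Finset.sum_congr rfl fun x _ => h₁ x).trans ?_
          rw [← Finset.mul_sum]
          have h₂ := congrFun hg₁ j
          simp only [Matrix.mulVec, dotProduct] at h₂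
          rw [h₂, consecWeight, mul_comm, Pi.single_apply]
          congr 1
          simp only [Function.update_self, Fin.ext_iff, hτ]
          exact if_congr eq_comm rfl rfl
        · have hiσ' : (i : ℕ) ≠ σ := fun e => hiσ (Fin.ext e)
          have hiτ' : (i : ℕ) < τ := hiτ
          have hi₁ : (i : ℕ) + 1 < n := by omega
          rw [Finset.sum_eq_single ⟨(i : ℕ) + 1, hi₁⟩]
          · have : i ≠ ⟨(i : ℕ) + 1, hi₁⟩ := fun e => by simp [Fin.ext_iff] at e
            rw [if_neg this, hu, if_neg this, if_pos rfl, zero_add,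
              hcol _ (by rw [Fin.lt_def]; change (i : ℕ) + 1 < τ; omega)]
            simp only [if_neg hiσ', consecWeight, Function.update_of_ne hiσ', Fin.ext_iff, if_true]
            by_cases hj : (i : ℕ) + 1 = j
            · rw [if_pos hj.symm, if_pos hj]
              ring
            · rw [if_neg (Ne.symm hj), if_neg hj]
              ring
          · intro x _ hx
            have : ¬ (i : ℕ) + 1 = x := fun e => hx (Fin.ext e.symm)
            simp [hiσ, consecWeight, this]
          · simp
      · intro a _ ha
        refine Finset.sum_eq_zero fun x _ => ?_
        by_cases hax : a = x
        · simp [hax]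
        · rw [hu]
          simp [hax, ha]
      · simp
    rw [← Module.End.mul_apply, ← map_mul ρ,
      show tv i j t * g = g * (g⁻¹ * (tv i j t * g)) by group, map_mul ρ, Module.End.mul_apply,
      apply_of_mem_patSpace (R := prefixRel ((τ : ℕ) + 1)) (fun i h => lt_irrefl _ h.1)
        (fun i j k h h' => ⟨h.1.trans h'.1, h.2⟩) ?_ hv' hpat, hform, map_smul]
    rintro i j k ⟨h₁, h₂⟩ ⟨h₃, h₄⟩
    have : i ≠ σ := fun e => by
      subst e
      omega
    rw [if_neg this, consecWeight, if_neg (by omega)]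
  · push Not at hb₀
    refine ⟨0, Or.inl rfl, fun h => ?_, v', hv'₀, ?_⟩
    · obtain ⟨j, hj, hj'⟩ := hb h
      exact absurd (hb₀ j hj) hj'
    · refine patSpace_anti (fun _ _ h => h) (fun i j hij => ?_) hv'
      have hij₁ : (i : ℕ) < j := hij.1
      by_cases hi : i = σ
      · subst hi
        simp [consecWeight, hb₀ j hij₁]
      · have hi' : (i : ℕ) ≠ σ := fun e => hi (Fin.ext e)
        simp [hi, consecWeight, Function.update_of_ne hi']

/-- A nonzero vector for a prefix of the rows yields a Zelevinsky vector whose weights extend the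
given ones. -/
theorem exists_of_prefix (hψ : ψ ≠ 1) (d : ℕ) : ∀ (σ : Fin n) (ε : ℕ → F), (σ : ℕ) + 1 + d = n →
    (∀ i, ε i = 0 ∨ ε i = 1) →
    (∃ v ≠ 0, v ∈ patSpace ψ ρ (prefixRel ((σ : ℕ) + 1)) (consecWeight ε)) →
    ∃ ε' : ℕ → F, (∀ i, ε' i = 0 ∨ ε' i = 1) ∧ (∀ i < (σ : ℕ), ε' i = ε i) ∧
      patSpace ψ ρ (· < ·) (consecWeight ε') ≠ ⊥ := by
  induction d with
  | zero =>
    rintro σ ε hσ hε ⟨v, hv₀, hv⟩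
    refine ⟨ε, hε, fun _ _ => rfl, fun h => hv₀ ?_⟩
    rw [← Submodule.mem_bot ℂ, ← h]
    refine patSpace_anti (fun i j hij => ?_) (fun _ _ _ => rfl) hv
    rw [Fin.lt_def] at hij
    exact ⟨hij, by omega⟩
  | succ d ih =>
    rintro σ ε hσ hε ⟨v, hv₀, hv⟩
    obtain ⟨δ, hδ, -, h⟩ := exists_next_prefix hψ σ ⟨(σ : ℕ) + 1, by omega⟩ rfl hv₀ hv
    obtain ⟨ε', h₁, h₂, h₃⟩ := ih ⟨(σ : ℕ) + 1, by omega⟩ (Function.update ε σ δ)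
      (by simp only; omega) (fun i => by
        by_cases hi : i = σ
        · subst hi
          simpa using hδ
        · simpa [hi] using hε i) h
    refine ⟨ε', h₁, fun i hi => ?_, h₃⟩
    rw [h₂ i (by simp only; omega), Function.update_of_ne (by omega)]

end Prefix

/-! ### Runs of simple roots, and comparison of the two kinds of vectors. -/

section Vanishing

variable {F : Type*} [Field F] {V : Type*} [AddCommGroup V] [Module ℂ V] {ψ : AddChar F ℂ}

/-- `ρ` has no Zelevinsky vectors whose character is non-trivial on `k` consecutive simple roots. -/
def RunVanish (ψ : AddChar F ℂ) (k : ℕ) {n : ℕ} (ρ : Representation ℂ (GL (Fin n) F) V) : Prop :=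
  ∀ ε : ℕ → F, (∀ i, ε i = 0 ∨ ε i = 1) → ∀ i, i + k < n → (∀ t < k, ε (i + t) = 1) →
    patSpace ψ ρ (· < ·) (consecWeight ε) = ⊥

theorem inPattern_lt_iff {n : ℕ} {u : GL (Fin n) F} :
    InPattern (· < ·) u ↔ IsUpperUnipotent u := by
  refine and_congr Iff.rfl ⟨fun h i j hij => ?_, fun h i j hne h' => ?_⟩
  · by_contra h'
    exact absurd (h i j hij.ne' h') (not_lt.2 hij.le)
  · by_contra hij
    exact h' (h i j (lt_of_le_of_ne (not_lt.1 hij) hne.symm))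

theorem patForm_consecWeight {n : ℕ} (ε : ℕ → F) (u : GL (Fin n) F) :
    patForm (consecWeight ε) u = ∑ i : Fin n, if hi : (i : ℕ) + 1 < n then
      ε i * (u : Matrix (Fin n) (Fin n) F) i ⟨(i : ℕ) + 1, hi⟩ else 0 := by
  refine Finset.sum_congr rfl fun i _ => ?_
  by_cases hi : (i : ℕ) + 1 < n
  · rw [dif_pos hi, Finset.sum_eq_single ⟨(i : ℕ) + 1, hi⟩]
    · have : i ≠ ⟨(i : ℕ) + 1, hi⟩ := fun e => by simp [Fin.ext_iff] at e
      rw [if_neg this, consecWeight, if_pos rfl]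
    · intro j _ hj
      have : ¬ (i : ℕ) + 1 = j := fun e => hj (Fin.ext e.symm)
      simp [consecWeight, this]
    · simp
  · rw [dif_neg hi]
    refine Finset.sum_eq_zero fun j _ => ?_
    have : ¬ (i : ℕ) + 1 = j := fun e => hi (by omega)
    simp [consecWeight, this]

theorem consecWeight_cover {n : ℕ} (ε : ℕ → F) (i j k : Fin n) (h : i < j) (h' : j < k) :
    consecWeight ε i k = 0 := by
  rw [Fin.lt_def] at h h'
  rw [consecWeight, if_neg (by omega)]

theorem zelevinskySpace_eq {n : ℕ} (l : List ℕ) (ρ : Representation ℂ (GL (Fin n) F) V) :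
    zelevinskySpace ψ l ρ = patSpace ψ ρ (· < ·)
      (consecWeight fun i => if i + 1 ∈ partialSums l then 0 else 1) := by
  ext v
  rw [mem_patSpace_iff (fun i => lt_irrefl i) (fun _ _ _ => lt_trans) (consecWeight_cover _)]
  refine forall_congr' fun u => imp_congr inPattern_lt_iff.symm ?_
  rw [zelevinskyChar, patForm_consecWeight]
  simp only [ite_mul, zero_mul, one_mul]

/-- The first partial sums, that is the largest parts, already violate dominance. -/
theorem not_dominates_replicate {k c : ℕ} (hc : 1 ≤ c) {l : List ℕ} {p : ℕ} (hp : p ∈ l)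
    (hk : k < p) : ¬ Dominates (List.replicate c k) l := by
  intro h
  have hl : 1 ≤ l.length := List.length_pos_of_mem hp
  have h₁ := h 1 le_rfl (by simpa using ⟨hc, hl⟩)
  have hrep : (List.replicate c k).insertionSort (· ≥ ·) = List.replicate c k :=
    List.Pairwise.insertionSort_eq (by simp [List.pairwise_replicate])
  rw [hrep] at h₁
  have hmem : p ∈ l.insertionSort (· ≥ ·) := (List.perm_insertionSort _ _).mem_iff.2 hp
  have hsort := List.pairwise_insertionSort (· ≥ ·) l
  obtain ⟨c, rfl⟩ := Nat.exists_eq_add_of_le hc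
  rw [add_comm, List.replicate_succ] at h₁
  cases hs : l.insertionSort (· ≥ ·) with
  | nil => simp [hs] at hmem
  | cons a t =>
    rw [hs] at h₁ hmem hsort
    simp only [List.take_succ_cons, List.take_zero, List.sum_cons, List.sum_nil, add_zero] at h₁
    rcases List.mem_cons.1 hmem with rfl | hm
    · omega
    · have := (List.pairwise_cons.1 hsort).1 p hm
      omega

-- The cuts of the composition are placed at the zeros of `ε`, so every character with weights `0`
-- and `1` is a Zelevinsky character.
open Classical in
theorem exists_composition {n : ℕ} (hn : 0 < n) (ε : ℕ → F) :
    ∃ l : Composition n, ∀ i, i + 1 < n → (i + 1 ∈ partialSums l.blocks ↔ ε i = 0) := by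
  have hpos : 0 < Fin.last n := by
    rw [Fin.lt_def]
    simpa using hn
  let B : CompositionAsSet n :=
    { boundaries := Finset.univ.filter fun j : Fin (n + 1) =>
        (j : ℕ) = 0 ∨ (j : ℕ) = n ∨ ε ((j : ℕ) - 1) = 0
      zero_mem := by simp
      getLast_mem := by simp }
  refine ⟨B.toComposition, fun i hi => ?_⟩
  rw [CompositionAsSet.toComposition_blocks]
  have h₁ : (⟨i + 1, by omega⟩ : Fin (n + 1)) ∈ B.boundaries ↔ ε i = 0 := by
    simp only [B, Finset.mem_filter, Finset.mem_univ, true_and]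
    have : ¬ (i + 1 = n) := by omega
    simp [this]
  rw [← h₁, CompositionAsSet.mem_boundaries_iff_exists_blocks_sum_take_eq]
  simp only [partialSums, Finset.mem_image, Finset.mem_Icc, CompositionAsSet.blocks_length]
  constructor
  · rintro ⟨j, ⟨hj, hj'⟩, he⟩
    exact ⟨j, by rw [CompositionAsSet.card_boundaries_eq_succ_length]; omega, he⟩
  · rintro ⟨j, hj, he⟩
    rw [CompositionAsSet.card_boundaries_eq_succ_length] at hj
    refine ⟨j, ⟨?_, by omega⟩, he⟩
    by_contra h0
    obtain rfl : j = 0 := by omega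
    simp at he

/-- A run of `k` ones starting at `i` leaves no cut at `i + 1, …, i + k`. The part of the
composition containing the index `i` therefore exceeds `k`, and `(k^c)` does not dominate such a
composition. -/
theorem IsKCType.runVanish {k c : ℕ} (hc : 1 ≤ c) {ρ : Representation ℂ (GL (Fin (k * c)) F) V}
    (h : IsKCType ψ k c ρ) : RunVanish ψ k ρ := by
  intro ε hε i hi hrun
  obtain ⟨l, hl⟩ := exists_composition (n := k * c) (by omega) ε
  have hz : zelevinskySpace ψ l.blocks ρ = patSpace ψ ρ (· < ·) (consecWeight ε) := by
    rw [zelevinskySpace_eq]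
    refine patSpace_congr (fun _ _ => Iff.rfl) fun a b hab => ?_
    unfold consecWeight
    by_cases hb : (a : ℕ) + 1 = b
    · have hla := hl a (by omega)
      rw [if_pos hb, if_pos hb]
      change (if (a : ℕ) + 1 ∈ partialSums l.blocks then (0 : F) else 1) = _
      rcases hε a with e | e
      · rw [if_pos (hla.2 e), e]
      · rw [if_neg fun h => one_ne_zero (e.symm.trans (hla.1 h)), e]
    · rw [if_neg hb, if_neg hb]
  rw [← hz]
  set x := l.index ⟨i, by omega⟩ with hx
  have h₁ : l.sizeUpTo x ≤ i := l.sizeUpTo_index_le ⟨i, by omega⟩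
  have h₂ : i < l.sizeUpTo (x + 1) := l.lt_sizeUpTo_index_succ ⟨i, by omega⟩
  have h₃ : i + k < l.sizeUpTo (x + 1) := by
    by_contra hlt
    obtain ⟨t, ht⟩ := Nat.exists_eq_add_of_lt h₂
    have ht' : t < k := by omega
    have hmem : (i + t) + 1 ∈ partialSums l.blocks := by
      refine Finset.mem_image.2 ⟨x + 1, Finset.mem_Icc.2 ⟨by omega, ?_⟩, ht⟩
      rw [l.blocks_length]
      exact x.2
    rw [hl _ (by omega), hrun t ht'] at hmem
    exact one_ne_zero hmem
  have h₄ := l.sizeUpTo_succ' x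
  exact h.2 l (not_dominates_replicate hc (l.blocksFun_mem_blocks x) (by omega))

/-- The weights of the Zelevinsky character of type `(k, k, …)`. -/
def rectWeight (F : Type*) [Field F] (k : ℕ) (i : ℕ) : F := if (i + 1) % k = 0 then 0 else 1

theorem zelevinskySpace_replicate {k c : ℕ} (ρ : Representation ℂ (GL (Fin (k * c)) F) V) :
    zelevinskySpace ψ (List.replicate c k) ρ =
      patSpace ψ ρ (· < ·) (consecWeight (rectWeight F k)) := by
  rw [zelevinskySpace_eq]
  refine patSpace_congr (fun _ _ => Iff.rfl) fun a b hab => ?_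
  unfold consecWeight rectWeight
  by_cases hb : (a : ℕ) + 1 = b
  · rw [if_pos hb, if_pos hb]
    refine if_congr ?_ rfl rfl
    have hlt : (a : ℕ) + 1 < k * c := by omega
    have hk : 0 < k := Nat.pos_of_ne_zero fun e => by simp [e] at hlt
    simp only [partialSums, Finset.mem_image, Finset.mem_Icc, List.length_replicate,
      List.take_replicate, List.sum_replicate, smul_eq_mul]
    constructor
    · rintro ⟨j, _, he⟩
      rw [← he, Nat.mul_mod_left]
    · intro he
      obtain ⟨j, hj⟩ := Nat.dvd_of_mod_eq_zero he
      have hjc : j < c := by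
        rw [hj] at hlt
        exact Nat.lt_of_mul_lt_mul_left hlt
      refine ⟨j, ⟨?_, hjc.le⟩, ?_⟩
      · by_contra h0
        obtain rfl : j = 0 := by omega
        omega
      · rw [min_eq_left hjc.le, hj, mul_comm]
  · rw [if_neg hb, if_neg hb]

/-- The labelling of the positions of the lines, line by line. -/
def lineEquiv (k c : ℕ) : Fin k × Fin c ≃ Fin (k * c) :=
  (Equiv.prodComm _ _).trans (finProdFinEquiv.trans (finCongr (mul_comm c k)))

theorem lineEquiv_apply {k c : ℕ} (x : Fin k × Fin c) :
    (lineEquiv k c x : ℕ) = x.1 + k * x.2 := by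
  simp [lineEquiv]

theorem lineEquiv_lt_iff {k c : ℕ} (x y : Fin k × Fin c) :
    lineEquiv k c x < lineEquiv k c y ↔
      (x.2 : ℕ) < y.2 ∨ ((x.2 : ℕ) = y.2 ∧ (x.1 : ℕ) < y.1) := by
  rw [Fin.lt_def, lineEquiv_apply, lineEquiv_apply]
  have hx := x.1.2
  have hy := y.1.2
  rcases lt_trichotomy (x.2 : ℕ) y.2 with h | h | h
  · have : k * ((x.2 : ℕ) + 1) ≤ k * y.2 := Nat.mul_le_mul_left k h
    rw [mul_add] at this
    simp only [h, true_or, iff_true]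
    omega
  · rw [h]
    simp
  · have : k * ((y.2 : ℕ) + 1) ≤ k * x.2 := Nat.mul_le_mul_left k h
    rw [mul_add] at this
    omega

/-- The end of one line and the start of the next are consecutive in the line by line labelling, but
the weight there is zero, so only neighbours on a common line count. -/
theorem consecWeight_lineEquiv {k c : ℕ} (x y : Fin k × Fin c) :
    consecWeight (rectWeight F k) (lineEquiv k c x) (lineEquiv k c y) = lineWeight F x y := by
  have hx := x.1.2
  have hy := y.1.2
  unfold consecWeight rectWeight lineWeight
  rw [lineEquiv_apply, lineEquiv_apply]
  by_cases hend : (x.1 : ℕ) + 1 = k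
  · have h₁ : ((x.1 : ℕ) + k * x.2 + 1) % k = 0 := by
      rw [show (x.1 : ℕ) + k * x.2 + 1 = k + k * x.2 by omega]
      simp
    rw [if_pos h₁, ite_self, if_neg (by omega)]
  · have h₁ : ((x.1 : ℕ) + k * x.2 + 1) % k ≠ 0 := by
      rw [show (x.1 : ℕ) + k * x.2 + 1 = ((x.1 : ℕ) + 1) + k * x.2 by omega, Nat.add_mul_mod_self_left,
        Nat.mod_eq_of_lt (by omega)]
      omega
    rw [if_neg h₁]
    refine if_congr ?_ rfl rfl
    constructor
    · intro h
      rcases lt_trichotomy (x.2 : ℕ) y.2 with h' | h' | h'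
      · have : k * ((x.2 : ℕ) + 1) ≤ k * y.2 := Nat.mul_le_mul_left k h'
        rw [mul_add] at this
        omega
      · rw [h'] at h
        exact ⟨h', by omega⟩
      · have : k * ((y.2 : ℕ) + 1) ≤ k * x.2 := Nat.mul_le_mul_left k h'
        rw [mul_add] at this
        omega
    · rintro ⟨h, h'⟩
      rw [h]
      omega

theorem isKCUnipotent_glReindex {k c : ℕ} {u : GL (Fin k × Fin c) F} :
    IsKCUnipotent (glReindex finProdFinEquiv u) ↔ InPattern (fun x y => x.1 < y.1) u := by
  have hb : ∀ a b i j, block (glReindex finProdFinEquiv u) a b i j =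
      (u : Matrix (Fin k × Fin c) (Fin k × Fin c) F) (a, i) (b, j) := by
    intro a b i j
    simp [block, glReindex_apply]
  constructor
  · rintro ⟨h₁, h₂⟩
    refine ⟨fun ⟨a, i⟩ => ?_, fun ⟨a, i⟩ ⟨b, j⟩ hne h => ?_⟩
    · rw [← hb, h₁]
      simp
    · rcases lt_trichotomy a b with h' | h' | h'
      · exact h'
      · subst h'
        rw [← hb, h₁] at h
        have : i ≠ j := fun e => hne (by rw [e])
        simp [this] at h
      · rw [← hb, h₂ a b h'] at h
        simp at h
  · rintro ⟨h₁, h₂⟩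
    refine ⟨fun a => ?_, fun a b hab => ?_⟩
    · ext i j
      rw [hb]
      by_cases hij : i = j
      · subst hij
        simp [h₁]
      · rw [Matrix.one_apply_ne hij]
        by_contra h
        exact lt_irrefl _ (h₂ (a, i) (a, j) (by simpa using hij) h)
    · ext i j
      rw [hb]
      by_contra h
      exact absurd (h₂ (a, i) (b, j) (by simp [hab.ne']) h) (not_lt.2 hab.le)

theorem kcChar_glReindex {k c : ℕ} (u : GL (Fin k × Fin c) F) :
    kcChar ψ (glReindex finProdFinEquiv u) = ψ (patForm (lineWeight F) u) := by
  rw [kcChar, patForm, Fintype.sum_prod_type]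
  congr 1
  refine Finset.sum_congr rfl fun a _ => ?_
  by_cases ha : (a : ℕ) + 1 < k
  · rw [dif_pos ha, Matrix.trace]
    refine Finset.sum_congr rfl fun i _ => ?_
    rw [Finset.sum_eq_single (⟨(a : ℕ) + 1, ha⟩, i)]
    · have : (a, i) ≠ (⟨(a : ℕ) + 1, ha⟩, i) := fun e => by
        simp [Fin.ext_iff] at e
      rw [if_neg this, lineWeight, if_pos ⟨rfl, rfl⟩]
      simp [block, glReindex_apply]
    · rintro ⟨b, j⟩ _ hne
      have : ¬ ((i : ℕ) = j ∧ (a : ℕ) + 1 = b) := fun h =>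
        hne (Prod.ext (Fin.ext h.2.symm) (Fin.ext h.1.symm))
      simp [lineWeight, this]
    · simp
  · rw [dif_neg ha]
    refine (Finset.sum_eq_zero fun i _ => Finset.sum_eq_zero fun y _ => ?_).symm
    have : ¬ (a : ℕ) + 1 = y.1 := fun e => ha (by omega)
    simp [lineWeight, this]

theorem lineWeight_cover {k c : ℕ} (x y z : Fin k × Fin c) (h : x.1 < y.1) (h' : y.1 < z.1) :
    lineWeight F x z = 0 := by
  rw [Fin.lt_def] at h h'
  exact lineWeight_eq_zero (by omega)

/-- With a block index read as the position and the index inside the block as the line, `ψ_{k,c}`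
has the same weights on neighbours of a line as the rectangular Zelevinsky character. This makes the
exchange possible. -/
theorem kcSpace_eq {k c : ℕ} (ρ : Representation ℂ (GL (Fin (k * c)) F) V) :
    kcSpace ψ ρ = patSpace ψ (ρ.comp (glReindex finProdFinEquiv).toMonoidHom)
      (fun x y : Fin k × Fin c => x.1 < y.1) (lineWeight F) := by
  ext v
  rw [mem_patSpace_iff (R := fun x y : Fin k × Fin c => x.1 < y.1) (fun x => lt_irrefl x.1)
    (fun _ _ _ => lt_trans) lineWeight_cover]
  constructor
  · intro h u hu
    rw [← kcChar_glReindex]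
    exact h _ (isKCUnipotent_glReindex.2 hu)
  · intro h u hu
    obtain ⟨u, rfl⟩ := (glReindex finProdFinEquiv).surjective u
    rw [kcChar_glReindex]
    exact h u (isKCUnipotent_glReindex.1 hu)

variable [Fintype F] [DecidableEq F]

/-- The last row of a line acts trivially, since otherwise there would be a Zelevinsky vector with
a character that is non-trivial on `k` consecutive simple roots. -/
theorem patSpace_chainRel_last (hψ : ψ ≠ 1) {k c l : ℕ} (hk : 1 ≤ k)
    {ρ : Representation ℂ (GL (Fin (k * c)) F) V} (hρ : RunVanish ψ k ρ) :
    patSpace ψ (ρ.comp (glReindex (lineEquiv k c)).toMonoidHom) (chainRel l (k - 1))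
        (lineWeight F) =
      patSpace ψ (ρ.comp (glReindex (lineEquiv k c)).toMonoidHom) (chainRel (l + 1) 0)
        (lineWeight F) := by
  apply le_antisymm
  swap
  · refine patSpace_anti (fun x y h => ?_) fun _ _ _ => rfl
    unfold chainRel at h ⊢
    grind
  intro v hv x y hxy t
  by_cases h : chainRel l (k - 1) x y
  · exact hv x y h t
  -- The two relations differ only in the pairs from the end of line `l` to later lines.
  obtain ⟨hx₁, hx₂, hy⟩ : (x.1 : ℕ) + 1 = k ∧ (x.2 : ℕ) = l ∧ l < (y.2 : ℕ) := by
    have := x.1.2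
    have := y.1.2
    unfold chainRel at h hxy
    grind
  have hw : lineWeight F x y = 0 := lineWeight_eq_zero (by omega)
  have hne : x ≠ y := fun e => by subst e; omega
  rw [hw, zero_mul, AddChar.map_zero_eq_one, one_smul]
  by_contra hact
  have hv₀ : v ≠ 0 := fun e => hact (by simp [e])
  set σ := lineEquiv k c x with hσ
  have hσv : (σ : ℕ) + 1 = k * l + k := by
    rw [hσ, lineEquiv_apply, hx₂]
    omega
  have hσy : σ < lineEquiv k c y := (lineEquiv_lt_iff x y).2 (Or.inl (by omega))
  have hτ : (σ : ℕ) + 1 < k * c := by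
    have := (lineEquiv k c y).2
    rw [Fin.lt_def] at hσy
    omega
  have hv' : v ∈ patSpace ψ ρ (prefixRel ((σ : ℕ) + 1)) (consecWeight (rectWeight F k)) := by
    rw [patSpace_comp_glReindex ρ _ (fun x hx => by unfold chainRel at hx; omega)] at hv
    refine patSpace_anti (fun i j hij => ?_) (fun i j _ => ?_) hv
    · obtain ⟨a, rfl⟩ := (lineEquiv k c).surjective i
      obtain ⟨b, rfl⟩ := (lineEquiv k c).surjective j
      rw [Equiv.symm_apply_apply, Equiv.symm_apply_apply]
      have h₁ := (lineEquiv_lt_iff a b).1 hij.1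
      have h₂ : lineEquiv k c a < lineEquiv k c x := by
        have := hij.2
        rw [Fin.lt_def]
        omega
      rw [lineEquiv_lt_iff] at h₂
      unfold chainRel
      grind
    · obtain ⟨a, rfl⟩ := (lineEquiv k c).surjective i
      obtain ⟨b, rfl⟩ := (lineEquiv k c).surjective j
      rw [Equiv.symm_apply_apply, Equiv.symm_apply_apply, consecWeight_lineEquiv]
  -- The nontrivial action forces the weight `1` between the end of line `l` and the next index.
  obtain ⟨δ, hδ, hδ', h'⟩ := exists_next_prefix hψ σ ⟨(σ : ℕ) + 1, hτ⟩ rfl hv₀ hv'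
  have hδ₁ : δ = 1 := by
    refine hδ' ⟨_, hσy, t, ?_⟩
    change ρ (glReindex (lineEquiv k c) (tv x y t)) v ≠ v at hact
    rwa [glReindex_tv _ hne] at hact
  obtain ⟨ε, h₁, h₂, h₃⟩ := exists_of_prefix hψ (k * c - ((σ : ℕ) + 2)) ⟨(σ : ℕ) + 1, hτ⟩
    (Function.update (rectWeight F k) σ δ) (by simp only; omega) (fun i => by
        by_cases hi : i = σ
        · subst hi
          simpa using hδ
        · rw [Function.update_of_ne hi, rectWeight]
          split_ifs <;> simp) h'
  -- The forbidden run starts at the beginning `k * l` of the line: `k - 1` ones inside the line,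
  -- and `δ = 1` at its end.
  refine h₃ (hρ ε h₁ (k * l) (by omega) fun s hs => ?_)
  rw [h₂ _ (by simp only; omega)]
  by_cases hs' : k * l + s = σ
  · rw [hs', Function.update_self, hδ₁]
  · rw [Function.update_of_ne hs', rectWeight, if_neg]
    rw [add_assoc, Nat.mul_add_mod, Nat.mod_eq_of_lt (by omega)]
    omega

variable [FiniteDimensional ℂ V]

theorem finrank_chainRel_zero (hψ : ψ ≠ 1) {k c : ℕ} (hk : 1 ≤ k)
    {ρ : Representation ℂ (GL (Fin (k * c)) F) V} (hρ : RunVanish ψ k ρ) (l : ℕ) (hl : l ≤ c) :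
    Module.finrank ℂ (patSpace ψ (ρ.comp (glReindex (lineEquiv k c)).toMonoidHom)
      (chainRel 0 0) (lineWeight F)) =
    Module.finrank ℂ (patSpace ψ (ρ.comp (glReindex (lineEquiv k c)).toMonoidHom)
      (chainRel l 0) (lineWeight F)) := by
  induction l with
  | zero => rfl
  | succ l ih =>
    rw [ih (by omega), finrank_chainRel (m := k - 1) hψ (by omega) (by omega),
      patSpace_chainRel_last hψ hk hρ]

/-- For a representation without Zelevinsky vectors with long runs, the spaces of `(k, c)_ψ` vectors
and of Zelevinsky vectors of type `(k^c)` have the same dimension. -/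
theorem finrank_kcSpace (hψ : ψ ≠ 1) {k c : ℕ} (hk : 1 ≤ k)
    {ρ : Representation ℂ (GL (Fin (k * c)) F) V} (hρ : RunVanish ψ k ρ) :
    Module.finrank ℂ (kcSpace ψ ρ) =
      Module.finrank ℂ (patSpace ψ ρ (· < ·) (consecWeight (rectWeight F k))) := by
  rw [kcSpace_eq, finrank_patSpace_comp_glReindex ρ finProdFinEquiv (lineEquiv k c)
      (R := fun x y : Fin k × Fin c => x.1 < y.1) (fun x => lt_irrefl x.1),
    patSpace_congr (R' := chainRel 0 0) (w' := lineWeight F) (fun x y => ?_) (fun _ _ _ => rfl),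
    finrank_chainRel_zero hψ hk hρ c le_rfl,
    patSpace_comp_glReindex ρ _ (fun x hx => by unfold chainRel at hx; omega)]
  · refine congrArg (fun W : Submodule ℂ V => Module.finrank ℂ W)
      (patSpace_congr (fun i j => ?_) fun i j _ => ?_)
    · obtain ⟨a, rfl⟩ := (lineEquiv k c).surjective i
      obtain ⟨b, rfl⟩ := (lineEquiv k c).surjective j
      rw [Equiv.symm_apply_apply, Equiv.symm_apply_apply, lineEquiv_lt_iff]
      have := a.2.2
      have := b.2.2
      unfold chainRel
      grind
    · obtain ⟨a, rfl⟩ := (lineEquiv k c).surjective i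
      obtain ⟨b, rfl⟩ := (lineEquiv k c).surjective j
      rw [Equiv.symm_apply_apply, Equiv.symm_apply_apply, consecWeight_lineEquiv]
  · rw [Fin.lt_def]
    unfold chainRel
    grind

end Vanishing

/-! ### Equivariant vectors in tensor products. -/

section Tensor

variable {V₁ V₂ : Type*} [AddCommGroup V₁] [Module ℂ V₁] [AddCommGroup V₂] [Module ℂ V₂]

/-- Contraction of the second tensor factor with a linear form. -/
noncomputable def contract (φ : V₂ →ₗ[ℂ] ℂ) : V₁ ⊗[ℂ] V₂ →ₗ[ℂ] V₁ :=
  (TensorProduct.rid ℂ V₁).toLinearMap ∘ₗ LinearMap.lTensor V₁ φ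

@[simp]
theorem contract_tmul (φ : V₂ →ₗ[ℂ] ℂ) (x : V₁) (y : V₂) : contract φ (x ⊗ₜ y) = φ y • x := by
  simp [contract]

theorem contract_map (A : V₁ →ₗ[ℂ] V₁) (φ : V₂ →ₗ[ℂ] ℂ) (z : V₁ ⊗[ℂ] V₂) :
    contract φ (TensorProduct.map A LinearMap.id z) = A (contract φ z) := by
  induction z using TensorProduct.induction_on with
  | zero => simp
  | tmul x y => simp
  | add x y hx hy => simp [hx, hy]

theorem sum_contract_tmul_basis [FiniteDimensional ℂ V₂] (z : V₁ ⊗[ℂ] V₂) :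
    ∑ j, contract ((Module.finBasis ℂ V₂).coord j) z ⊗ₜ Module.finBasis ℂ V₂ j = z := by
  induction z using TensorProduct.induction_on with
  | zero => simp
  | tmul x y =>
    simp only [contract_tmul, TensorProduct.smul_tmul, ← TensorProduct.tmul_sum]
    congr 1
    exact (Module.finBasis ℂ V₂).sum_repr y
  | add x y hx hy =>
    simp only [map_add, TensorProduct.add_tmul, Finset.sum_add_distrib]
    rw [hx, hy]

theorem comm_map (A : V₁ →ₗ[ℂ] V₁) (B : V₂ →ₗ[ℂ] V₂) (z : V₁ ⊗[ℂ] V₂) :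
    TensorProduct.comm ℂ V₁ V₂ (TensorProduct.map A B z) =
      TensorProduct.map B A (TensorProduct.comm ℂ V₁ V₂ z) := by
  induction z using TensorProduct.induction_on with
  | zero => simp
  | tmul x y => simp
  | add x y hx hy => simp [hx, hy]

variable {ι κ F : Type*} [Fintype ι] [DecidableEq ι] [Fintype κ] [DecidableEq κ] [Field F]
  {ψ : AddChar F ℂ} {σ₁ : Representation ℂ (GL ι F) V₁} {σ₂ : Representation ℂ (GL κ F) V₂}
  {R₁ : ι → ι → Prop} {w₁ : ι → ι → F} {R₂ : κ → κ → Prop} {w₂ : κ → κ → F}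

theorem contract_mem {z : V₁ ⊗[ℂ] V₂}
    (hz : ∀ i j, R₁ i j → ∀ t, TensorProduct.map (σ₁ (tv i j t)) LinearMap.id z =
      ψ (w₁ i j * t) • z) (φ : V₂ →ₗ[ℂ] ℂ) : contract φ z ∈ patSpace ψ σ₁ R₁ w₁ := by
  intro i j hij t
  rw [← contract_map, hz i j hij t, map_smul]

/-- The coordinates of `z` along a basis of the second factor all lie in the zero pattern space. -/
theorem tensor_eq_zero_of_left [FiniteDimensional ℂ V₂] {z : V₁ ⊗[ℂ] V₂}
    (hz : ∀ i j, R₁ i j → ∀ t, TensorProduct.map (σ₁ (tv i j t)) LinearMap.id z =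
      ψ (w₁ i j * t) • z) (hσ : patSpace ψ σ₁ R₁ w₁ = ⊥) : z = 0 := by
  rw [← sum_contract_tmul_basis z]
  refine Finset.sum_eq_zero fun j _ => ?_
  have h := contract_mem hz ((Module.finBasis ℂ V₂).coord j)
  rw [hσ, Submodule.mem_bot] at h
  rw [h, TensorProduct.zero_tmul]

theorem map_comm_eq {z : V₁ ⊗[ℂ] V₂}
    (hz : ∀ i j, R₂ i j → ∀ t, TensorProduct.map LinearMap.id (σ₂ (tv i j t)) z =
      ψ (w₂ i j * t) • z) (i j : κ) (hij : R₂ i j) (t : F) :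
    TensorProduct.map (σ₂ (tv i j t)) LinearMap.id (TensorProduct.comm ℂ V₁ V₂ z) =
      ψ (w₂ i j * t) • TensorProduct.comm ℂ V₁ V₂ z := by
  rw [← comm_map, hz i j hij, map_smul]

theorem tensor_eq_zero_of_right [FiniteDimensional ℂ V₁] {z : V₁ ⊗[ℂ] V₂}
    (hz : ∀ i j, R₂ i j → ∀ t, TensorProduct.map LinearMap.id (σ₂ (tv i j t)) z =
      ψ (w₂ i j * t) • z) (hσ : patSpace ψ σ₂ R₂ w₂ = ⊥) : z = 0 := by
  have := tensor_eq_zero_of_left (map_comm_eq hz) hσ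
  simpa using this

/-- Contraction of the second factor shows that `z` is `v₁` tensored with some vector; contraction
of the first with a form nonzero at `v₁` puts that vector on the line of `v₂`. -/
theorem tensor_eq_smul_tmul [FiniteDimensional ℂ V₂] {z : V₁ ⊗[ℂ] V₂}
    (hz₁ : ∀ i j, R₁ i j → ∀ t, TensorProduct.map (σ₁ (tv i j t)) LinearMap.id z =
      ψ (w₁ i j * t) • z)
    (hz₂ : ∀ i j, R₂ i j → ∀ t, TensorProduct.map LinearMap.id (σ₂ (tv i j t)) z =
      ψ (w₂ i j * t) • z) {v₁ : V₁} {v₂ : V₂} (hv₁ : v₁ ≠ 0)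
    (h₁ : ∀ x ∈ patSpace ψ σ₁ R₁ w₁, ∃ r : ℂ, r • v₁ = x)
    (h₂ : ∀ x ∈ patSpace ψ σ₂ R₂ w₂, ∃ r : ℂ, r • v₂ = x) : ∃ r : ℂ, z = r • v₁ ⊗ₜ[ℂ] v₂ := by
  choose r hr using fun j => h₁ _ (contract_mem hz₁ ((Module.finBasis ℂ V₂).coord j))
  have hz : z = v₁ ⊗ₜ[ℂ] ∑ j, r j • Module.finBasis ℂ V₂ j := by
    conv_lhs => rw [← sum_contract_tmul_basis z]
    rw [TensorProduct.tmul_sum]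
    refine Finset.sum_congr rfl fun j _ => ?_
    rw [← hr j, TensorProduct.smul_tmul]
  obtain ⟨φ, hφ⟩ : ∃ φ : Module.Dual ℂ V₁, φ v₁ ≠ 0 := by
    by_contra hφ
    push Not at hφ
    exact hv₁ ((Module.forall_dual_apply_eq_zero_iff ℂ v₁).1 hφ)
  have h := contract_mem (map_comm_eq hz₂) φ
  rw [hz, TensorProduct.comm_tmul, contract_tmul, Submodule.smul_mem_iff _ hφ] at h
  obtain ⟨q, hq⟩ := h₂ _ h
  exact ⟨q, by rw [hz, ← hq, TensorProduct.tmul_smul]⟩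

end Tensor

/-! ### Shuffles as representatives of the double cosets of the parabolic and the unipotent group.
-/

section Mackey

variable {F : Type*} [Field F] {n₁ n₂ n : ℕ} (h : n₁ + n₂ = n)

/-- The labelling of the indices of `GL_n` by the two blocks of the parabolic subgroup. -/
def sumEquiv : Fin n₁ ⊕ Fin n₂ ≃ Fin n := finSumFinEquiv.trans (finCongr h)

theorem isParabolicWith_iff {p : GL (Fin n) F} {g₁ : GL (Fin n₁) F} {g₂ : GL (Fin n₂) F} :
    IsParabolicWith h p g₁ g₂ ↔
      (∀ a b, (p : Matrix (Fin n) (Fin n) F) (sumEquiv h (.inl a)) (sumEquiv h (.inl b)) =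
        (g₁ : Matrix (Fin n₁) (Fin n₁) F) a b) ∧
      (∀ a b, (p : Matrix (Fin n) (Fin n) F) (sumEquiv h (.inr a)) (sumEquiv h (.inr b)) =
        (g₂ : Matrix (Fin n₂) (Fin n₂) F) a b) ∧
      ∀ a b, (p : Matrix (Fin n) (Fin n) F) (sumEquiv h (.inr a)) (sumEquiv h (.inl b)) = 0 := by
  constructor
  · rintro ⟨X, hX⟩
    rw [hX]
    refine ⟨fun a b => ?_, fun a b => ?_, fun a b => ?_⟩ <;> simp [sumEquiv]
  · rintro ⟨h₁, h₂, h₃⟩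
    refine ⟨Matrix.of fun a b => (p : Matrix (Fin n) (Fin n) F) (sumEquiv h (.inl a))
      (sumEquiv h (.inr b)), ?_⟩
    ext i j
    obtain ⟨x, rfl⟩ := (sumEquiv h).surjective i
    obtain ⟨y, rfl⟩ := (sumEquiv h).surjective j
    change _ = Matrix.reindex (sumEquiv h) (sumEquiv h) _ _ _
    rw [Matrix.reindex_apply, Matrix.submatrix_apply, Equiv.symm_apply_apply,
      Equiv.symm_apply_apply]
    rcases x with a | a <;> rcases y with b | b <;> simp [h₁, h₂, h₃]

theorem exists_isParabolicWith {p : GL (Fin n) F}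
    (hp : ∀ a b, (p : Matrix (Fin n) (Fin n) F) (sumEquiv h (.inr a)) (sumEquiv h (.inl b)) = 0) :
    ∃ g₁ g₂, IsParabolicWith h p g₁ g₂ := by
  set M := (p : Matrix (Fin n) (Fin n) F).submatrix (sumEquiv h) (sumEquiv h) with hM
  have hdet : M.det ≠ 0 := by
    rw [hM, Matrix.det_submatrix_equiv_self]
    exact p.det_ne_zero
  have hM' : M = Matrix.fromBlocks M.toBlocks₁₁ M.toBlocks₁₂ 0 M.toBlocks₂₂ := by
    conv_lhs => rw [← Matrix.fromBlocks_toBlocks M]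
    congr 1
    ext a b
    exact hp a b
  rw [hM', Matrix.det_fromBlocks_zero₂₁] at hdet
  refine ⟨Matrix.GeneralLinearGroup.mkOfDetNeZero _ (left_ne_zero_of_mul hdet),
    Matrix.GeneralLinearGroup.mkOfDetNeZero _ (right_ne_zero_of_mul hdet), ?_⟩
  rw [isParabolicWith_iff]
  exact ⟨fun a b => rfl, fun a b => rfl, hp⟩

theorem isParabolicWith_tv_inl {a b : Fin n₁} (hab : a ≠ b) (t : F) :
    IsParabolicWith h (tv (sumEquiv h (.inl a)) (sumEquiv h (.inl b)) t) (tv a b t) 1 := by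
  have hne : sumEquiv h (.inl a) ≠ sumEquiv h (.inl b) := by simpa using hab
  rw [isParabolicWith_iff]
  refine ⟨fun i j => ?_, fun i j => ?_, fun i j => ?_⟩ <;>
    simp [tv_apply hne, tv_apply hab, Matrix.one_apply]

theorem isParabolicWith_tv_inr {a b : Fin n₂} (hab : a ≠ b) (t : F) :
    IsParabolicWith h (tv (sumEquiv h (.inr a)) (sumEquiv h (.inr b)) t) 1 (tv a b t) := by
  have hne : sumEquiv h (.inr a) ≠ sumEquiv h (.inr b) := by simpa using hab
  rw [isParabolicWith_iff]
  refine ⟨fun i j => ?_, fun i j => ?_, fun i j => ?_⟩ <;>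
    simp [tv_apply hne, tv_apply hab, Matrix.one_apply]

theorem isParabolicWith_tv_inl_inr (a : Fin n₁) (b : Fin n₂) (t : F) :
    IsParabolicWith h (tv (sumEquiv h (.inl a)) (sumEquiv h (.inr b)) t) 1 1 := by
  have hne : sumEquiv h (.inl a) ≠ sumEquiv h (.inr b) := by simp
  rw [isParabolicWith_iff]
  refine ⟨fun i j => ?_, fun i j => ?_, fun i j => ?_⟩ <;>
    simp [tv_apply hne, Matrix.one_apply]

open Classical in
/-- Every subspace of row vectors is the image under a unipotent upper triangular matrix of the
span of the basis vectors at its leading indices. -/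
theorem exists_upperUnipotent_span (S : Submodule F (Fin n → F)) :
    ∃ (T : Finset (Fin n)) (u : GL (Fin n) F), IsUpperUnipotent u ∧
      ∀ y, Matrix.vecMul y (u : Matrix (Fin n) (Fin n) F) ∈ S ↔ ∀ j ∉ T, y j = 0 := by
  set T : Finset (Fin n) :=
    Finset.univ.filter fun t => ∃ x ∈ S, x t = 1 ∧ ∀ j < t, x j = 0 with hT
  have hx : ∀ t, ∃ x : Fin n → F, (t ∈ T → x ∈ S) ∧ x t = 1 ∧ ∀ j < t, x j = 0 := by
    intro t
    by_cases ht : t ∈ T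
    · obtain ⟨x, hx, h₁, h₂⟩ := (Finset.mem_filter.1 ht).2
      exact ⟨x, fun _ => hx, h₁, h₂⟩
    · exact ⟨Pi.single t 1, fun h => absurd h ht, by simp, fun j hj => by simp [hj.ne]⟩
  choose x hxS hx₁ hx₀ using hx
  have hdet : (Matrix.of x).det ≠ 0 := by
    rw [Matrix.det_of_isUpperTriangular (M := Matrix.of x) (fun i j hij => hx₀ i j hij)]
    simp [hx₁]
  set u := Matrix.GeneralLinearGroup.mkOfDetNeZero _ hdet with hu
  have huS : ∀ y : Fin n → F, (∀ j ∉ T, y j = 0) →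
      Matrix.vecMul y (u : Matrix (Fin n) (Fin n) F) ∈ S := by
    intro y hy
    have : Matrix.vecMul y (u : Matrix (Fin n) (Fin n) F) = ∑ t, y t • x t := by
      ext j
      simp [Matrix.vecMul, dotProduct, hu]
    rw [this]
    refine Submodule.sum_mem _ fun t _ => ?_
    by_cases ht : t ∈ T
    · exact S.smul_mem _ (hxS t ht)
    · rw [hy t ht, zero_smul]
      exact S.zero_mem
  refine ⟨T, u, ⟨fun i => hx₁ i, fun i j hij => hx₀ i j hij⟩, fun y => ⟨fun hy => ?_, huS y⟩⟩
  by_contra hne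
  push Not at hne
  -- After subtracting an element of `S`, the coefficients are supported off `T`. The first nonzero
  -- one would then be a leading index of a vector of `S`, hence in `T`.
  set y' : Fin n → F := fun j => if j ∈ T then 0 else y j with hy'
  have hy'S : Matrix.vecMul y' (u : Matrix (Fin n) (Fin n) F) ∈ S := by
    have : y' = y - fun j => if j ∈ T then y j else 0 := by
      ext j
      simp only [hy', Pi.sub_apply]
      split_ifs <;> simp
    rw [this, Matrix.sub_vecMul]
    exact S.sub_mem hy (huS _ fun j hj => if_neg hj)
  obtain ⟨j₀, hj₀, hmin⟩ := Finset.exists_min_image (Finset.univ.filter fun j => y' j ≠ 0) id (by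
    obtain ⟨j, hj, hjy⟩ := hne
    exact ⟨j, by simpa [hy', hj] using hjy⟩)
  simp only [Finset.mem_filter, Finset.mem_univ, true_and, id] at hj₀ hmin
  have hzero : ∀ j < j₀, y' j = 0 := fun j hj => by
    by_contra hne
    exact absurd (hmin j hne) (not_le.2 hj)
  have hj₀T : j₀ ∉ T := fun hmem => hj₀ (by simp [hy', hmem])
  have hval : ∀ j ≤ j₀, Matrix.vecMul y' (u : Matrix (Fin n) (Fin n) F) j = y' j := by
    intro j hj
    change ∑ i, y' i * x i j = _
    rw [Finset.sum_eq_single j]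
    · rw [hx₁, mul_one]
    · intro i _ hij
      rcases lt_or_gt_of_ne hij with hlt | hlt
      · rw [hzero i (lt_of_lt_of_le hlt hj), zero_mul]
      · rw [hx₀ i j hlt, mul_zero]
    · simp
  refine hj₀T (Finset.mem_filter.2 ⟨Finset.mem_univ _,
    (y' j₀)⁻¹ • Matrix.vecMul y' (u : Matrix (Fin n) (Fin n) F), S.smul_mem _ hy'S, ?_, ?_⟩)
  · rw [Pi.smul_apply, hval j₀ le_rfl, smul_eq_mul, inv_mul_cancel₀ hj₀]
  · intro j hj
    rw [Pi.smul_apply, hval j hj.le, hzero j hj, smul_zero]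

/-- The permutation matrix whose row `sumEquiv h x` is the basis vector at `e x`. -/
def shuffle (e : Fin n₁ ⊕ Fin n₂ ≃ Fin n) : GL (Fin n) F := permGL (e.symm.trans (sumEquiv h))

theorem shuffle_mul_tv (e : Fin n₁ ⊕ Fin n₂ ≃ Fin n) {x y : Fin n₁ ⊕ Fin n₂} (hxy : x ≠ y)
    (t : F) : shuffle h e * tv (e x) (e y) t =
      tv (sumEquiv h x) (sumEquiv h y) t * shuffle h e := by
  have := permGL_mul_tv (e.symm.trans (sumEquiv h)) (e.injective.ne hxy) t
  simp only [Equiv.trans_apply, Equiv.symm_apply_apply] at this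
  exact this

/-- Every element of `GL_n` is the product of an element of the parabolic subgroup, a shuffle
permutation, and an upper triangular unipotent matrix. -/
theorem exists_shuffle (g : GL (Fin n) F) : ∃ (e : Fin n₁ ⊕ Fin n₂ ≃ Fin n) (p u : GL (Fin n) F)
    (g₁ : GL (Fin n₁) F) (g₂ : GL (Fin n₂) F),
    StrictMono (e ∘ Sum.inl) ∧ StrictMono (e ∘ Sum.inr) ∧ IsUpperUnipotent u ∧
      IsParabolicWith h p g₁ g₂ ∧ g = p * (shuffle h e * u) := by
  classical
  -- Left multiplication by the parabolic preserves the span of the lower rows; the echelon form of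
  -- this span supplies both the shuffle and the unipotent factor.
  set r : Fin n₂ → Fin n → F := fun b => (g : Matrix (Fin n) (Fin n) F) (sumEquiv h (.inr b))
    with hr
  obtain ⟨T, u, hu, hT⟩ := exists_upperUnipotent_span (Submodule.span F (Set.range r))
  have hlin : LinearIndependent F (g : Matrix (Fin n) (Fin n) F).row :=
    Matrix.linearIndependent_rows_iff_isUnit.2 g.isUnit
  have hrlin : LinearIndependent F r := hlin.comp _ ((sumEquiv h).injective.comp Sum.inr_injective)
  have hulin : LinearIndependent F (fun t : T => (u : Matrix (Fin n) (Fin n) F).row t) :=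
    (Matrix.linearIndependent_rows_iff_isUnit.2 u.isUnit).comp _ Subtype.val_injective
  have hspan : Submodule.span F (Set.range r) =
      Submodule.span F (Set.range fun t : T => (u : Matrix (Fin n) (Fin n) F).row t) := by
    apply le_antisymm
    · intro y hy
      have hy' : Matrix.vecMul (Matrix.vecMul y ((u⁻¹ : GL (Fin n) F) : Matrix (Fin n) (Fin n) F))
          (u : Matrix (Fin n) (Fin n) F) = y := by
        have : ((u⁻¹ : GL (Fin n) F) : Matrix (Fin n) (Fin n) F) * u = 1 := Units.inv_mul u
        rw [Matrix.vecMul_vecMul, this, Matrix.vecMul_one]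
      have hz := (hT _).1 (hy'.symm ▸ hy)
      rw [← hy']
      set z := Matrix.vecMul y ((u⁻¹ : GL (Fin n) F) : Matrix (Fin n) (Fin n) F)
      have : Matrix.vecMul z (u : Matrix (Fin n) (Fin n) F) =
          ∑ t, z t • (u : Matrix (Fin n) (Fin n) F).row t := by
        ext j
        simp [Matrix.vecMul, dotProduct]
      rw [this]
      refine Submodule.sum_mem _ fun t _ => ?_
      by_cases ht : t ∈ T
      · exact Submodule.smul_mem _ _ (Submodule.subset_span ⟨⟨t, ht⟩, rfl⟩)
      · rw [hz t ht, zero_smul]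
        exact Submodule.zero_mem _
    · rw [Submodule.span_le]
      rintro _ ⟨t, rfl⟩
      have := (hT (Pi.single (t : Fin n) 1)).2 fun j hj => by
        have : j ≠ t := fun e => hj (e ▸ t.2)
        simp [this]
      simpa using this
  have hcard : T.card = n₂ := by
    have h₁ := finrank_span_eq_card hrlin
    rw [hspan, finrank_span_eq_card hulin] at h₁
    simpa using h₁
  have hcard' : Tᶜ.card = n₁ := by
    rw [Finset.card_compl, hcard, Fintype.card_fin]
    omega
  have hcard'' : Tᶜᶜ.card = n₂ := by
    rw [compl_compl, hcard]
  set e := finSumEquivOfFinset hcard' hcard'' with he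
  set p := g * u⁻¹ * permGL ((sumEquiv h).symm.trans e) with hp
  have hperm : permGL ((sumEquiv h).symm.trans e) * shuffle h e = (1 : GL (Fin n) F) := by
    ext i j
    rw [shuffle, mul_permGL_apply]
    simp [permGL, Matrix.one_apply]
  -- The lower rows of `g * u⁻¹` are supported on `T`, while `e` sends the first block to the
  -- complement of `T`.
  have hlow : ∀ a b, (p : Matrix (Fin n) (Fin n) F) (sumEquiv h (.inr a)) (sumEquiv h (.inl b)) =
      0 := by
    intro a b
    rw [hp, mul_permGL_apply]
    have hmem := (hT (Matrix.vecMul (r a) ((u⁻¹ : GL (Fin n) F) : Matrix (Fin n) (Fin n) F))).1 (by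
      have : ((u⁻¹ : GL (Fin n) F) : Matrix (Fin n) (Fin n) F) * u = 1 := Units.inv_mul u
      rw [Matrix.vecMul_vecMul, this, Matrix.vecMul_one]
      exact Submodule.subset_span ⟨a, rfl⟩)
    have hb : e (.inl b) ∉ T := by
      rw [he, finSumEquivOfFinset_inl, ← Finset.mem_compl]
      exact Finset.orderEmbOfFin_mem _ _ _
    have := hmem _ hb
    simp only [Equiv.trans_apply, Equiv.symm_apply_apply]
    exact this
  obtain ⟨g₁, g₂, hpar⟩ := exists_isParabolicWith h hlow
  refine ⟨e, p, u, g₁, g₂, ?_, ?_, hu, hpar, ?_⟩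
  · exact (Tᶜ.orderEmbOfFin hcard').strictMono
  · exact (Tᶜᶜ.orderEmbOfFin hcard'').strictMono
  · rw [hp, ← mul_assoc, mul_assoc _ _ (shuffle h e), hperm, mul_one, mul_assoc, inv_mul_cancel,
      mul_one]

end Mackey

/-! ### Weights seen by one block of a shuffle. -/

section InducedWeights

variable {F : Type*} [Field F]

/-- The weights induced on one of the blocks of a shuffle. -/
def inducedWeight {m n : ℕ} (ε : ℕ → F) (a : Fin m → Fin n) (i : ℕ) : F :=
  if hi : i + 1 < m then consecWeight ε (a ⟨i, by omega⟩) (a ⟨i + 1, hi⟩) else 0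

/-- For indices not adjacent in the block, monotonicity puts another index between their images, so
both weights vanish. -/
theorem consecWeight_inducedWeight {m n : ℕ} (ε : ℕ → F) {a : Fin m → Fin n} (ha : StrictMono a)
    {i j : Fin m} (hij : i < j) :
    consecWeight (inducedWeight ε a) i j = consecWeight ε (a i) (a j) := by
  by_cases h : (i : ℕ) + 1 = j
  · have hlt : (i : ℕ) + 1 < m := by omega
    rw [consecWeight, if_pos h, inducedWeight, dif_pos hlt]
    congr 2
    exact Fin.ext h
  · have hlt : (i : ℕ) + 1 < j := by
      rw [Fin.lt_def] at hij
      omega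
    have h₁ : a i < a ⟨(i : ℕ) + 1, by omega⟩ := ha (by rw [Fin.lt_def]; simp)
    have h₂ : a ⟨(i : ℕ) + 1, by omega⟩ < a j := ha hlt
    rw [consecWeight, if_neg h, consecWeight_cover ε _ _ _ h₁ h₂]

theorem inducedWeight_zero_or_one {m n : ℕ} {ε : ℕ → F} (hε : ∀ i, ε i = 0 ∨ ε i = 1)
    (a : Fin m → Fin n) (i : ℕ) : inducedWeight ε a i = 0 ∨ inducedWeight ε a i = 1 := by
  unfold inducedWeight consecWeight
  split_ifs
  · exact hε _
  · exact Or.inl rfl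
  · exact Or.inl rfl

theorem exists_succ_of_mem_range {m n : ℕ} {a : Fin m → Fin n} (ha : StrictMono a) {i : Fin m}
    {x : Fin n} (hx : x ∈ Set.range a) (hix : (a i : ℕ) + 1 = x) :
    ∃ hi : (i : ℕ) + 1 < m, a ⟨(i : ℕ) + 1, hi⟩ = x := by
  obtain ⟨j, rfl⟩ := hx
  have hij : i < j := ha.lt_iff_lt.1 (by rw [Fin.lt_def]; omega)
  have hi : (i : ℕ) + 1 < m := by
    rw [Fin.lt_def] at hij
    omega
  refine ⟨hi, ?_⟩
  by_contra hne
  have h₁ : a i < a ⟨(i : ℕ) + 1, hi⟩ := ha (by rw [Fin.lt_def]; simp)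
  have h₂ : a ⟨(i : ℕ) + 1, hi⟩ < a j := by
    refine ha (lt_of_le_of_ne ?_ fun e => hne (by rw [e]))
    rw [Fin.lt_def] at hij
    rw [Fin.le_def]
    exact hij
  rw [Fin.lt_def] at h₁ h₂
  omega

/-- A run of consecutive indices in the range of `a` on which `ε` is `1` gives a run of the induced
weights. -/
theorem exists_run {m n : ℕ} {ε : ℕ → F} {a : Fin m → Fin n} (ha : StrictMono a) {i k : ℕ}
    (hrange : ∀ t ≤ k, ∃ x ∈ Set.range a, (x : ℕ) = i + t) (hε : ∀ t < k, ε (i + t) = 1) :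
    ∃ j, j + k < m ∧ ∀ t < k, inducedWeight ε a (j + t) = 1 := by
  obtain ⟨_, ⟨j, rfl⟩, hj⟩ := hrange 0 (Nat.zero_le _)
  have key : ∀ t ≤ k, ∃ hlt : (j : ℕ) + t < m, (a ⟨(j : ℕ) + t, hlt⟩ : ℕ) = i + t := by
    intro t
    induction t with
    | zero => exact fun _ => ⟨j.2, hj⟩
    | succ t ih =>
      intro ht
      obtain ⟨hlt, hat⟩ := ih (by omega)
      obtain ⟨x, hx, hxi⟩ := hrange (t + 1) ht
      obtain ⟨hi, hix⟩ := exists_succ_of_mem_range ha (i := ⟨(j : ℕ) + t, hlt⟩) hx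
        (by rw [hat, hxi]; omega)
      exact ⟨hi, by rw [← hxi, ← hix]; rfl⟩
  refine ⟨j, (key k le_rfl).1, fun t ht => ?_⟩
  obtain ⟨h₁, h₂⟩ := key t ht.le
  obtain ⟨h₃, h₄⟩ := key (t + 1) ht
  rw [inducedWeight, dif_pos (by omega), consecWeight, if_pos, h₂, hε t ht]
  rw [h₂]
  exact (h₄.trans (by omega)).symm

end InducedWeights

/-! ### Zelevinsky vectors of a parabolic induction. -/

section MackeyZelevinsky

variable {F : Type*} [Field F] {n₁ n₂ n : ℕ} {h : n₁ + n₂ = n}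
  {V₁ V₂ : Type*} [AddCommGroup V₁] [Module ℂ V₁] [AddCommGroup V₂] [Module ℂ V₂]
  {ψ : AddChar F ℂ} {σ₁ : Representation ℂ (GL (Fin n₁) F) V₁}
  {σ₂ : Representation ℂ (GL (Fin n₂) F) V₂}

theorem parabolicInduction_apply (x : GL (Fin n) F) (f : parabolicSpace h σ₁ σ₂)
    (g : GL (Fin n) F) : (parabolicInduction h σ₁ σ₂ x f).1 g = f.1 (g * x) := rfl

/-- The value of an equivariant function on the double coset of a shuffle vanishes if the value at
the shuffle does. -/
theorem apply_eq_zero_of_shuffle {ε : ℕ → F} {f : parabolicSpace h σ₁ σ₂}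
    (hf : f ∈ patSpace ψ (parabolicInduction h σ₁ σ₂) (· < ·) (consecWeight ε))
    {e : Fin n₁ ⊕ Fin n₂ ≃ Fin n} (he : f.1 (shuffle h e) = 0) {p u : GL (Fin n) F}
    {g₁ : GL (Fin n₁) F} {g₂ : GL (Fin n₂) F} (hp : IsParabolicWith h p g₁ g₂)
    (hu : IsUpperUnipotent u) : f.1 (p * (shuffle h e * u)) = 0 := by
  rw [f.2 p g₁ g₂ hp, ← parabolicInduction_apply u f,
    apply_of_mem_patSpace (R := (· < ·)) (fun i => lt_irrefl i) (fun _ _ _ => lt_trans)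
      (consecWeight_cover _) hf (inPattern_lt_iff.2 hu)]
  change TensorProduct.map (σ₁ g₁) (σ₂ g₂) (ψ (patForm (consecWeight ε) u) • f.1 (shuffle h e)) = 0
  rw [he, smul_zero, map_zero]

/-- Commuting a root element through the shuffle compares the eigenvalue under right translation
with the equivariance under the parabolic on the left. -/
theorem shuffle_apply_tv {ε : ℕ → F} {f : parabolicSpace h σ₁ σ₂}
    (hf : f ∈ patSpace ψ (parabolicInduction h σ₁ σ₂) (· < ·) (consecWeight ε))
    {e : Fin n₁ ⊕ Fin n₂ ≃ Fin n} {x y : Fin n₁ ⊕ Fin n₂} (hxy : e x < e y) {t : F}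
    {g₁ : GL (Fin n₁) F} {g₂ : GL (Fin n₂) F}
    (hp : IsParabolicWith h (tv (sumEquiv h x) (sumEquiv h y) t) g₁ g₂) :
    TensorProduct.map (σ₁ g₁) (σ₂ g₂) (f.1 (shuffle h e)) =
      ψ (consecWeight ε (e x) (e y) * t) • f.1 (shuffle h e) := by
  have hne : x ≠ y := fun he => by
    subst he
    exact lt_irrefl _ hxy
  rw [← f.2 _ g₁ g₂ hp, ← shuffle_mul_tv h e hne, ← parabolicInduction_apply, hf _ _ hxy]
  rfl

theorem shuffle_left {ε : ℕ → F} {f : parabolicSpace h σ₁ σ₂}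
    (hf : f ∈ patSpace ψ (parabolicInduction h σ₁ σ₂) (· < ·) (consecWeight ε))
    {e : Fin n₁ ⊕ Fin n₂ ≃ Fin n} (he : StrictMono (e ∘ Sum.inl)) (i j : Fin n₁) (hij : i < j)
    (t : F) : TensorProduct.map (σ₁ (tv i j t)) LinearMap.id (f.1 (shuffle h e)) =
      ψ (consecWeight (inducedWeight ε (e ∘ Sum.inl)) i j * t) • f.1 (shuffle h e) := by
  rw [consecWeight_inducedWeight ε he hij]
  have := shuffle_apply_tv hf (e := e) (x := .inl i) (y := .inl j) (he hij) (t := t)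
    (isParabolicWith_tv_inl h hij.ne t)
  rwa [map_one] at this

theorem shuffle_right {ε : ℕ → F} {f : parabolicSpace h σ₁ σ₂}
    (hf : f ∈ patSpace ψ (parabolicInduction h σ₁ σ₂) (· < ·) (consecWeight ε))
    {e : Fin n₁ ⊕ Fin n₂ ≃ Fin n} (he : StrictMono (e ∘ Sum.inr)) (i j : Fin n₂) (hij : i < j)
    (t : F) : TensorProduct.map LinearMap.id (σ₂ (tv i j t)) (f.1 (shuffle h e)) =
      ψ (consecWeight (inducedWeight ε (e ∘ Sum.inr)) i j * t) • f.1 (shuffle h e) := by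
  rw [consecWeight_inducedWeight ε he hij]
  have := shuffle_apply_tv hf (e := e) (x := .inr i) (y := .inr j) (he hij) (t := t)
    (isParabolicWith_tv_inr h hij.ne t)
  rwa [map_one] at this

/-- The shuffle carries this simple root into the unipotent radical of the parabolic, which acts
trivially on values. A nonzero weight would force the value to vanish. -/
theorem shuffle_cross (hψ : ψ ≠ 1) {ε : ℕ → F} {f : parabolicSpace h σ₁ σ₂}
    (hf : f ∈ patSpace ψ (parabolicInduction h σ₁ σ₂) (· < ·) (consecWeight ε))
    {e : Fin n₁ ⊕ Fin n₂ ≃ Fin n} (he : f.1 (shuffle h e) ≠ 0) {a : Fin n₁} {b : Fin n₂}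
    (hab : (e (.inl a) : ℕ) + 1 = e (.inr b)) : ε (e (.inl a)) = 0 := by
  by_contra hε
  obtain ⟨t, ht⟩ : ∃ t, ψ t ≠ 1 := by
    by_contra hall
    push Not at hall
    exact hψ (by ext t; simpa using hall t)
  have := shuffle_apply_tv hf (e := e) (x := .inl a) (y := .inr b)
    (by rw [Fin.lt_def]; omega) (t := (ε (e (.inl a)))⁻¹ * t) (isParabolicWith_tv_inl_inr h a b _)
  rw [map_one, map_one, consecWeight, if_pos hab, mul_inv_cancel_left₀ hε] at this
  have h0 : (ψ t - 1) • f.1 (shuffle h e) = 0 := by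
    rw [sub_smul, one_smul, ← this]
    simp [sub_self]
  rcases smul_eq_zero.1 h0 with h0 | h0
  · exact ht (sub_eq_zero.1 h0)
  · exact he h0

theorem shuffle_eq_zero_of_right [FiniteDimensional ℂ V₁] {k₂ : ℕ} (h₂ : RunVanish ψ k₂ σ₂) {ε : ℕ → F}
    (hε : ∀ i, ε i = 0 ∨ ε i = 1) {f : parabolicSpace h σ₁ σ₂}
    (hf : f ∈ patSpace ψ (parabolicInduction h σ₁ σ₂) (· < ·) (consecWeight ε))
    {e : Fin n₁ ⊕ Fin n₂ ≃ Fin n} (he : StrictMono (e ∘ Sum.inr)) {i : ℕ}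
    (hrange : ∀ t ≤ k₂, ∃ x ∈ Set.range (e ∘ Sum.inr), (x : ℕ) = i + t)
    (hrun : ∀ t < k₂, ε (i + t) = 1) : f.1 (shuffle h e) = 0 := by
  obtain ⟨j, hj, hj'⟩ := exists_run he hrange hrun
  exact tensor_eq_zero_of_right (shuffle_right hf he)
    (h₂ _ (inducedWeight_zero_or_one hε _) j hj hj')

theorem shuffle_eq_zero_of_left [FiniteDimensional ℂ V₂] {k₁ : ℕ} (h₁ : RunVanish ψ k₁ σ₁) {ε : ℕ → F}
    (hε : ∀ i, ε i = 0 ∨ ε i = 1) {f : parabolicSpace h σ₁ σ₂}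
    (hf : f ∈ patSpace ψ (parabolicInduction h σ₁ σ₂) (· < ·) (consecWeight ε))
    {e : Fin n₁ ⊕ Fin n₂ ≃ Fin n} (he : StrictMono (e ∘ Sum.inl)) {i : ℕ}
    (hrange : ∀ t ≤ k₁, ∃ x ∈ Set.range (e ∘ Sum.inl), (x : ℕ) = i + t)
    (hrun : ∀ t < k₁, ε (i + t) = 1) : f.1 (shuffle h e) = 0 := by
  obtain ⟨j, hj, hj'⟩ := exists_run he hrange hrun
  exact tensor_eq_zero_of_left (shuffle_left hf he)
    (h₁ _ (inducedWeight_zero_or_one hε _) j hj hj')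

theorem mem_range_inl_or_inr (e : Fin n₁ ⊕ Fin n₂ ≃ Fin n) (x : Fin n) :
    x ∈ Set.range (e ∘ Sum.inl) ∨ x ∈ Set.range (e ∘ Sum.inr) := by
  obtain ⟨y | y, rfl⟩ := e.surjective x
  · exact Or.inl ⟨y, rfl⟩
  · exact Or.inr ⟨y, rfl⟩

/-- If the value at a shuffle is nonzero, then within a run the indices of the second block come
before those of the first. -/
theorem mem_range_inl_of_run (hψ : ψ ≠ 1) {ε : ℕ → F} {f : parabolicSpace h σ₁ σ₂}
    (hf : f ∈ patSpace ψ (parabolicInduction h σ₁ σ₂) (· < ·) (consecWeight ε))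
    {e : Fin n₁ ⊕ Fin n₂ ≃ Fin n} (he : f.1 (shuffle h e) ≠ 0) {i m : ℕ} (him : i + m < n)
    (hrun : ∀ t < m, ε (i + t) = 1) (hi : (⟨i, by omega⟩ : Fin n) ∈ Set.range (e ∘ Sum.inl)) :
    (⟨i + m, him⟩ : Fin n) ∈ Set.range (e ∘ Sum.inl) := by
  induction m with
  | zero => exact hi
  | succ m ih =>
    obtain ⟨a, ha⟩ := ih (by omega) (fun t ht => hrun t (by omega)) hi
    rcases mem_range_inl_or_inr e ⟨i + (m + 1), him⟩ with h' | ⟨b, hb⟩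
    · exact h'
    · have ha' : (e (.inl a) : ℕ) = i + m := congrArg Fin.val ha
      have hb' : (e (.inr b) : ℕ) = i + (m + 1) := congrArg Fin.val hb
      have := shuffle_cross hψ hf he (a := a) (b := b) (by omega)
      rw [ha', hrun m (by omega)] at this
      exact absurd this one_ne_zero

theorem exists_shuffle_ne_zero {ε : ℕ → F} {f : parabolicSpace h σ₁ σ₂}
    (hf : f ∈ patSpace ψ (parabolicInduction h σ₁ σ₂) (· < ·) (consecWeight ε)) (hne : f ≠ 0) :
    ∃ e : Fin n₁ ⊕ Fin n₂ ≃ Fin n, StrictMono (e ∘ Sum.inl) ∧ StrictMono (e ∘ Sum.inr) ∧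
      f.1 (shuffle h e) ≠ 0 := by
  by_contra hall
  push Not at hall
  refine hne (Subtype.ext (funext fun g => ?_))
  obtain ⟨e, p, u, g₁, g₂, he₁, he₂, hu, hp, rfl⟩ := exists_shuffle h g
  exact apply_eq_zero_of_shuffle hf (hall e he₁ he₂) hp hu

theorem not_mem_both (e : Fin n₁ ⊕ Fin n₂ ≃ Fin n) {x : Fin n}
    (h₁ : x ∈ Set.range (e ∘ Sum.inl)) (h₂ : x ∈ Set.range (e ∘ Sum.inr)) : False := by
  obtain ⟨a, rfl⟩ := h₁
  obtain ⟨b, hb⟩ := h₂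
  exact absurd (e.injective hb) (by simp)

variable [FiniteDimensional ℂ V₁] [FiniteDimensional ℂ V₂]

/-- The number of consecutive indices of a run in each block is bounded: the index of a run at
position `k₂` or later is in the first block, and if there are `k₁` indices after an index of the
run, it is in the second. -/
theorem runVanish_parabolicInduction (hψ : ψ ≠ 1) {k₁ k₂ : ℕ} (h₁ : RunVanish ψ k₁ σ₁)
    (h₂ : RunVanish ψ k₂ σ₂) : RunVanish ψ (k₁ + k₂) (parabolicInduction h σ₁ σ₂) := by
  intro ε hε i hi hrun
  rw [Submodule.eq_bot_iff]
  intro f hf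
  by_contra hne
  obtain ⟨e, he₁, he₂, hfe⟩ := exists_shuffle_ne_zero hf hne
  rcases mem_range_inl_or_inr e ⟨i + k₂, by omega⟩ with hmem | hmem
  · refine hfe (shuffle_eq_zero_of_left h₁ hε hf he₁ (i := i + k₂) (fun t ht => ?_) fun t ht => ?_)
    · refine ⟨⟨i + k₂ + t, by omega⟩, ?_, rfl⟩
      exact mem_range_inl_of_run hψ hf hfe _
        (fun s hs => by rw [add_assoc]; exact hrun _ (by omega)) hmem
    · rw [add_assoc]
      exact hrun _ (by omega)
  · refine hfe (shuffle_eq_zero_of_right h₂ hε hf he₂ (i := i) (fun t ht => ?_) fun t ht => ?_)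
    · refine ⟨⟨i + t, by omega⟩, ?_, rfl⟩
      rcases mem_range_inl_or_inr e ⟨i + t, by omega⟩ with hmem' | hmem'
      · refine (not_mem_both e ?_ hmem).elim
        have := mem_range_inl_of_run hψ hf hfe (i := i + t) (m := k₂ - t) (by omega)
          (fun s hs => by rw [add_assoc]; exact hrun _ (by omega)) hmem'
        simpa [show i + t + (k₂ - t) = i + k₂ by omega] using this
      · exact hmem'
    · exact hrun _ (by omega)

end MackeyZelevinsky

/-! ### Multiplicity at most one for the rectangular Zelevinsky character. -/

section Rectangle

variable {F : Type*} [Field F] {k₁ k₂ c : ℕ}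
  {V₁ V₂ : Type*} [AddCommGroup V₁] [Module ℂ V₁] [AddCommGroup V₂] [Module ℂ V₂]
  {ψ : AddChar F ℂ} {σ₁ : Representation ℂ (GL (Fin (k₁ * c)) F) V₁}
  {σ₂ : Representation ℂ (GL (Fin (k₂ * c)) F) V₂}

/-- The shuffle in which each line starts with `k₂` indices of the second block. -/
def lineShuffle (k₁ k₂ c : ℕ) : Fin (k₁ * c) ⊕ Fin (k₂ * c) ≃ Fin ((k₁ + k₂) * c) :=
  ((((lineEquiv k₁ c).symm.sumCongr (lineEquiv k₂ c).symm).trans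
    (Equiv.sumProdDistrib (Fin k₁) (Fin k₂) (Fin c)).symm).trans
      (((Equiv.sumComm _ _).trans (finSumFinEquiv.trans (finCongr (add_comm k₂ k₁)))).prodCongr
        (Equiv.refl _))).trans (lineEquiv (k₁ + k₂) c)

theorem lineShuffle_inl (x : Fin k₁ × Fin c) : lineShuffle k₁ k₂ c (.inl (lineEquiv k₁ c x)) =
    lineEquiv (k₁ + k₂) c (⟨k₂ + x.1, by omega⟩, x.2) := by
  simp [lineShuffle]
  exact Fin.ext (add_comm _ _)

theorem lineShuffle_inr (x : Fin k₂ × Fin c) : lineShuffle k₁ k₂ c (.inr (lineEquiv k₂ c x)) =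
    lineEquiv (k₁ + k₂) c (⟨x.1, by omega⟩, x.2) := by
  simp [lineShuffle]
  rfl

theorem lineShuffle_inl_strictMono : StrictMono (lineShuffle k₁ k₂ c ∘ Sum.inl) := by
  intro i j hij
  obtain ⟨x, rfl⟩ := (lineEquiv k₁ c).surjective i
  obtain ⟨y, rfl⟩ := (lineEquiv k₁ c).surjective j
  change lineShuffle _ _ _ (.inl _) < lineShuffle _ _ _ (.inl _)
  rw [lineShuffle_inl, lineShuffle_inl, lineEquiv_lt_iff]
  rw [lineEquiv_lt_iff] at hij
  simp only
  omega

theorem lineShuffle_inr_strictMono : StrictMono (lineShuffle k₁ k₂ c ∘ Sum.inr) := by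
  intro i j hij
  obtain ⟨x, rfl⟩ := (lineEquiv k₂ c).surjective i
  obtain ⟨y, rfl⟩ := (lineEquiv k₂ c).surjective j
  change lineShuffle _ _ _ (.inr _) < lineShuffle _ _ _ (.inr _)
  rw [lineShuffle_inr, lineShuffle_inr, lineEquiv_lt_iff]
  rw [lineEquiv_lt_iff] at hij
  simp only
  omega

theorem lineShuffle_weight_inl (i j : Fin (k₁ * c)) (hij : i < j) :
    consecWeight (inducedWeight (rectWeight F (k₁ + k₂)) (lineShuffle k₁ k₂ c ∘ Sum.inl)) i j =
      consecWeight (rectWeight F k₁) i j := by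
  rw [consecWeight_inducedWeight _ lineShuffle_inl_strictMono hij]
  obtain ⟨x, rfl⟩ := (lineEquiv k₁ c).surjective i
  obtain ⟨y, rfl⟩ := (lineEquiv k₁ c).surjective j
  rw [Function.comp, Function.comp, lineShuffle_inl, lineShuffle_inl, consecWeight_lineEquiv,
    consecWeight_lineEquiv, lineWeight, lineWeight]
  refine if_congr ?_ rfl rfl
  simp only
  omega

theorem lineShuffle_weight_inr (i j : Fin (k₂ * c)) (hij : i < j) :
    consecWeight (inducedWeight (rectWeight F (k₁ + k₂)) (lineShuffle k₁ k₂ c ∘ Sum.inr)) i j =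
      consecWeight (rectWeight F k₂) i j := by
  rw [consecWeight_inducedWeight _ lineShuffle_inr_strictMono hij]
  obtain ⟨x, rfl⟩ := (lineEquiv k₂ c).surjective i
  obtain ⟨y, rfl⟩ := (lineEquiv k₂ c).surjective j
  rw [Function.comp, Function.comp, lineShuffle_inr, lineShuffle_inr, consecWeight_lineEquiv,
    consecWeight_lineEquiv, lineWeight, lineWeight]

theorem mem_range_lineShuffle_inl {x : Fin (k₁ + k₂) × Fin c} (hx : k₂ ≤ (x.1 : ℕ)) :
    lineEquiv (k₁ + k₂) c x ∈ Set.range (lineShuffle k₁ k₂ c ∘ Sum.inl) := by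
  refine ⟨lineEquiv k₁ c (⟨x.1 - k₂, by omega⟩, x.2), ?_⟩
  rw [Function.comp, lineShuffle_inl]
  congr 1
  ext
  · simp only
    omega
  · rfl

theorem mem_range_lineShuffle_inr {x : Fin (k₁ + k₂) × Fin c} (hx : (x.1 : ℕ) < k₂) :
    lineEquiv (k₁ + k₂) c x ∈ Set.range (lineShuffle k₁ k₂ c ∘ Sum.inr) :=
  ⟨lineEquiv k₂ c (⟨x.1, hx⟩, x.2), by rw [Function.comp, lineShuffle_inr]⟩

theorem rectWeight_zero_or_one (k i : ℕ) : rectWeight F k i = 0 ∨ rectWeight F k i = 1 := by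
  unfold rectWeight
  split_ifs
  · exact Or.inl rfl
  · exact Or.inr rfl

theorem rectWeight_line {k a l : ℕ} (ha : a + 1 < k) : rectWeight F k (a + k * l) = 1 := by
  rw [rectWeight, if_neg]
  rw [show a + k * l + 1 = (a + 1) + k * l by omega, Nat.add_mul_mod_self_left,
    Nat.mod_eq_of_lt ha]
  omega

variable [FiniteDimensional ℂ V₁] [FiniteDimensional ℂ V₂]

/-- On each line of `k₁ + k₂` indices, those of the second block come first. There cannot be more
than `k₂` of them, nor more than `k₁` of the first block, without a forbidden run, so both counts
are exact. Increasing maps with equal ranges agree. -/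
theorem eq_lineShuffle (hψ : ψ ≠ 1) (h₁ : RunVanish ψ k₁ σ₁) (h₂ : RunVanish ψ k₂ σ₂)
    {f : parabolicSpace (Nat.add_mul k₁ k₂ c).symm σ₁ σ₂}
    (hf : f ∈ patSpace ψ (parabolicInduction (Nat.add_mul k₁ k₂ c).symm σ₁ σ₂) (· < ·)
      (consecWeight (rectWeight F (k₁ + k₂))))
    {e : Fin (k₁ * c) ⊕ Fin (k₂ * c) ≃ Fin ((k₁ + k₂) * c)} (he₁ : StrictMono (e ∘ Sum.inl))
    (he₂ : StrictMono (e ∘ Sum.inr)) (hfe : f.1 (shuffle (Nat.add_mul k₁ k₂ c).symm e) ≠ 0) :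
    e = lineShuffle k₁ k₂ c := by
  have hlt : ∀ (a : ℕ) (l : Fin c), a < k₁ + k₂ → a + (k₁ + k₂) * l < (k₁ + k₂) * c := by
    intro a l ha
    have := (lineEquiv (k₁ + k₂) c (⟨a, ha⟩, l)).2
    rwa [lineEquiv_apply] at this
  have hline : ∀ (a : ℕ) (ha : a < k₁ + k₂) (l : Fin c),
      lineEquiv (k₁ + k₂) c (⟨a, ha⟩, l) = ⟨a + (k₁ + k₂) * l, hlt a l ha⟩ :=
    fun a ha l => Fin.ext (lineEquiv_apply _)
  have step : ∀ (a b : ℕ) (hab : a ≤ b) (hb : b < k₁ + k₂) (l : Fin c),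
      lineEquiv (k₁ + k₂) c (⟨a, by omega⟩, l) ∈ Set.range (e ∘ Sum.inl) →
      lineEquiv (k₁ + k₂) c (⟨b, hb⟩, l) ∈ Set.range (e ∘ Sum.inl) := by
    intro a b hab hb l hmem
    rw [hline] at hmem ⊢
    have heq : a + (k₁ + k₂) * l + (b - a) = b + (k₁ + k₂) * l := by omega
    have := mem_range_inl_of_run hψ hf hfe (i := a + (k₁ + k₂) * l) (m := b - a)
      (by rw [heq]; exact hlt b l hb)
      (fun t ht => by
        rw [show a + (k₁ + k₂) * l + t = (a + t) + (k₁ + k₂) * l by omega]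
        exact rectWeight_line (by omega)) hmem
    simpa only [heq] using this
  have hinl : ∀ x : Fin (k₁ + k₂) × Fin c, k₂ ≤ (x.1 : ℕ) →
      lineEquiv (k₁ + k₂) c x ∈ Set.range (e ∘ Sum.inl) := by
    rintro ⟨⟨a, ha⟩, l⟩ hx
    simp only at hx
    rcases mem_range_inl_or_inr e (lineEquiv (k₁ + k₂) c (⟨a, ha⟩, l)) with hmem | hmem
    · exact hmem
    · refine (hfe (shuffle_eq_zero_of_right h₂ (rectWeight_zero_or_one _) hf he₂
        (i := 0 + (k₁ + k₂) * l) (fun t ht => ?_) fun t ht => ?_)).elim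
      · refine ⟨lineEquiv (k₁ + k₂) c (⟨t, by omega⟩, l), ?_, ?_⟩
        · rcases mem_range_inl_or_inr e (lineEquiv (k₁ + k₂) c (⟨t, by omega⟩, l)) with h' | h'
          · exact (not_mem_both e (step t a (by omega) ha l h') hmem).elim
          · exact h'
        · rw [lineEquiv_apply]
          simp only
          omega
      · rw [show 0 + (k₁ + k₂) * (l : ℕ) + t = t + (k₁ + k₂) * l by omega]
        exact rectWeight_line (by omega)
  have hinr : ∀ x : Fin (k₁ + k₂) × Fin c, (x.1 : ℕ) < k₂ →
      lineEquiv (k₁ + k₂) c x ∈ Set.range (e ∘ Sum.inr) := by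
    rintro ⟨⟨a, ha⟩, l⟩ hx
    simp only at hx
    rcases mem_range_inl_or_inr e (lineEquiv (k₁ + k₂) c (⟨a, ha⟩, l)) with hmem | hmem
    · refine (hfe (shuffle_eq_zero_of_left h₁ (rectWeight_zero_or_one _) hf he₁
        (i := a + (k₁ + k₂) * l) (fun t ht => ?_) fun t ht => ?_)).elim
      · refine ⟨lineEquiv (k₁ + k₂) c (⟨a + t, by omega⟩, l),
          step a (a + t) (by omega) (by omega) l hmem, ?_⟩
        rw [lineEquiv_apply]
        simp only
        omega
      · rw [show a + (k₁ + k₂) * (l : ℕ) + t = (a + t) + (k₁ + k₂) * l by omega]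
        exact rectWeight_line (by omega)
    · exact hmem
  have hr₁ : Set.range (e ∘ Sum.inl) = Set.range (lineShuffle k₁ k₂ c ∘ Sum.inl) := by
    ext i
    obtain ⟨x, rfl⟩ := (lineEquiv (k₁ + k₂) c).surjective i
    rcases le_or_gt k₂ (x.1 : ℕ) with hx | hx
    · exact iff_of_true (hinl x hx) (mem_range_lineShuffle_inl hx)
    · exact iff_of_false (fun h' => not_mem_both _ h' (hinr x hx))
        fun h' => not_mem_both _ h' (mem_range_lineShuffle_inr hx)
  have hr₂ : Set.range (e ∘ Sum.inr) = Set.range (lineShuffle k₁ k₂ c ∘ Sum.inr) := by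
    ext i
    obtain ⟨x, rfl⟩ := (lineEquiv (k₁ + k₂) c).surjective i
    rcases le_or_gt k₂ (x.1 : ℕ) with hx | hx
    · exact iff_of_false (not_mem_both _ (hinl x hx))
        (not_mem_both _ (mem_range_lineShuffle_inl hx))
    · exact iff_of_true (hinr x hx) (mem_range_lineShuffle_inr hx)
  rw [he₁.range_inj lineShuffle_inl_strictMono] at hr₁
  rw [he₂.range_inj lineShuffle_inr_strictMono] at hr₂
  ext x
  rcases x with x | x
  · exact congrArg Fin.val (congrFun hr₁ x)
  · exact congrArg Fin.val (congrFun hr₂ x)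

theorem exists_smul_eq_of_finrank_le_one {V : Type*} [AddCommGroup V] [Module ℂ V]
    [FiniteDimensional ℂ V] {W : Submodule ℂ V} (hW : Module.finrank ℂ W ≤ 1) {v : V} (hv : v ∈ W)
    (hv₀ : v ≠ 0) (x : V) (hx : x ∈ W) : ∃ r : ℂ, r • v = x := by
  have h1 : Module.finrank ℂ W = 1 := by
    refine le_antisymm hW (Nat.one_le_iff_ne_zero.2 fun h0 => hv₀ ?_)
    rw [Submodule.finrank_eq_zero] at h0
    simpa [h0] using hv
  obtain ⟨r, hr⟩ := exists_smul_eq_of_finrank_eq_one h1 (x := ⟨v, hv⟩)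
    (fun h => hv₀ (congrArg Subtype.val h)) ⟨x, hx⟩
  exact ⟨r, congrArg Subtype.val hr⟩

instance [Finite F] {n₁ n₂ n : ℕ} (h : n₁ + n₂ = n) (σ₁ : Representation ℂ (GL (Fin n₁) F) V₁)
    (σ₂ : Representation ℂ (GL (Fin n₂) F) V₂) : FiniteDimensional ℂ (parabolicSpace h σ₁ σ₂) := by
  have : Finite (GL (Fin n) F) := inferInstanceAs (Finite (Matrix (Fin n) (Fin n) F)ˣ)
  infer_instance

/-- Evaluation at the line shuffle is injective, because all other double cosets contribute zero,
and it takes values in the line of `v₁ ⊗ v₂`. -/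
theorem finrank_zelevinsky_parabolicInduction_le [Finite F] (hψ : ψ ≠ 1)
    (h₁ : RunVanish ψ k₁ σ₁) (h₂ : RunVanish ψ k₂ σ₂)
    (hf₁ : Module.finrank ℂ (patSpace ψ σ₁ (· < ·) (consecWeight (rectWeight F k₁))) = 1)
    (hf₂ : Module.finrank ℂ (patSpace ψ σ₂ (· < ·) (consecWeight (rectWeight F k₂))) = 1) :
    Module.finrank ℂ (patSpace ψ (parabolicInduction (Nat.add_mul k₁ k₂ c).symm σ₁ σ₂) (· < ·)
      (consecWeight (rectWeight F (k₁ + k₂)))) ≤ 1 := by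
  obtain ⟨v₁, hv₁, hv₁₀⟩ : ∃ v ∈ patSpace ψ σ₁ (· < ·) (consecWeight (rectWeight F k₁)), v ≠ 0 :=
    Submodule.exists_mem_ne_zero_of_ne_bot fun h => by
      rw [h, finrank_bot] at hf₁
      exact zero_ne_one hf₁
  obtain ⟨v₂, hv₂, hv₂₀⟩ : ∃ v ∈ patSpace ψ σ₂ (· < ·) (consecWeight (rectWeight F k₂)), v ≠ 0 :=
    Submodule.exists_mem_ne_zero_of_ne_bot fun h => by
      rw [h, finrank_bot] at hf₂
      exact zero_ne_one hf₂
  set Z := patSpace ψ (parabolicInduction (Nat.add_mul k₁ k₂ c).symm σ₁ σ₂) (· < ·)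
      (consecWeight (rectWeight F (k₁ + k₂))) with hZ
  set g := shuffle (F := F) (Nat.add_mul k₁ k₂ c).symm (lineShuffle k₁ k₂ c) with hg
  have hinj : ∀ f ∈ Z, f.1 g = 0 → f = 0 := by
    intro f hf h0
    by_contra hne
    obtain ⟨e, he₁, he₂, hfe⟩ := exists_shuffle_ne_zero hf hne
    obtain rfl := eq_lineShuffle hψ h₁ h₂ hf he₁ he₂ hfe
    exact hfe h0
  have hval : ∀ f ∈ Z, ∃ r : ℂ, f.1 g = r • v₁ ⊗ₜ[ℂ] v₂ := by
    intro f hf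
    refine tensor_eq_smul_tmul (shuffle_left hf lineShuffle_inl_strictMono)
      (shuffle_right hf lineShuffle_inr_strictMono) hv₁₀ ?_ ?_
    · rw [patSpace_congr (fun _ _ => Iff.rfl) lineShuffle_weight_inl]
      exact exists_smul_eq_of_finrank_le_one hf₁.le hv₁ hv₁₀
    · rw [patSpace_congr (fun _ _ => Iff.rfl) lineShuffle_weight_inr]
      exact exists_smul_eq_of_finrank_le_one hf₂.le hv₂ hv₂₀
  by_cases hbot : Z = ⊥
  · rw [hbot, finrank_bot]
    exact zero_le_one
  obtain ⟨f₀, hf₀, hne⟩ := Submodule.exists_mem_ne_zero_of_ne_bot hbot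
  obtain ⟨r₀, hr₀⟩ := hval f₀ hf₀
  have hr₀' : r₀ ≠ 0 := by
    rintro rfl
    exact hne (hinj f₀ hf₀ (by rw [hr₀, zero_smul]))
  refine finrank_le_one (⟨f₀, hf₀⟩ : Z) ?_
  rintro ⟨f, hf⟩
  obtain ⟨r, hr⟩ := hval f hf
  refine ⟨r / r₀, Subtype.ext (sub_eq_zero.1 (hinj _ (Z.sub_mem (Z.smul_mem _ hf₀) hf) ?_))⟩
  change (r / r₀) • f₀.1 g - f.1 g = 0
  rw [hr₀, hr, smul_smul, div_mul_cancel₀ _ hr₀', sub_self]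

end Rectangle

/-! ### Projection onto the vectors of a character. -/

section CharacterAverage

variable {G V : Type*} [Group G] [AddCommGroup V] [Module ℂ V] {N : Subgroup G}

theorem char_inv_mul {χ : N →* ℂ} (u : N) : χ u⁻¹ * χ u = 1 := by
  rw [← map_mul, inv_mul_cancel, map_one]

variable [Fintype N]

/-- The projection of `ρ` onto the vectors that transform under `N` by the character `χ`. -/
noncomputable def charAvg (ρ : Representation ℂ G V) (χ : N →* ℂ) : V →ₗ[ℂ] V :=
  (Fintype.card N : ℂ)⁻¹ • ∑ u : N, χ u⁻¹ • ρ u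

variable {ρ : Representation ℂ G V} {χ : N →* ℂ}

theorem charAvg_apply (x : V) :
    charAvg ρ χ x = (Fintype.card N : ℂ)⁻¹ • ∑ u : N, χ u⁻¹ • ρ u x := by
  simp [charAvg]

/-- A linear map with this equivariance cannot see the averaging. It is applied to the pairing with
a `(k, c)_ψ` vector and to the functional on the open cell. -/
theorem apply_charAvg {W : Type*} [AddCommGroup W] [Module ℂ W] {f : V →ₗ[ℂ] W} {x : V}
    (hf : ∀ u : N, f (ρ u x) = χ u • f x) : f (charAvg ρ χ x) = f x := by
  have hN : (Fintype.card N : ℂ) ≠ 0 := Nat.cast_ne_zero.2 Fintype.card_ne_zero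
  simp only [charAvg_apply, map_smul, map_sum, hf, smul_smul, char_inv_mul, one_smul]
  rw [Finset.sum_const, Finset.card_univ, ← Nat.cast_smul_eq_nsmul ℂ, smul_smul,
    inv_mul_cancel₀ hN, one_smul]

theorem charAvg_of_mem {v : V} (hv : ∀ u : N, ρ u v = χ u • v) : charAvg ρ χ v = v :=
  apply_charAvg (f := LinearMap.id) hv

theorem map_charAvg_eq (n : N) (x : V) : ρ n (charAvg ρ χ x) = χ n • charAvg ρ χ x := by
  rw [charAvg_apply, map_smul, map_sum, smul_comm (χ n), Finset.smul_sum (r := χ n)]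
  refine congrArg _ (Fintype.sum_equiv (Equiv.mulLeft n) _ _ fun u => ?_)
  rw [Equiv.coe_mulLeft, map_smul, smul_smul, mul_inv_rev, map_mul, mul_left_comm,
    mul_comm (χ n), char_inv_mul, mul_one, Subgroup.coe_mul, map_mul, Module.End.mul_apply]

theorem charAvg_map (n : N) (x : V) : charAvg ρ χ (ρ n x) = χ n • charAvg ρ χ x := by
  rw [charAvg_apply, charAvg_apply, smul_comm (χ n), Finset.smul_sum (r := χ n)]
  refine congrArg _ (Fintype.sum_equiv (Equiv.mulRight n) _ _ fun u => ?_)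
  rw [Equiv.coe_mulRight, smul_smul, mul_inv_rev, map_mul, ← mul_assoc, mul_comm (χ n),
    char_inv_mul, one_mul, Subgroup.coe_mul, map_mul, Module.End.mul_apply]

theorem conj_char (u : N) : (starRingEnd ℂ) (χ u) = χ u⁻¹ := by
  have h : ‖χ u‖ = 1 := by
    refine (pow_eq_one_iff_of_nonneg (norm_nonneg _) (Fintype.card_ne_zero (α := N))).1 ?_
    rw [← norm_pow, ← map_pow, pow_card_eq_one, map_one, norm_one]
  rw [← Complex.inv_eq_conj h, eq_comm]
  exact eq_inv_of_mul_eq_one_left (char_inv_mul u)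

/-- Invariance of the inner product makes the pairing with `v` equivariant, so `x` and its average
have the same pairing; this determines the coefficient `r`. -/
theorem charAvg_eq_of_inner {B : InnerProductSpace.Core ℂ V}
    (hB : ∀ g x y, B.inner (ρ g x) (ρ g y) = B.inner x y) {v : V} (hv₀ : v ≠ 0)
    (hv : ∀ u : N, ρ u v = χ u • v) {x : V} {r : ℂ} (hr : r • v = charAvg ρ χ x) :
    charAvg ρ χ x = (B.inner v x / B.inner v v) • v := by
  let _ := B
  let f : V →ₗ[ℂ] ℂ :=
    { toFun := B.inner v
      map_add' := fun a b => InnerProductSpace.Core.inner_add_right v a b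
      map_smul' := fun a b => InnerProductSpace.Core.inner_smul_right v b }
  have hf : ∀ u : N, f (ρ u x) = χ u • f x := by
    intro u
    have h1 : B.inner (ρ u v) (ρ u x) = B.inner v x := hB u v x
    have h2 : B.inner (χ u • v) (ρ u x) = (starRingEnd ℂ) (χ u) * B.inner v (ρ u x) :=
      B.smul_left _ _ _
    rw [hv, h2, conj_char] at h1
    change B.inner v (ρ u x) = χ u * B.inner v x
    rw [← h1, ← mul_assoc, mul_comm (χ u), char_inv_mul, one_mul]
  have h := apply_charAvg hf
  rw [← hr, map_smul] at h
  have hne : B.inner v v ≠ 0 := fun h0 => hv₀ (B.definite v h0)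
  rw [← hr]
  congr 1
  rw [eq_div_iff hne]
  exact h

end CharacterAverage

/-! ### Existence of an invariant inner product. -/

section InvariantInner

/-- The standard Hermitian form of a basis is summed over the group; its term at `1` gives
definiteness. -/
theorem exists_invariant_core {G V : Type*} [Group G] [Finite G] [AddCommGroup V] [Module ℂ V]
    [FiniteDimensional ℂ V] (ρ : Representation ℂ G V) :
    ∃ B : InnerProductSpace.Core ℂ V, ∀ g x y, B.inner (ρ g x) (ρ g y) = B.inner x y := by
  classical
  have := Fintype.ofFinite G
  let b := Module.finBasis ℂ V
  let I : V → V → ℂ := fun x y =>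
    ∑ g : G, ∑ i, (starRingEnd ℂ) (b.repr (ρ g x) i) * b.repr (ρ g y) i
  have hI : ∀ x, I x x = ((∑ g : G, ∑ i, ‖b.repr (ρ g x) i‖ ^ 2 : ℝ) : ℂ) := by
    intro x
    push_cast
    exact Finset.sum_congr rfl fun g _ => Finset.sum_congr rfl fun i _ => Complex.conj_mul' _
  refine ⟨{ inner := I
            conj_inner_symm := ?_
            re_inner_nonneg := ?_
            add_left := ?_
            smul_left := ?_
            definite := ?_ }, ?_⟩
  · intro x y
    simp [I, map_sum, mul_comm]
  · intro x
    rw [hI]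
    simp only [RCLike.re_to_complex, Complex.ofReal_re]
    positivity
  · intro x y z
    simp [I, add_mul, Finset.sum_add_distrib]
  · intro x y r
    simp [I, Finset.mul_sum, mul_assoc]
  · intro x hx
    change I x x = 0 at hx
    rw [hI, Complex.ofReal_eq_zero] at hx
    rw [Finset.sum_eq_zero_iff_of_nonneg fun g _ => by positivity] at hx
    have h1 := hx 1 (Finset.mem_univ _)
    rw [Finset.sum_eq_zero_iff_of_nonneg fun g _ => by positivity] at h1
    refine b.repr.map_eq_zero_iff.1 (Finsupp.ext fun i => ?_)
    simpa using h1 i (Finset.mem_univ _)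
  · intro h x y
    change I _ _ = I _ _
    refine Fintype.sum_equiv (Equiv.mulRight h) _ _ fun g => ?_
    simp

end InvariantInner

/-! ### Bessel–Speh functions through the projection to `(k, c)_ψ` vectors. -/

section BesselFunctions

variable {F : Type*} [Field F] {V : Type*} [AddCommGroup V] [Module ℂ V]

instance [Finite F] (n : ℕ) : Finite (GL (Fin n) F) :=
  inferInstanceAs (Finite (Matrix (Fin n) (Fin n) F)ˣ)

/-- The unipotent radical of the standard parabolic subgroup attached to `(c^k)`. -/
def kcGroup (F : Type*) [Field F] [Finite F] (k c : ℕ) : Subgroup (GL (Fin (k * c)) F) :=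
  (patGroup (ι := Fin k × Fin c) (fun x y => x.1 < y.1) (fun _ => lt_irrefl _)
    fun _ _ _ => lt_trans).map (glReindex finProdFinEquiv).toMonoidHom

theorem mem_kcGroup [Finite F] {k c : ℕ} {u : GL (Fin (k * c)) F} :
    u ∈ kcGroup F k c ↔ IsKCUnipotent u := by
  obtain ⟨u, rfl⟩ := (glReindex (finProdFinEquiv (m := k) (n := c))).surjective u
  rw [isKCUnipotent_glReindex]
  exact Subgroup.mem_map_iff_mem (glReindex finProdFinEquiv).injective

/-- The character `ψ_{k,c}`. -/
noncomputable def kcHom [Finite F] (ψ : AddChar F ℂ) (k c : ℕ) : kcGroup F k c →* ℂ where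
  toFun u := kcChar ψ u.1
  map_one' := by
    change kcChar ψ (1 : GL (Fin (k * c)) F) = 1
    rw [← map_one (glReindex finProdFinEquiv), kcChar_glReindex, patForm_one, AddChar.map_zero_eq_one]
  map_mul' := by
    rintro ⟨_, u, (hu : InPattern _ u), rfl⟩ ⟨_, v, (hv : InPattern _ v), rfl⟩
    change kcChar ψ (glReindex finProdFinEquiv u * glReindex finProdFinEquiv v) =
      kcChar ψ (glReindex finProdFinEquiv u) * kcChar ψ (glReindex finProdFinEquiv v)
    rw [← map_mul, kcChar_glReindex, kcChar_glReindex, kcChar_glReindex, ← AddChar.map_add_eq_mul,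
      patForm_mul (R := fun x y => x.1 < y.1) (fun _ => lt_irrefl _) (fun _ _ _ => lt_trans)
        lineWeight_cover hu hv]

theorem mem_kcSpace_iff [Finite F] {ψ : AddChar F ℂ} {k c : ℕ}
    {ρ : Representation ℂ (GL (Fin (k * c)) F) V} {v : V} :
    v ∈ kcSpace ψ ρ ↔ ∀ u : kcGroup F k c, ρ u v = kcHom ψ k c u • v :=
  ⟨fun h u => h u (mem_kcGroup.1 u.2), fun h u hu => h ⟨u, mem_kcGroup.2 hu⟩⟩

variable [Finite F] {ψ : AddChar F ℂ} {k c : ℕ} {ρ : Representation ℂ (GL (Fin (k * c)) F) V}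

noncomputable instance : Fintype (kcGroup F k c) := Fintype.ofFinite _

theorem charAvg_mem_kcSpace (x : V) : charAvg ρ (kcHom ψ k c) x ∈ kcSpace ψ ρ :=
  mem_kcSpace_iff.2 fun u => map_charAvg_eq u x

/-- The left side involves neither the inner product nor the vector used to define `J`. Uniqueness
of `J` and its computation in a larger representation both come from this identity. -/
theorem IsBesselSpehFunction.charAvg_eq
    (hρ : ∀ v ∈ kcSpace ψ ρ, v ≠ 0 → ∀ x ∈ kcSpace ψ ρ, ∃ r : ℂ, r • v = x)
    {J : GL (Fin (k * c)) F → ℂ} (hJ : IsBesselSpehFunction ψ ρ J) {v : V}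
    (hv : v ∈ kcSpace ψ ρ) (g : GL (Fin (k * c)) F) :
    charAvg ρ (kcHom ψ k c) (ρ g v) = J g • v := by
  obtain ⟨B, hB, v₁, hv₁, h₀, hJ⟩ := hJ
  obtain ⟨s, rfl⟩ := hρ v₁ hv₁ h₀ v hv
  obtain ⟨r, hr⟩ := hρ v₁ hv₁ h₀ _ (charAvg_mem_kcSpace (ρ g v₁))
  rw [map_smul, map_smul, charAvg_eq_of_inner hB h₀ (mem_kcSpace_iff.1 hv₁) hr, hJ, smul_comm]

theorem existsUnique_isBesselSpehFunction [FiniteDimensional ℂ V]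
    (hρ : ∀ v ∈ kcSpace ψ ρ, v ≠ 0 → ∀ x ∈ kcSpace ψ ρ, ∃ r : ℂ, r • v = x)
    (hv : ∃ v ∈ kcSpace ψ ρ, v ≠ 0) : ∃! J, IsBesselSpehFunction ψ ρ J := by
  obtain ⟨v, hv, h₀⟩ := hv
  obtain ⟨B, hB⟩ := exists_invariant_core ρ
  refine ⟨fun g => B.inner v (ρ g v) / B.inner v v, ⟨B, hB, v, hv, h₀, fun _ => rfl⟩, ?_⟩
  intro J hJ
  have h₁ : IsBesselSpehFunction ψ ρ fun g => B.inner v (ρ g v) / B.inner v v :=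
    ⟨B, hB, v, hv, h₀, fun _ => rfl⟩
  ext g
  have h := hJ.charAvg_eq hρ hv g
  rw [h₁.charAvg_eq hρ hv g] at h
  exact (smul_left_injective ℂ h₀ h).symm

end BesselFunctions

/-! ### Arrays of blocks and block unipotent matrices. -/

section BlockMatrices

/-- Matrices with entries `c × c` blocks. -/
abbrev BlockMat (F : Type*) (c : ℕ) (ι κ : Type*) := Matrix ι κ (Matrix (Fin c) (Fin c) F)

variable {F : Type*} [Field F] {c k : ℕ}

/-- Invertible `k × k` arrays of `c × c` blocks as elements of `GL_{kc}(F)`. -/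
def blk : (BlockMat F c (Fin k) (Fin k))ˣ ≃* GL (Fin (k * c)) F :=
  (Units.mapEquiv (Matrix.compRingEquiv (Fin k) (Fin c) F).toMulEquiv).trans
    (glReindex finProdFinEquiv)

theorem blk_apply (u : (BlockMat F c (Fin k) (Fin k))ˣ) (a b : Fin k) (i j : Fin c) :
    (blk u : Matrix (Fin (k * c)) (Fin (k * c)) F) (finProdFinEquiv (a, i)) (finProdFinEquiv (b, j)) =
      u.1 a b i j := by
  change u.1 (finProdFinEquiv.symm (finProdFinEquiv (a, i))).1
    (finProdFinEquiv.symm (finProdFinEquiv (b, j))).1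
    (finProdFinEquiv.symm (finProdFinEquiv (a, i))).2
    (finProdFinEquiv.symm (finProdFinEquiv (b, j))).2 = _
  simp only [Equiv.symm_apply_apply]

theorem block_blk (u : (BlockMat F c (Fin k) (Fin k))ˣ) (a b : Fin k) : block (blk u) a b = u.1 a b := by
  ext i j
  exact blk_apply u a b i j

/-- Upper triangular block matrices with identity matrices on the diagonal. -/
def IsBlockUnipotent (u : BlockMat F c (Fin k) (Fin k)) : Prop :=
  (∀ a, u a a = 1) ∧ ∀ a b, b < a → u a b = 0

theorem isKCUnipotent_blk (u : (BlockMat F c (Fin k) (Fin k))ˣ) :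
    IsKCUnipotent (blk u) ↔ IsBlockUnipotent u.1 := by
  simp only [IsKCUnipotent, IsBlockUnipotent, block_blk]

/-- The sum of the traces of the blocks just above the diagonal. -/
def superTrace (u : BlockMat F c (Fin k) (Fin k)) : F :=
  ∑ a : Fin k, ∑ b : Fin k, if (a : ℕ) + 1 = b then (u a b).trace else 0

theorem kcChar_blk (ψ : AddChar F ℂ) (u : (BlockMat F c (Fin k) (Fin k))ˣ) :
    kcChar ψ (blk u) = ψ (superTrace u.1) := by
  refine congrArg ψ (Finset.sum_congr rfl fun a _ => ?_)
  split_ifs with ha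
  · rw [Finset.sum_eq_single ⟨a + 1, ha⟩]
    · simp [block_blk]
    · intro b _ hb
      rw [if_neg fun e => hb (Fin.ext e.symm)]
    · simp
  · rw [Finset.sum_eq_zero]
    intro b _
    rw [if_neg (by omega)]

theorem sumEquiv_inl_val {k₁ k₂ : ℕ} (h : k₁ + k₂ = k) (a : Fin k₁) :
    (sumEquiv h (.inl a) : ℕ) = a := by simp [sumEquiv]

theorem sumEquiv_inr_val {k₁ k₂ : ℕ} (h : k₁ + k₂ = k) (a : Fin k₂) :
    (sumEquiv h (.inr a) : ℕ) = k₁ + a := by simp [sumEquiv]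

theorem isParabolicWith_blk {k₁ k₂ : ℕ} {p : (BlockMat F c (Fin (k₁ + k₂)) (Fin (k₁ + k₂)))ˣ}
    {g₁ : (BlockMat F c (Fin k₁) (Fin k₁))ˣ} {g₂ : (BlockMat F c (Fin k₂) (Fin k₂))ˣ} :
    IsParabolicWith (Nat.add_mul k₁ k₂ c).symm (blk p) (blk g₁) (blk g₂) ↔
      ∃ Q, p.1 = Matrix.reindex (sumEquiv rfl) (sumEquiv rfl) (Matrix.fromBlocks g₁.1 Q 0 g₂.1) := by
  have hl : ∀ (a : Fin k₁) (i : Fin c), sumEquiv (Nat.add_mul k₁ k₂ c).symm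
      (.inl (finProdFinEquiv (a, i))) = finProdFinEquiv (sumEquiv rfl (.inl a), i) := by
    intro a i
    ext
    simp [sumEquiv]
  have hr : ∀ (a : Fin k₂) (i : Fin c), sumEquiv (Nat.add_mul k₁ k₂ c).symm
      (.inr (finProdFinEquiv (a, i))) = finProdFinEquiv (sumEquiv rfl (.inr a), i) := by
    intro a i
    ext
    simp [sumEquiv]
    ring
  rw [isParabolicWith_iff]
  simp only [finProdFinEquiv.surjective.forall, Prod.forall, hl, hr, blk_apply]
  constructor
  · rintro ⟨h₁, h₂, h₃⟩
    refine ⟨Matrix.of fun a b => p.1 (sumEquiv rfl (.inl a)) (sumEquiv rfl (.inr b)), ?_⟩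
    rw [← Equiv.symm_apply_eq]
    ext a b i j
    rcases a with a | a <;> rcases b with b | b
    · exact h₁ a i b j
    · rfl
    · exact h₃ a i b j
    · exact h₂ a i b j
  · rintro ⟨Q, hQ⟩
    rw [hQ]
    simp

/-- Of the off-diagonal part `X`, only the bottom left block touches the block superdiagonal. -/
theorem superTrace_fromBlocks {m₁ m₂ : ℕ} (h : m₁ + 1 + (m₂ + 1) = k)
    (A : BlockMat F c (Fin (m₁ + 1)) (Fin (m₁ + 1))) (X : BlockMat F c (Fin (m₁ + 1)) (Fin (m₂ + 1)))
    (D : BlockMat F c (Fin (m₂ + 1)) (Fin (m₂ + 1))) :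
    superTrace (Matrix.reindex (sumEquiv h) (sumEquiv h) (Matrix.fromBlocks A X 0 D)) =
      superTrace A + superTrace D + (X (Fin.last m₁) 0).trace := by
  simp only [superTrace, ← (sumEquiv h).sum_comp, Fintype.sum_sum_type, sumEquiv_inl_val,
    sumEquiv_inr_val, Matrix.reindex_apply, Matrix.submatrix_apply, Equiv.symm_apply_apply,
    Matrix.fromBlocks_apply₁₁, Matrix.fromBlocks_apply₁₂, Matrix.fromBlocks_apply₂₁,
    Matrix.fromBlocks_apply₂₂, Matrix.zero_apply, Matrix.trace_zero, ite_self, Finset.sum_const_zero,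
    Finset.sum_add_distrib]
  have h₁ : ∀ a b : Fin (m₂ + 1), (m₁ + 1 + (a : ℕ) + 1 = m₁ + 1 + b) = ((a : ℕ) + 1 = b) :=
    fun a b => propext (by omega)
  have h₂ : (∑ a : Fin (m₁ + 1), ∑ b : Fin (m₂ + 1), if (a : ℕ) + 1 = m₁ + 1 + b then (X a b).trace
      else 0) = (X (Fin.last m₁) 0).trace := by
    rw [Finset.sum_eq_single (Fin.last m₁), Finset.sum_eq_single 0]
    · simp
    · intro b _ hb
      rw [if_neg]
      intro e
      refine hb (Fin.ext ?_)
      simpa using e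
    · simp
    · intro a _ ha
      refine Finset.sum_eq_zero fun b _ => if_neg fun e => ha (Fin.ext ?_)
      have := a.2
      simp only [Fin.val_last]
      omega
    · simp
  simp only [h₁, h₂]
  ring

theorem isBlockUnipotent_fromBlocks {k₁ k₂ : ℕ} (h : k₁ + k₂ = k)
    {A : BlockMat F c (Fin k₁) (Fin k₁)} {X : BlockMat F c (Fin k₁) (Fin k₂)}
    {C : BlockMat F c (Fin k₂) (Fin k₁)} {D : BlockMat F c (Fin k₂) (Fin k₂)} :
    IsBlockUnipotent (Matrix.reindex (sumEquiv h) (sumEquiv h) (Matrix.fromBlocks A X C D)) ↔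
      IsBlockUnipotent A ∧ IsBlockUnipotent D ∧ C = 0 := by
  simp only [IsBlockUnipotent, (sumEquiv h).surjective.forall, Sum.forall, Matrix.reindex_apply,
    Matrix.submatrix_apply, Equiv.symm_apply_apply, Matrix.fromBlocks_apply₁₁,
    Matrix.fromBlocks_apply₁₂, Matrix.fromBlocks_apply₂₁, Matrix.fromBlocks_apply₂₂, Fin.lt_def,
    sumEquiv_inl_val, sumEquiv_inr_val, ← Matrix.ext_iff, Matrix.zero_apply]
  constructor
  · rintro ⟨⟨h₁, h₂⟩, h₃, h₄⟩
    exact ⟨⟨h₁, fun a b hab => (h₃ a).1 b hab⟩, ⟨h₂, fun a b hab => (h₄ a).2 b (by omega)⟩,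
      fun a b => (h₄ a).1 b (by omega)⟩
  · rintro ⟨⟨h₁, h₃⟩, ⟨h₂, h₄⟩, h₅⟩
    refine ⟨⟨h₁, h₂⟩, fun a => ⟨fun b hb => h₃ a b hb, fun b hb => by omega⟩,
      fun a => ⟨fun b _ => h₅ a b, fun b hb => h₄ a b (by omega)⟩⟩

/-- The block upper triangular matrix with the given blocks. -/
def upperUnit {k₁ k₂ : ℕ} (h : k₁ + k₂ = k) (a : (BlockMat F c (Fin k₁) (Fin k₁))ˣ)
    (X : BlockMat F c (Fin k₁) (Fin k₂)) (d : (BlockMat F c (Fin k₂) (Fin k₂))ˣ) :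
    (BlockMat F c (Fin k) (Fin k))ˣ where
  val := Matrix.reindex (sumEquiv h) (sumEquiv h) (Matrix.fromBlocks a.1 X 0 d.1)
  inv := Matrix.reindex (sumEquiv h) (sumEquiv h)
    (Matrix.fromBlocks a⁻¹.1 (-(a⁻¹.1 * X * d⁻¹.1)) 0 d⁻¹.1)
  val_inv := by
    rw [Matrix.reindex_apply, Matrix.reindex_apply, Matrix.submatrix_mul_equiv,
      Matrix.fromBlocks_multiply]
    simp [← Matrix.mul_assoc]
  inv_val := by
    rw [Matrix.reindex_apply, Matrix.reindex_apply, Matrix.submatrix_mul_equiv,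
      Matrix.fromBlocks_multiply]
    simp [Matrix.mul_assoc]

/-- The inverse of `u` is again block unipotent, and its diagonal parts are the inverses of those of
`u`. -/
theorem IsBlockUnipotent.exists_upperUnit [Finite F] {k₁ k₂ : ℕ} (h : k₁ + k₂ = k)
    {u : (BlockMat F c (Fin k) (Fin k))ˣ} (hu : IsBlockUnipotent u.1) :
    ∃ (a : (BlockMat F c (Fin k₁) (Fin k₁))ˣ) (X : BlockMat F c (Fin k₁) (Fin k₂))
      (d : (BlockMat F c (Fin k₂) (Fin k₂))ˣ), u = upperUnit h a X d ∧
        IsBlockUnipotent a.1 ∧ IsBlockUnipotent d.1 := by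
  have hu' : IsBlockUnipotent u⁻¹.1 := by
    rw [← isKCUnipotent_blk, ← mem_kcGroup] at hu ⊢
    rw [map_inv]
    exact inv_mem hu
  have key : ∀ {v : BlockMat F c (Fin k) (Fin k)}, IsBlockUnipotent v → ∃ A X D,
      v = Matrix.reindex (sumEquiv h) (sumEquiv h) (Matrix.fromBlocks A X 0 D) ∧
        IsBlockUnipotent A ∧ IsBlockUnipotent D := by
    intro v hv
    have e : v = Matrix.reindex (sumEquiv h) (sumEquiv h) (Matrix.fromBlocks
        ((Matrix.reindex (sumEquiv h).symm (sumEquiv h).symm v).toBlocks₁₁)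
        ((Matrix.reindex (sumEquiv h).symm (sumEquiv h).symm v).toBlocks₁₂)
        ((Matrix.reindex (sumEquiv h).symm (sumEquiv h).symm v).toBlocks₂₁)
        ((Matrix.reindex (sumEquiv h).symm (sumEquiv h).symm v).toBlocks₂₂)) := by
      rw [Matrix.fromBlocks_toBlocks]
      simp
    have hv' := hv
    rw [e, isBlockUnipotent_fromBlocks] at hv'
    rw [hv'.2.2] at e
    exact ⟨_, _, _, e, hv'.1, hv'.2.1⟩
  obtain ⟨A, X, D, e, hA, hD⟩ := key hu
  obtain ⟨A', X', D', e', -, -⟩ := key hu'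
  have h₁ := u.mul_inv
  have h₂ := u.inv_mul
  rw [e, e', Matrix.reindex_apply, Matrix.reindex_apply, Matrix.submatrix_mul_equiv,
    Matrix.fromBlocks_multiply] at h₁ h₂
  have one : (1 : BlockMat F c (Fin k) (Fin k)) = (Matrix.fromBlocks 1 0 0 1).submatrix
    (sumEquiv h).symm (sumEquiv h).symm := by simp
  rw [one] at h₁ h₂
  have h₁' := Matrix.fromBlocks_inj.1 ((Matrix.reindex (sumEquiv h) (sumEquiv h)).injective h₁)
  have h₂' := Matrix.fromBlocks_inj.1 ((Matrix.reindex (sumEquiv h) (sumEquiv h)).injective h₂)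
  refine ⟨⟨A, A', by simpa using h₁'.1, by simpa using h₂'.1⟩, X,
    ⟨D, D', by simpa using h₁'.2.2.2, by simpa using h₂'.2.2.2⟩, Units.ext e, hA, hD⟩

end BlockMatrices

/-! ### Equivariant functions supported on one coset. -/

section CellFunctions

variable {F : Type*} [Field F] {n₁ n₂ n : ℕ} {h : n₁ + n₂ = n}
  {V₁ V₂ : Type*} [AddCommGroup V₁] [Module ℂ V₁] [AddCommGroup V₂] [Module ℂ V₂]

theorem IsParabolicWith.mul {p p' : GL (Fin n) F} {g₁ g₁' : GL (Fin n₁) F} {g₂ g₂' : GL (Fin n₂) F}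
    (hp : IsParabolicWith h p g₁ g₂) (hp' : IsParabolicWith h p' g₁' g₂') :
    IsParabolicWith h (p * p') (g₁ * g₁') (g₂ * g₂') := by
  obtain ⟨X, hX⟩ := hp
  obtain ⟨X', hX'⟩ := hp'
  refine ⟨g₁.1 * X' + X * g₂'.1, ?_⟩
  rw [Matrix.GeneralLinearGroup.coe_mul, hX, hX', Matrix.reindex_apply, Matrix.reindex_apply,
    Matrix.submatrix_mul_equiv, Matrix.fromBlocks_multiply, Matrix.zero_mul, Matrix.mul_zero,
    Matrix.mul_zero, Matrix.zero_mul, add_zero, add_zero, zero_add]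
  rfl

theorem IsParabolicWith.inv {p : GL (Fin n) F} {g₁ : GL (Fin n₁) F} {g₂ : GL (Fin n₂) F}
    (hp : IsParabolicWith h p g₁ g₂) : IsParabolicWith h p⁻¹ g₁⁻¹ g₂⁻¹ := by
  obtain ⟨X, hX⟩ := hp
  refine ⟨-(g₁⁻¹.1 * X * g₂⁻¹.1), Units.inv_eq_of_mul_eq_one_right ?_⟩
  rw [hX, Matrix.reindex_apply, Matrix.reindex_apply, Matrix.submatrix_mul_equiv,
    Matrix.fromBlocks_multiply]
  have h₁ : g₁.1 * g₁⁻¹.1 = 1 := g₁.mul_inv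
  have h₂ : g₂.1 * g₂⁻¹.1 = 1 := g₂.mul_inv
  rw [Matrix.mul_neg, ← Matrix.mul_assoc, ← Matrix.mul_assoc, h₁, h₂, Matrix.one_mul,
    Matrix.mul_zero, Matrix.zero_mul, Matrix.mul_zero, Matrix.zero_mul, add_zero, zero_add, zero_add,
    neg_add_cancel, Matrix.fromBlocks_one, Matrix.submatrix_one_equiv]

/-- Makes the choice of the Levi part in `cosetFun` immaterial. -/
theorem IsParabolicWith.unique {p : GL (Fin n) F} {g₁ g₁' : GL (Fin n₁) F} {g₂ g₂' : GL (Fin n₂) F}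
    (hp : IsParabolicWith h p g₁ g₂) (hp' : IsParabolicWith h p g₁' g₂') : g₁ = g₁' ∧ g₂ = g₂' := by
  rw [isParabolicWith_iff] at hp hp'
  constructor
  · ext a b
    rw [← hp.1, hp'.1]
  · ext a b
    rw [← hp.2.1, hp'.2.1]

open Classical in
/-- The function on `GL_n` that is supported on the coset `P w` and has the value `z` at `w`. -/
noncomputable def cosetFun (h : n₁ + n₂ = n) (σ₁ : Representation ℂ (GL (Fin n₁) F) V₁)
    (σ₂ : Representation ℂ (GL (Fin n₂) F) V₂) (w : GL (Fin n) F) (z : V₁ ⊗[ℂ] V₂)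
    (g : GL (Fin n) F) : V₁ ⊗[ℂ] V₂ :=
  if hg : ∃ x : GL (Fin n₁) F × GL (Fin n₂) F, IsParabolicWith h (g * w⁻¹) x.1 x.2 then
    TensorProduct.map (σ₁ hg.choose.1) (σ₂ hg.choose.2) z else 0

variable {σ₁ : Representation ℂ (GL (Fin n₁) F) V₁} {σ₂ : Representation ℂ (GL (Fin n₂) F) V₂}

theorem cosetFun_eq {w g : GL (Fin n) F} (z : V₁ ⊗[ℂ] V₂) {g₁ : GL (Fin n₁) F} {g₂ : GL (Fin n₂) F}
    (hg : IsParabolicWith h (g * w⁻¹) g₁ g₂) :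
    cosetFun h σ₁ σ₂ w z g = TensorProduct.map (σ₁ g₁) (σ₂ g₂) z := by
  have hex : ∃ x : GL (Fin n₁) F × GL (Fin n₂) F, IsParabolicWith h (g * w⁻¹) x.1 x.2 :=
    ⟨(g₁, g₂), hg⟩
  obtain ⟨e₁, e₂⟩ := hex.choose_spec.unique hg
  rw [cosetFun, dif_pos hex, e₁, e₂]

theorem exists_of_cosetFun_ne_zero {w g : GL (Fin n) F} {z : V₁ ⊗[ℂ] V₂}
    (hg : cosetFun h σ₁ σ₂ w z g ≠ 0) : ∃ g₁ g₂, IsParabolicWith h (g * w⁻¹) g₁ g₂ := by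
  by_contra hne
  refine hg (dif_neg ?_)
  rintro ⟨x, hx⟩
  exact hne ⟨x.1, x.2, hx⟩

theorem cosetFun_mem (w : GL (Fin n) F) (z : V₁ ⊗[ℂ] V₂) :
    cosetFun h σ₁ σ₂ w z ∈ parabolicSpace h σ₁ σ₂ := by
  intro p g₁ g₂ hp g
  by_cases hg : ∃ g₁ g₂, IsParabolicWith h (g * w⁻¹) g₁ g₂
  · obtain ⟨x₁, x₂, hx⟩ := hg
    have := hp.mul hx
    rw [← mul_assoc] at this
    rw [cosetFun_eq z hx, cosetFun_eq z this, map_mul, map_mul, ← LinearMap.comp_apply,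
      ← TensorProduct.map_comp]
    rfl
  · have h₁ : cosetFun h σ₁ σ₂ w z g = 0 := by
      by_contra hne
      exact hg (exists_of_cosetFun_ne_zero hne)
    have h₂ : cosetFun h σ₁ σ₂ w z (p * g) = 0 := by
      by_contra hne
      obtain ⟨x₁, x₂, hx⟩ := exists_of_cosetFun_ne_zero hne
      have := hp.inv.mul hx
      rw [mul_assoc p, inv_mul_cancel_left] at this
      exact hg ⟨_, _, this⟩
    rw [h₁, h₂, map_zero]

end CellFunctions

/-! ### Coordinates on the open cell. -/

section BigCell

variable {F : Type*} [Field F] {c k₁ k₂ : ℕ}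

/-- The element `(0 I; I X)` of the open cell. -/
def cellUnit (X : BlockMat F c (Fin k₂) (Fin k₁)) :
    (BlockMat F c (Fin (k₁ + k₂)) (Fin (k₁ + k₂)))ˣ where
  val := Matrix.reindex (sumEquiv rfl) (sumEquiv (add_comm k₂ k₁)) (Matrix.fromBlocks 0 1 1 X)
  inv := Matrix.reindex (sumEquiv (add_comm k₂ k₁)) (sumEquiv rfl) (Matrix.fromBlocks (-X) 1 1 0)
  val_inv := by
    rw [Matrix.reindex_apply, Matrix.reindex_apply, Matrix.submatrix_mul_equiv,
      Matrix.fromBlocks_multiply]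
    simp
  inv_val := by
    rw [Matrix.reindex_apply, Matrix.reindex_apply, Matrix.submatrix_mul_equiv,
      Matrix.fromBlocks_multiply]
    simp

/-- All coordinates of a point of the cell can be read off from its four blocks. In particular the
lower left block is the invertible `g₂`, which tests membership in the cell. -/
theorem upperUnit_mul_cellUnit (g₁ : (BlockMat F c (Fin k₁) (Fin k₁))ˣ)
    (Q : BlockMat F c (Fin k₁) (Fin k₂)) (g₂ : (BlockMat F c (Fin k₂) (Fin k₂))ˣ)
    (T : BlockMat F c (Fin k₂) (Fin k₁)) :
    (upperUnit rfl g₁ Q g₂ * cellUnit T).1 = Matrix.reindex (sumEquiv rfl)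
      (sumEquiv (add_comm k₂ k₁)) (Matrix.fromBlocks Q (g₁.1 + Q * T) g₂.1 (g₂.1 * T)) := by
  rw [Units.val_mul]
  simp only [upperUnit, cellUnit]
  rw [Matrix.reindex_apply, Matrix.reindex_apply, Matrix.submatrix_mul_equiv,
    Matrix.fromBlocks_multiply]
  simp

theorem cellUnit_mul (X : BlockMat F c (Fin k₂) (Fin k₁)) (M : BlockMat F c (Fin (k₁ + k₂)) (Fin (k₁ + k₂)))
    {A : BlockMat F c (Fin k₂) (Fin k₂)} {B : BlockMat F c (Fin k₂) (Fin k₁)}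
    {C : BlockMat F c (Fin k₁) (Fin k₂)} {D : BlockMat F c (Fin k₁) (Fin k₁)}
    (hM : M = Matrix.reindex (sumEquiv (add_comm k₂ k₁)) (sumEquiv (add_comm k₂ k₁))
      (Matrix.fromBlocks A B C D)) :
    (cellUnit X).1 * M = Matrix.reindex (sumEquiv rfl) (sumEquiv (add_comm k₂ k₁))
      (Matrix.fromBlocks C D (A + X * C) (B + X * D)) := by
  rw [hM]
  simp only [cellUnit]
  rw [Matrix.reindex_apply, Matrix.reindex_apply, Matrix.submatrix_mul_equiv,
    Matrix.fromBlocks_multiply]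
  simp

/-- Right translation acts on the coordinate `X` by affine maps, at the price of a Levi factor with
its two components in swapped order. -/
theorem cellUnit_mul_upperUnit (X : BlockMat F c (Fin k₂) (Fin k₁))
    (a : (BlockMat F c (Fin k₂) (Fin k₂))ˣ) (X₀ : BlockMat F c (Fin k₂) (Fin k₁))
    (d : (BlockMat F c (Fin k₁) (Fin k₁))ˣ) :
    cellUnit X * upperUnit (add_comm k₂ k₁) a X₀ d =
      upperUnit rfl d 0 a * cellUnit (a⁻¹.1 * (X₀ + X * d.1)) := by
  ext1
  rw [upperUnit_mul_cellUnit, Units.val_mul, cellUnit_mul X (upperUnit _ a X₀ d).1 rfl,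
    ← Matrix.mul_assoc a.1, a.mul_inv]
  simp

theorem upperUnit_mul {k : ℕ} (h : k₁ + k₂ = k) (a a' : (BlockMat F c (Fin k₁) (Fin k₁))ˣ)
    (X X' : BlockMat F c (Fin k₁) (Fin k₂)) (d d' : (BlockMat F c (Fin k₂) (Fin k₂))ˣ) :
    upperUnit h a X d * upperUnit h a' X' d' =
      upperUnit h (a * a') (a.1 * X' + X * d'.1) (d * d') := by
  ext1
  rw [Units.val_mul]
  simp only [upperUnit]
  rw [Matrix.reindex_apply, Matrix.reindex_apply, Matrix.submatrix_mul_equiv,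
    Matrix.fromBlocks_multiply]
  simp

/-- Together with the analogue for the first column, this shows that unipotent changes of
coordinates preserve the block at `(last, 0)`, the one that enters the character. -/
theorem IsBlockUnipotent.mul_last {m : ℕ} {ι : Type*} {a : BlockMat F c (Fin (m + 1)) (Fin (m + 1))}
    (ha : IsBlockUnipotent a) (X : BlockMat F c (Fin (m + 1)) ι) (j : ι) :
    (a * X) (Fin.last m) j = X (Fin.last m) j := by
  rw [Matrix.mul_apply, Finset.sum_eq_single (Fin.last m), ha.1, one_mul]
  · intro b _ hb
    rw [ha.2 _ _ (Fin.lt_last_iff_ne_last.2 hb), zero_mul]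
  · simp

theorem IsBlockUnipotent.mul_zero {m : ℕ} {ι : Type*} {a : BlockMat F c (Fin (m + 1)) (Fin (m + 1))}
    (ha : IsBlockUnipotent a) (X : BlockMat F c ι (Fin (m + 1))) (i : ι) :
    (X * a) i 0 = X i 0 := by
  rw [Matrix.mul_apply, Finset.sum_eq_single 0, ha.1, mul_one]
  · intro b _ hb
    rw [ha.2 _ _ (Fin.pos_iff_ne_zero.2 hb), MulZeroClass.mul_zero]
  · simp

theorem isBlockUnipotent_one {k : ℕ} : IsBlockUnipotent (1 : BlockMat F c (Fin k) (Fin k)) :=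
  ⟨fun a => Matrix.one_apply_eq a, fun _ _ hab => Matrix.one_apply_ne hab.ne'⟩

theorem superTrace_one {k : ℕ} : superTrace (1 : BlockMat F c (Fin k) (Fin k)) = 0 := by
  refine Finset.sum_eq_zero fun a _ => Finset.sum_eq_zero fun b _ => ?_
  split_ifs with hab
  · rw [Matrix.one_apply_ne (by rintro rfl; omega), Matrix.trace_zero]
  · rfl

variable {V₁ V₂ : Type*} [AddCommGroup V₁] [Module ℂ V₁] [AddCommGroup V₂] [Module ℂ V₂]
  {σ₁ : Representation ℂ (GL (Fin (k₁ * c)) F) V₁} {σ₂ : Representation ℂ (GL (Fin (k₂ * c)) F) V₂}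

theorem apply_upperUnit_mul (f : parabolicSpace (Nat.add_mul k₁ k₂ c).symm σ₁ σ₂)
    (g₁ : (BlockMat F c (Fin k₁) (Fin k₁))ˣ) (Q : BlockMat F c (Fin k₁) (Fin k₂))
    (g₂ : (BlockMat F c (Fin k₂) (Fin k₂))ˣ) (m : (BlockMat F c (Fin (k₁ + k₂)) (Fin (k₁ + k₂)))ˣ) :
    f.1 (blk (upperUnit rfl g₁ Q g₂ * m)) =
      TensorProduct.map (σ₁ (blk g₁)) (σ₂ (blk g₂)) (f.1 (blk m)) := by
  rw [map_mul]
  exact f.2 _ _ _ (isParabolicWith_blk.2 ⟨Q, rfl⟩) _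

theorem exists_upperUnit_of_isParabolicWith {p : (BlockMat F c (Fin (k₁ + k₂)) (Fin (k₁ + k₂)))ˣ}
    {g₁ : GL (Fin (k₁ * c)) F} {g₂ : GL (Fin (k₂ * c)) F}
    (hp : IsParabolicWith (Nat.add_mul k₁ k₂ c).symm (blk p) g₁ g₂) :
    ∃ g₁' Q g₂', p = upperUnit rfl g₁' Q g₂' ∧ blk g₁' = g₁ ∧ blk g₂' = g₂ := by
  obtain ⟨g₁, rfl⟩ := blk.surjective g₁
  obtain ⟨g₂, rfl⟩ := blk.surjective g₂
  obtain ⟨Q, hQ⟩ := isParabolicWith_blk.1 hp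
  exact ⟨g₁, Q, g₂, Units.ext hQ, rfl, rfl⟩

end BigCell

/-! ### The coordinate functional on the line of `(k, c)_ψ` vectors. -/

section Average

variable {F : Type*} [Field F] [Finite F] {c k : ℕ} {ψ : AddChar F ℂ} {V : Type*} [AddCommGroup V] [Module ℂ V]
  {ρ : Representation ℂ (GL (Fin (k * c)) F) V}

/-- `ev` is the coordinate, with respect to the `(k, c)_ψ` vector `v`, of the projection to the
line of `v`. -/
structure IsBesselFunctional (ψ : AddChar F ℂ) (ρ : Representation ℂ (GL (Fin (k * c)) F) V) (v : V)
    (ev : V →ₗ[ℂ] ℂ) : Prop where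
  mem : v ∈ kcSpace ψ ρ
  charAvg_eq : ∀ x, charAvg ρ (kcHom ψ k c) x = ev x • v
  apply_self : ev v = 1

theorem exists_isBesselFunctional
    (hρ : ∀ v ∈ kcSpace ψ ρ, v ≠ 0 → ∀ x ∈ kcSpace ψ ρ, ∃ r : ℂ, r • v = x)
    (hv : ∃ v ∈ kcSpace ψ ρ, v ≠ 0) : ∃ v ev, IsBesselFunctional ψ ρ v ev := by
  obtain ⟨v, hv, h₀⟩ := hv
  obtain ⟨φ, hφ⟩ := Module.Projective.exists_dual_eq_one ℂ h₀
  refine ⟨v, φ ∘ₗ charAvg ρ (kcHom ψ k c), hv, fun x => ?_, ?_⟩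
  · obtain ⟨r, hr⟩ := hρ v hv h₀ _ (charAvg_mem_kcSpace x)
    rw [LinearMap.comp_apply, ← hr, map_smul, hφ, smul_eq_mul, mul_one]
  · rw [LinearMap.comp_apply, charAvg_of_mem (mem_kcSpace_iff.1 hv), hφ]

variable {v : V} {ev : V →ₗ[ℂ] ℂ}

theorem IsBesselFunctional.ne_zero (h : IsBesselFunctional ψ ρ v ev) : v ≠ 0 := by
  rintro rfl
  have := h.apply_self
  rw [map_zero] at this
  exact zero_ne_one this

theorem IsBesselFunctional.apply_map (h : IsBesselFunctional ψ ρ v ev)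
    {u : (BlockMat F c (Fin k) (Fin k))ˣ} (hu : IsBlockUnipotent u.1) (x : V) :
    ev (ρ (blk u) x) = ψ (superTrace u.1) * ev x := by
  have h₁ := charAvg_map (ρ := ρ) (χ := kcHom ψ k c)
    ⟨blk u, mem_kcGroup.2 ((isKCUnipotent_blk u).2 hu)⟩ x
  rw [h.charAvg_eq, h.charAvg_eq, smul_smul] at h₁
  have h₂ := smul_left_injective ℂ h.ne_zero h₁
  rw [← kcChar_blk]
  exact h₂

theorem IsBesselFunctional.map_self (h : IsBesselFunctional ψ ρ v ev)
    {u : (BlockMat F c (Fin k) (Fin k))ˣ} (hu : IsBlockUnipotent u.1) :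
    ρ (blk u) v = ψ (superTrace u.1) • v := by
  rw [← kcChar_blk]
  exact h.mem _ ((isKCUnipotent_blk u).2 hu)

theorem IsBesselFunctional.apply_besselSpeh (h : IsBesselFunctional ψ ρ v ev)
    (hρ : ∀ v ∈ kcSpace ψ ρ, v ≠ 0 → ∀ x ∈ kcSpace ψ ρ, ∃ r : ℂ, r • v = x)
    {J : GL (Fin (k * c)) F → ℂ} (hJ : IsBesselSpehFunction ψ ρ J) (g : GL (Fin (k * c)) F) :
    ev (ρ g v) = J g := by
  have := hJ.charAvg_eq hρ h.mem g
  rw [h.charAvg_eq] at this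
  exact smul_left_injective ℂ h.ne_zero this

end Average

/-! ### Functionals and averages on tensor products. -/

section TensorFunctional

variable {V₁ V₂ : Type*} [AddCommGroup V₁] [Module ℂ V₁] [AddCommGroup V₂] [Module ℂ V₂]

/-- The tensor product of two linear functionals. -/
noncomputable def tensorEv (e₁ : V₁ →ₗ[ℂ] ℂ) (e₂ : V₂ →ₗ[ℂ] ℂ) : V₁ ⊗[ℂ] V₂ →ₗ[ℂ] ℂ :=
  LinearMap.mul' ℂ ℂ ∘ₗ TensorProduct.map e₁ e₂

theorem tensorEv_tmul (e₁ : V₁ →ₗ[ℂ] ℂ) (e₂ : V₂ →ₗ[ℂ] ℂ) (x : V₁) (y : V₂) :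
    tensorEv e₁ e₂ (x ⊗ₜ y) = e₁ x * e₂ y := by
  simp [tensorEv]

theorem tensorEv_map {e₁ : V₁ →ₗ[ℂ] ℂ} {e₂ : V₂ →ₗ[ℂ] ℂ} {A : V₁ →ₗ[ℂ] V₁} {B : V₂ →ₗ[ℂ] V₂}
    {r s : ℂ} (hA : ∀ x, e₁ (A x) = r * e₁ x) (hB : ∀ x, e₂ (B x) = s * e₂ x) (z : V₁ ⊗[ℂ] V₂) :
    tensorEv e₁ e₂ (TensorProduct.map A B z) = r * s * tensorEv e₁ e₂ z := by
  induction z with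
  | zero => simp
  | add a b ha hb => rw [map_add, map_add, ha, hb, map_add, mul_add]
  | tmul x y =>
    rw [TensorProduct.map_tmul, tensorEv_tmul, tensorEv_tmul, hA, hB]
    ring

theorem map_eq_tensorEv_smul {e₁ : V₁ →ₗ[ℂ] ℂ} {e₂ : V₂ →ₗ[ℂ] ℂ} {A : V₁ →ₗ[ℂ] V₁} {B : V₂ →ₗ[ℂ] V₂}
    {v₁ : V₁} {v₂ : V₂} (hA : ∀ x, A x = e₁ x • v₁) (hB : ∀ x, B x = e₂ x • v₂) (z : V₁ ⊗[ℂ] V₂) :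
    TensorProduct.map A B z = tensorEv e₁ e₂ z • v₁ ⊗ₜ v₂ := by
  induction z with
  | zero => simp
  | add a b ha hb => rw [map_add, ha, hb, map_add, add_smul]
  | tmul x y => rw [TensorProduct.map_tmul, tensorEv_tmul, hA, hB, TensorProduct.smul_tmul_smul]

theorem map_charAvg_id_eq {G : Type*} [Group G] {N : Subgroup G} [Fintype N]
    {ρ : Representation ℂ G V₁} {χ : N →* ℂ} {z : V₁ ⊗[ℂ] V₂}
    (hz : ∀ u : N, TensorProduct.map (ρ u) LinearMap.id z = χ u • z) :
    TensorProduct.map (charAvg ρ χ) LinearMap.id z = z := by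
  let ρ' : Representation ℂ G (V₁ ⊗[ℂ] V₂) := ρ.tprod (Representation.trivial ℂ G V₂)
  refine Eq.trans ?_ (charAvg_of_mem (ρ := ρ') (χ := χ) hz)
  rw [charAvg_apply, charAvg]
  change LinearMap.rTensorHom V₂ _ z = _
  simp only [map_smul, map_sum, LinearMap.smul_apply, LinearMap.sum_apply]
  rfl

theorem map_id_charAvg_eq {G : Type*} [Group G] {N : Subgroup G} [Fintype N]
    {ρ : Representation ℂ G V₂} {χ : N →* ℂ} {z : V₁ ⊗[ℂ] V₂}
    (hz : ∀ u : N, TensorProduct.map LinearMap.id (ρ u) z = χ u • z) :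
    TensorProduct.map LinearMap.id (charAvg ρ χ) z = z := by
  let ρ' : Representation ℂ G (V₁ ⊗[ℂ] V₂) := (Representation.trivial ℂ G V₁).tprod ρ
  refine Eq.trans ?_ (charAvg_of_mem (ρ := ρ') (χ := χ) hz)
  rw [charAvg_apply, charAvg]
  change LinearMap.lTensorHom V₁ _ z = _
  simp only [map_smul, map_sum, LinearMap.smul_apply, LinearMap.sum_apply]
  rfl

end TensorFunctional

/-! ### An equivariant functional and a `(k, c)_ψ` vector on the open cell. -/

section CellFunctional

variable {F : Type*} [Field F] [Fintype F] {c m₁ m₂ : ℕ} {ψ : AddChar F ℂ}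
  {V₁ V₂ : Type*} [AddCommGroup V₁] [Module ℂ V₁] [AddCommGroup V₂] [Module ℂ V₂]
  {σ₁ : Representation ℂ (GL (Fin ((m₁ + 1) * c)) F) V₁}
  {σ₂ : Representation ℂ (GL (Fin ((m₂ + 1) * c)) F) V₂} {v₁ : V₁} {v₂ : V₂} {e₁ : V₁ →ₗ[ℂ] ℂ}
  {e₂ : V₂ →ₗ[ℂ] ℂ}

/-- The functional `f ↦ ∑ ψ (- tr X_{last, first}) f (0 I; I X)` on the parabolic induction. -/
noncomputable def cellFunctional (ψ : AddChar F ℂ) (e₁ : V₁ →ₗ[ℂ] ℂ) (e₂ : V₂ →ₗ[ℂ] ℂ)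
    (σ₁ : Representation ℂ (GL (Fin ((m₁ + 1) * c)) F) V₁)
    (σ₂ : Representation ℂ (GL (Fin ((m₂ + 1) * c)) F) V₂) :
    parabolicSpace (Nat.add_mul (m₁ + 1) (m₂ + 1) c).symm σ₁ σ₂ →ₗ[ℂ] ℂ where
  toFun f := ∑ X : BlockMat F c (Fin (m₂ + 1)) (Fin (m₁ + 1)),
    ψ (-(X (Fin.last m₂) 0).trace) * tensorEv e₁ e₂ (f.1 (blk (cellUnit X)))
  map_add' f g := by
    simp only [Submodule.coe_add, Pi.add_apply, map_add, mul_add, Finset.sum_add_distrib]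
  map_smul' r f := by
    simp only [Submodule.coe_smul, Pi.smul_apply, map_smul, smul_eq_mul, RingHom.id_apply,
      Finset.mul_sum, mul_left_comm]

theorem cellFunctional_apply (f : parabolicSpace (Nat.add_mul (m₁ + 1) (m₂ + 1) c).symm σ₁ σ₂) :
    cellFunctional ψ e₁ e₂ σ₁ σ₂ f = ∑ X : BlockMat F c (Fin (m₂ + 1)) (Fin (m₁ + 1)),
      ψ (-(X (Fin.last m₂) 0).trace) * tensorEv e₁ e₂ (f.1 (blk (cellUnit X))) := rfl

/-- Substitute `X ↦ a⁻¹ (X₀ + X d)` in the sum. The Levi factor contributes the characters of `d`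
and `a`, and the block at `(last, 0)` is shifted by that of `X₀`, which supplies the remaining
factor of `ψ_{k,c}`. -/
theorem cellFunctional_map (h₁ : IsBesselFunctional ψ σ₁ v₁ e₁) (h₂ : IsBesselFunctional ψ σ₂ v₂ e₂)
    (u : kcGroup F (m₁ + 1 + (m₂ + 1)) c)
    (f : parabolicSpace (Nat.add_mul (m₁ + 1) (m₂ + 1) c).symm σ₁ σ₂) :
    cellFunctional ψ e₁ e₂ σ₁ σ₂ (parabolicInduction _ σ₁ σ₂ u.1 f) =
      kcHom ψ _ c u • cellFunctional ψ e₁ e₂ σ₁ σ₂ f := by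
  obtain ⟨u, hu⟩ := u
  obtain ⟨u, rfl⟩ := blk.surjective u
  have hu' := (isKCUnipotent_blk u).1 (mem_kcGroup.1 hu)
  obtain ⟨a, X₀, d, rfl, ha, hd⟩ := hu'.exists_upperUnit (add_comm (m₂ + 1) (m₁ + 1))
  have hχ : kcHom ψ _ c ⟨_, hu⟩ = ψ (superTrace d.1) * ψ (superTrace a.1) *
      ψ (X₀ (Fin.last m₂) 0).trace := by
    change kcChar ψ (blk _) = _
    rw [kcChar_blk, upperUnit, superTrace_fromBlocks, AddChar.map_add_eq_mul,
      AddChar.map_add_eq_mul, mul_comm (ψ _) (ψ (superTrace d.1))]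
  rw [hχ, cellFunctional_apply, cellFunctional_apply, smul_eq_mul, Finset.mul_sum]
  refine Fintype.sum_bijective (fun X => a⁻¹.1 * (X₀ + X * d.1)) ?_ _ _ fun X => ?_
  · refine (Finite.injective_iff_bijective).1 fun X Y hXY => ?_
    have h3 : a.1 * (a⁻¹.1 * (X₀ + X * d.1)) = a.1 * (a⁻¹.1 * (X₀ + Y * d.1)) := congrArg _ hXY
    rw [← Matrix.mul_assoc, ← Matrix.mul_assoc, a.mul_inv, Matrix.one_mul, Matrix.one_mul,
      add_right_inj] at h3
    have h4 := congrArg (fun Z : BlockMat F c (Fin (m₂ + 1)) (Fin (m₁ + 1)) => Z * d⁻¹.1) h3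
    simpa [Matrix.mul_assoc] using h4
  · have hX : (a⁻¹.1 * (X₀ + X * d.1)) (Fin.last m₂) 0 = X₀ (Fin.last m₂) 0 + X (Fin.last m₂) 0 := by
      rw [← ha.mul_last (a⁻¹.1 * (X₀ + X * d.1)) 0, ← Matrix.mul_assoc, a.mul_inv, Matrix.one_mul, Matrix.add_apply,
        hd.mul_zero]
    rw [parabolicInduction_apply, ← map_mul blk, cellUnit_mul_upperUnit, apply_upperUnit_mul,
      tensorEv_map (h₁.apply_map hd) (h₂.apply_map ha), hX, Matrix.trace_add, neg_add,
      AddChar.map_add_eq_mul]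
    have : ψ (X₀ (Fin.last m₂) 0).trace * ψ (-(X₀ (Fin.last m₂) 0).trace) = 1 := by
      rw [← AddChar.map_add_eq_mul, add_neg_cancel, AddChar.map_zero_eq_one]
    linear_combination (-(ψ (superTrace d.1) * ψ (superTrace a.1) * ψ (-(X (Fin.last m₂) 0).trace) *
      tensorEv e₁ e₂ (f.1 (blk (cellUnit (a⁻¹.1 * (X₀ + X * d.1))))))) * this

/-- A `(k, c)_ψ` vector in the parabolic induction that is supported on the open cell. -/
noncomputable def cellVector (ψ : AddChar F ℂ) (v₁ : V₁) (v₂ : V₂)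
    (σ₁ : Representation ℂ (GL (Fin ((m₁ + 1) * c)) F) V₁)
    (σ₂ : Representation ℂ (GL (Fin ((m₂ + 1) * c)) F) V₂) :
    parabolicSpace (Nat.add_mul (m₁ + 1) (m₂ + 1) c).symm σ₁ σ₂ :=
  charAvg (parabolicInduction _ σ₁ σ₂) (kcHom ψ (m₁ + 1 + (m₂ + 1)) c)
    ⟨cosetFun _ σ₁ σ₂ (blk (cellUnit 0)) (v₁ ⊗ₜ v₂), cosetFun_mem _ _⟩

theorem cellVector_mem : cellVector ψ v₁ v₂ σ₁ σ₂ ∈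
    kcSpace ψ (parabolicInduction (Nat.add_mul (m₁ + 1) (m₂ + 1) c).symm σ₁ σ₂) :=
  charAvg_mem_kcSpace _

/-- Averaging does not change the value of an equivariant functional, and among the representatives
`(0 I; I X)` only `X = 0` lies in the coset supporting the function being averaged. -/
theorem cellFunctional_cellVector (h₁ : IsBesselFunctional ψ σ₁ v₁ e₁)
    (h₂ : IsBesselFunctional ψ σ₂ v₂ e₂) :
    cellFunctional ψ e₁ e₂ σ₁ σ₂ (cellVector ψ v₁ v₂ σ₁ σ₂) = 1 := by
  rw [cellVector, apply_charAvg fun u => cellFunctional_map h₁ h₂ u _, cellFunctional_apply,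
    Finset.sum_eq_single 0]
  · have : IsParabolicWith (Nat.add_mul (m₁ + 1) (m₂ + 1) c).symm
        (blk (cellUnit (F := F) (c := c) (k₁ := m₁ + 1) (k₂ := m₂ + 1) 0) * (blk (cellUnit 0))⁻¹) 1 1 := by
      rw [mul_inv_cancel, ← map_one blk, ← map_one blk, ← map_one blk, isParabolicWith_blk]
      exact ⟨0, by simp⟩
    change ψ _ * tensorEv e₁ e₂ (cosetFun _ σ₁ σ₂ _ _ _) = 1
    rw [cosetFun_eq _ this, map_one, map_one, TensorProduct.map_tmul, tensorEv_tmul]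
    simp [h₁.apply_self, h₂.apply_self]
  · intro X _ hX
    have : cosetFun (Nat.add_mul (m₁ + 1) (m₂ + 1) c).symm σ₁ σ₂ (blk (cellUnit 0)) (v₁ ⊗ₜ v₂)
        (blk (cellUnit X)) = 0 := by
      by_contra hne
      obtain ⟨g₁, g₂, hp⟩ := exists_of_cosetFun_ne_zero hne
      rw [← map_inv, ← map_mul] at hp
      obtain ⟨g₁, Q, g₂, hp, -, -⟩ := exists_upperUnit_of_isParabolicWith hp
      rw [mul_inv_eq_iff_eq_mul] at hp
      have h := congrArg Units.val hp
      rw [upperUnit_mul_cellUnit] at h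
      have h' := Matrix.fromBlocks_inj.1 ((Matrix.reindex _ _).injective h)
      exact hX (by simpa using h'.2.2.2)
    change ψ _ * tensorEv e₁ e₂ (cosetFun _ σ₁ σ₂ _ _ _) = 0
    rw [this, map_zero, mul_zero]
  · simp

/-- The average is supported on the translates of the coset by the block unipotent group, where the
lower left block is a product `g₂ a` of units. -/
theorem exists_unit_of_cellVector_ne_zero {m : (BlockMat F c (Fin (m₁ + 1 + (m₂ + 1))) (Fin (m₁ + 1 + (m₂ + 1))))ˣ}
    (hm : (cellVector ψ v₁ v₂ σ₁ σ₂).1 (blk m) ≠ 0) {A : BlockMat F c (Fin (m₁ + 1)) (Fin (m₂ + 1))}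
    {B : BlockMat F c (Fin (m₁ + 1)) (Fin (m₁ + 1))} {C : BlockMat F c (Fin (m₂ + 1)) (Fin (m₂ + 1))}
    {D : BlockMat F c (Fin (m₂ + 1)) (Fin (m₁ + 1))}
    (h : m.1 = Matrix.reindex (sumEquiv rfl) (sumEquiv (add_comm (m₂ + 1) (m₁ + 1)))
      (Matrix.fromBlocks A B C D)) : IsUnit C := by
  obtain ⟨u, hu, hne⟩ : ∃ u : (BlockMat F c (Fin (m₁ + 1 + (m₂ + 1))) (Fin (m₁ + 1 + (m₂ + 1))))ˣ,
      IsBlockUnipotent u⁻¹.1 ∧ cosetFun (Nat.add_mul (m₁ + 1) (m₂ + 1) c).symm σ₁ σ₂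
        (blk (cellUnit 0)) (v₁ ⊗ₜ v₂) (blk (m * u)) ≠ 0 := by
    by_contra hcon
    push Not at hcon
    refine hm ?_
    rw [cellVector, charAvg_apply, Submodule.coe_smul, Pi.smul_apply, Submodule.coe_sum,
      Finset.sum_apply, Finset.sum_eq_zero, smul_zero]
    intro u _
    obtain ⟨u', hu'⟩ := blk.surjective u.1
    rw [Submodule.coe_smul, Pi.smul_apply, parabolicInduction_apply, ← hu', ← map_mul]
    have hin : IsBlockUnipotent u'⁻¹.1 := by
      rw [← isKCUnipotent_blk, ← mem_kcGroup, map_inv, hu']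
      exact inv_mem u.2
    exact (congrArg _ (hcon u' hin)).trans (smul_zero _)
  obtain ⟨g₁, g₂, hp⟩ := exists_of_cosetFun_ne_zero hne
  rw [← map_inv, ← map_mul] at hp
  obtain ⟨g₁, Q, g₂, hp, -, -⟩ := exists_upperUnit_of_isParabolicWith hp
  rw [mul_inv_eq_iff_eq_mul] at hp
  obtain ⟨a, X, d, hu', -, -⟩ := hu.exists_upperUnit (add_comm (m₂ + 1) (m₁ + 1))
  have hm' := eq_mul_inv_of_mul_eq hp
  rw [hu', mul_assoc, cellUnit_mul_upperUnit, ← mul_assoc, upperUnit_mul] at hm'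
  rw [hm', upperUnit_mul_cellUnit] at h
  have h' := Matrix.fromBlocks_inj.1 ((Matrix.reindex _ _).injective h)
  exact h'.2.2.1 ▸ (g₂ * a).isUnit

/-- The cell representative conjugates block diagonal unipotent matrices into the Levi subgroup, so
the value there is fixed by the averages on both tensor factors, which project to the lines of `v₁`
and `v₂`. -/
theorem apply_cellUnit_zero (h₁ : IsBesselFunctional ψ σ₁ v₁ e₁) (h₂ : IsBesselFunctional ψ σ₂ v₂ e₂)
    {f : parabolicSpace (Nat.add_mul (m₁ + 1) (m₂ + 1) c).symm σ₁ σ₂}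
    (hf : f ∈ kcSpace ψ (parabolicInduction (Nat.add_mul (m₁ + 1) (m₂ + 1) c).symm σ₁ σ₂)) :
    f.1 (blk (cellUnit 0)) = tensorEv e₁ e₂ (f.1 (blk (cellUnit 0))) • v₁ ⊗ₜ v₂ := by
  have key : ∀ (d : (BlockMat F c (Fin (m₁ + 1)) (Fin (m₁ + 1)))ˣ)
      (a : (BlockMat F c (Fin (m₂ + 1)) (Fin (m₂ + 1)))ˣ), IsBlockUnipotent d.1 →
      IsBlockUnipotent a.1 → TensorProduct.map (σ₁ (blk d)) (σ₂ (blk a)) (f.1 (blk (cellUnit 0))) =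
        (ψ (superTrace d.1) * ψ (superTrace a.1)) • f.1 (blk (cellUnit 0)) := by
    intro d a hd ha
    have hu : IsBlockUnipotent (upperUnit (add_comm (m₂ + 1) (m₁ + 1)) a 0 d).1 :=
      (isBlockUnipotent_fromBlocks _).2 ⟨ha, hd, rfl⟩
    have hfu := congrArg (fun x => x.1 (blk (cellUnit 0))) (hf _ ((isKCUnipotent_blk _).2 hu))
    rw [parabolicInduction_apply, ← map_mul, cellUnit_mul_upperUnit, Matrix.zero_mul, add_zero,
      Matrix.mul_zero, apply_upperUnit_mul, kcChar_blk, upperUnit, superTrace_fromBlocks] at hfu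
    rw [hfu, Submodule.coe_smul, Pi.smul_apply]
    simp [AddChar.map_add_eq_mul, mul_comm]
  set z := f.1 (blk (cellUnit 0)) with hz
  have hz₁ : TensorProduct.map (charAvg σ₁ (kcHom ψ (m₁ + 1) c)) LinearMap.id z = z := by
    refine map_charAvg_id_eq ?_
    rintro ⟨u, hu⟩
    obtain ⟨u, rfl⟩ := blk.surjective u
    have hu' := (isKCUnipotent_blk u).1 (mem_kcGroup.1 hu)
    have := key u 1 hu' isBlockUnipotent_one
    rw [map_one, map_one, Units.val_one, superTrace_one, AddChar.map_zero_eq_one, mul_one,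
      ← kcChar_blk] at this
    exact this
  have hz₂ : TensorProduct.map LinearMap.id (charAvg σ₂ (kcHom ψ (m₂ + 1) c)) z = z := by
    refine map_id_charAvg_eq ?_
    rintro ⟨u, hu⟩
    obtain ⟨u, rfl⟩ := blk.surjective u
    have hu' := (isKCUnipotent_blk u).1 (mem_kcGroup.1 hu)
    have := key 1 u isBlockUnipotent_one hu'
    rw [map_one, map_one, Units.val_one, superTrace_one, AddChar.map_zero_eq_one, one_mul,
      ← kcChar_blk] at this
    exact this
  rw [← map_eq_tensorEv_smul h₁.charAvg_eq h₂.charAvg_eq z]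
  conv_lhs => rw [← hz₁, ← hz₂]
  rw [← LinearMap.comp_apply, ← TensorProduct.map_comp, LinearMap.id_comp, LinearMap.comp_id]

theorem tensorEv_bigCell (h₁ : IsBesselFunctional ψ σ₁ v₁ e₁) (h₂ : IsBesselFunctional ψ σ₂ v₂ e₂)
    {f : parabolicSpace (Nat.add_mul (m₁ + 1) (m₂ + 1) c).symm σ₁ σ₂}
    (hf : f ∈ kcSpace ψ (parabolicInduction (Nat.add_mul (m₁ + 1) (m₂ + 1) c).symm σ₁ σ₂))
    (g₁ : (BlockMat F c (Fin (m₁ + 1)) (Fin (m₁ + 1)))ˣ)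
    (Q : BlockMat F c (Fin (m₁ + 1)) (Fin (m₂ + 1)))
    (g₂ : (BlockMat F c (Fin (m₂ + 1)) (Fin (m₂ + 1)))ˣ)
    (T : BlockMat F c (Fin (m₂ + 1)) (Fin (m₁ + 1))) :
    tensorEv e₁ e₂ (f.1 (blk (upperUnit rfl g₁ Q g₂ * cellUnit T))) =
      ψ (T (Fin.last m₂) 0).trace * tensorEv e₁ e₂ (f.1 (blk (cellUnit 0))) *
        (e₁ (σ₁ (blk g₁) v₁) * e₂ (σ₂ (blk g₂) v₂)) := by
  have hT : cellUnit T = cellUnit 0 * upperUnit (add_comm (m₂ + 1) (m₁ + 1)) 1 T 1 := by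
    rw [cellUnit_mul_upperUnit]
    ext1
    rw [upperUnit_mul_cellUnit, cellUnit]
    simp
  have hu : IsBlockUnipotent (upperUnit (F := F) (c := c) (add_comm (m₂ + 1) (m₁ + 1)) 1 T 1).1 :=
    (isBlockUnipotent_fromBlocks _).2 ⟨isBlockUnipotent_one, isBlockUnipotent_one, rfl⟩
  have hfu := congrArg (fun x => x.1 (blk (cellUnit 0))) (hf _ ((isKCUnipotent_blk _).2 hu))
  rw [parabolicInduction_apply, ← map_mul, ← hT, kcChar_blk, upperUnit, superTrace_fromBlocks,
    Units.val_one, Units.val_one, superTrace_one, superTrace_one, zero_add, zero_add,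
    Submodule.coe_smul, Pi.smul_apply, apply_cellUnit_zero h₁ h₂ hf] at hfu
  rw [apply_upperUnit_mul, hfu, map_smul, map_smul, map_smul, map_smul, TensorProduct.map_tmul,
    tensorEv_tmul, smul_eq_mul, smul_eq_mul, mul_assoc]

/-- For the equivariant vector every `X` contributes equally to the functional, since the two
characters of `X` cancel, and the total is `1`. -/
theorem card_mul_tensorEv_cellVector (h₁ : IsBesselFunctional ψ σ₁ v₁ e₁)
    (h₂ : IsBesselFunctional ψ σ₂ v₂ e₂) :
    (Fintype.card (BlockMat F c (Fin (m₂ + 1)) (Fin (m₁ + 1))) : ℂ) *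
      tensorEv e₁ e₂ ((cellVector ψ v₁ v₂ σ₁ σ₂).1 (blk (cellUnit 0))) = 1 := by
  rw [← cellFunctional_cellVector (σ₁ := σ₁) (σ₂ := σ₂) h₁ h₂, cellFunctional_apply,
    ← Finset.card_univ, ← nsmul_eq_mul, ← Finset.sum_const]
  refine Finset.sum_congr rfl fun X _ => ?_
  have := tensorEv_bigCell h₁ h₂ (cellVector_mem (σ₁ := σ₁) (σ₂ := σ₂) (v₁ := v₁) (v₂ := v₂)) 1 0 1 X
  have h1 : upperUnit (F := F) (c := c) (k := m₁ + 1 + (m₂ + 1)) rfl 1 0 1 = 1 := by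
    ext1
    simp [upperUnit]
  rw [h1, one_mul, map_one, map_one, map_one, map_one, Module.End.one_apply, Module.End.one_apply,
    h₁.apply_self, h₂.apply_self, mul_one, mul_one] at this
  rw [this, ← mul_assoc, ← AddChar.map_add_eq_mul, neg_add_cancel, AddChar.map_zero_eq_one, one_mul]

end CellFunctional

/-! ### Block structure of the element `(0 I; h 0)`. -/

section Voronoi

variable {F : Type*} [Field F] {c : ℕ}

/-- The array of blocks of `voronoi k h`, as a unit. -/
def voronoiUnit (k : ℕ) (h : GL (Fin c) F) : (BlockMat F c (Fin k) (Fin k))ˣ where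
  val := voronoiBlocks k h.1
  inv := voronoiInvBlocks k h⁻¹.1
  val_inv := voronoiBlocks_mul k _ _ h.mul_inv
  inv_val := voronoiInvBlocks_mul k _ _ h.inv_mul

theorem blk_voronoiUnit (k : ℕ) (h : GL (Fin c) F) : blk (voronoiUnit k h) = voronoi k h :=
  Units.ext rfl

/-- Rows are split in the order `k₂`, `k₁` to match the columns of `cellUnit`. The diagonal parts
`voronoiBlocks _ 0` are nilpotent shifts. -/
theorem voronoiBlocks_fromBlocks (m₁ m₂ : ℕ) (h : Matrix (Fin c) (Fin c) F) :
    voronoiBlocks (m₁ + 1 + (m₂ + 1)) h =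
      Matrix.reindex (sumEquiv (add_comm (m₂ + 1) (m₁ + 1))) (sumEquiv (add_comm (m₂ + 1) (m₁ + 1)))
        (Matrix.fromBlocks (voronoiBlocks (m₂ + 1) 0) (Matrix.single (Fin.last m₂) 0 1)
          (Matrix.single (Fin.last m₁) 0 h) (voronoiBlocks (m₁ + 1) 0)) := by
  rw [← Equiv.symm_apply_eq]
  ext a b : 2
  have h0 : ∀ {n : ℕ} (b : Fin (n + 1)), (0 : Fin (n + 1)) = b ↔ (b : ℕ) = 0 := fun b =>
    ⟨fun e => e ▸ rfl, fun e => Fin.ext e.symm⟩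
  have hl : ∀ {n : ℕ} (b : Fin (n + 1)), Fin.last n = b ↔ n = (b : ℕ) := fun b =>
    ⟨fun e => e ▸ rfl, fun e => Fin.ext e⟩
  rcases a with a | a <;> rcases b with b | b <;>
    simp only [Matrix.reindex_symm, Matrix.reindex_apply, Matrix.submatrix_apply, Equiv.symm_symm,
      Matrix.fromBlocks_apply₁₁, Matrix.fromBlocks_apply₁₂, Matrix.fromBlocks_apply₂₁,
      Matrix.fromBlocks_apply₂₂, voronoiBlocks, Matrix.of_apply, sumEquiv_inl_val, sumEquiv_inr_val,
      Matrix.single_apply, h0, hl] <;>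
    split_ifs <;> first | rfl | omega

/-- The unit `1 + N`, for a matrix `N` of square zero. -/
def oneAddUnit {A : Type*} [Ring A] (N : A) (hN : N * N = 0) : Aˣ where
  val := 1 + N
  inv := 1 - N
  val_inv := by simp [mul_sub, add_mul, hN]
  inv_val := by simp [mul_add, sub_mul, hN]

variable {m₁ m₂ : ℕ}

theorem mul_shift_zero {ι : Type*} (X : BlockMat F c ι (Fin (m₁ + 1))) (i : ι) :
    (X * voronoiBlocks (m₁ + 1) (0 : Matrix (Fin c) (Fin c) F)) i 0 = 0 := by
  rw [Matrix.mul_apply]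
  refine Finset.sum_eq_zero fun j _ => ?_
  rw [voronoiBlocks, Matrix.of_apply, if_neg (by simp), ite_self, mul_zero]

theorem mul_shift_one {ι : Type*} (X : BlockMat F c ι (Fin (m₁ + 1 + 1))) (i : ι) :
    (X * voronoiBlocks (m₁ + 1 + 1) (0 : Matrix (Fin c) (Fin c) F)) i 1 = X i 0 := by
  rw [Matrix.mul_apply, Finset.sum_eq_single 0]
  · simp [voronoiBlocks]
  · intro j _ hj
    have : ¬ (j : ℕ) + 1 = ((1 : Fin (m₁ + 1 + 1)) : ℕ) := by
      intro e
      refine hj (Fin.ext ?_)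
      simpa using e
    rw [voronoiBlocks, Matrix.of_apply, if_neg this, ite_self, mul_zero]
  · simp

theorem voronoiBlocks_last {m : ℕ} (h : Matrix (Fin c) (Fin c) F) (b : Fin (m + 1)) :
    voronoiBlocks (m + 1) h (Fin.last m) b = if b = 0 then h else 0 := by
  have h1 : ¬ m + 1 = (b : ℕ) := by omega
  simp only [voronoiBlocks, Matrix.of_apply, Fin.val_last, if_neg h1, true_and, Fin.ext_iff,
    Fin.val_zero]

theorem voronoiBlocks_castSucc {m : ℕ} (h : Matrix (Fin c) (Fin c) F) (a : Fin m) (b : Fin (m + 1)) :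
    voronoiBlocks (m + 1) h a.castSucc b = if a.succ = b then 1 else 0 := by
  have h1 : ¬ ((a : ℕ) + 1 = m + 1 ∧ (b : ℕ) = 0) := by omega
  simp only [voronoiBlocks, Matrix.of_apply, Fin.val_castSucc, Fin.ext_iff, Fin.val_succ]
  rw [if_neg h1]

theorem voronoiBlocks_mul_last {m : ℕ} {ι : Type*} (h : Matrix (Fin c) (Fin c) F)
    (M : BlockMat F c (Fin (m + 1)) ι) (j : ι) :
    (voronoiBlocks (m + 1) h * M) (Fin.last m) j = h * M 0 j := by
  rw [Matrix.mul_apply, Finset.sum_eq_single 0]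
  · rw [voronoiBlocks_last, if_pos rfl]
  · intro b _ hb
    rw [voronoiBlocks_last, if_neg hb, zero_mul]
  · simp

theorem voronoiBlocks_mul_castSucc {m : ℕ} {ι : Type*} (h : Matrix (Fin c) (Fin c) F)
    (M : BlockMat F c (Fin (m + 1)) ι) (a : Fin m) (j : ι) :
    (voronoiBlocks (m + 1) h * M) a.castSucc j = M a.succ j := by
  rw [Matrix.mul_apply, Finset.sum_eq_single a.succ]
  · rw [voronoiBlocks_castSucc, if_pos rfl, one_mul]
  · intro b _ hb
    rw [voronoiBlocks_castSucc, if_neg hb.symm, zero_mul]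
  · simp

/-- The lower right block of `(0 I; I X) (0 I; h 0)`. -/
def cornerBlock (X : BlockMat F c (Fin (m₂ + 1)) (Fin (m₁ + 1))) :
    BlockMat F c (Fin (m₂ + 1)) (Fin (m₁ + 1)) :=
  Matrix.single (Fin.last m₂) 0 1 + X * voronoiBlocks (m₁ + 1) 0

theorem cornerBlock_apply (X : BlockMat F c (Fin (m₂ + 1)) (Fin (m₁ + 1))) (a : Fin (m₂ + 1))
    (b : Fin (m₁ + 1)) : cornerBlock X a b = Matrix.single (Fin.last m₂) 0 1 a b +
      (X * voronoiBlocks (m₁ + 1) (0 : Matrix (Fin c) (Fin c) F)) a b := rfl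

theorem cornerBlock_last_zero (X : BlockMat F c (Fin (m₂ + 1)) (Fin (m₁ + 1))) :
    cornerBlock X (Fin.last m₂) 0 = 1 := by
  rw [cornerBlock_apply, mul_shift_zero X, Matrix.single_apply_same, add_zero]

theorem cornerBlock_castSucc_zero (X : BlockMat F c (Fin (m₂ + 1)) (Fin (m₁ + 1))) (a : Fin m₂) :
    cornerBlock X a.castSucc 0 = 0 := by
  rw [cornerBlock_apply, mul_shift_zero X, Matrix.single_apply_of_row_ne, add_zero]
  exact (Fin.castSucc_lt_last a).ne'

theorem cornerBlock_one (X : BlockMat F c (Fin (m₂ + 1)) (Fin (m₁ + 1 + 1))) :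
    cornerBlock X (Fin.last m₂) 1 = X (Fin.last m₂) 0 := by
  rw [cornerBlock_apply, mul_shift_one X, Matrix.single_apply_of_col_ne, zero_add]
  exact Fin.zero_ne_one

/-- The strictly upper triangular first row of the Levi part in `GL_{k₁c}`. -/
def rowPart (X : BlockMat F c (Fin (m₂ + 1)) (Fin (m₁ + 1))) :
    BlockMat F c (Fin (m₁ + 1)) (Fin (m₁ + 1)) :=
  Matrix.of fun a b => if a = 0 ∧ b ≠ 0 then cornerBlock X (Fin.last m₂) b else 0

/-- The strictly upper triangular last column of the Levi part in `GL_{k₂c}`. -/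
def colPart (X : BlockMat F c (Fin (m₂ + 1)) (Fin (m₁ + 1))) (D : GL (Fin c) F) :
    BlockMat F c (Fin (m₂ + 1)) (Fin (m₂ + 1)) :=
  Matrix.of fun a b => if a ≠ Fin.last m₂ ∧ b = Fin.last m₂ then X a (Fin.last m₁) * D⁻¹.1 else 0

theorem rowPart_sq (X : BlockMat F c (Fin (m₂ + 1)) (Fin (m₁ + 1))) : rowPart X * rowPart X = 0 := by
  refine Matrix.ext fun a b => ?_
  rw [Matrix.mul_apply, Matrix.zero_apply]
  refine Finset.sum_eq_zero fun j _ => ?_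
  by_cases hj : j = 0 <;> simp [rowPart, hj]

theorem colPart_sq (X : BlockMat F c (Fin (m₂ + 1)) (Fin (m₁ + 1))) (D : GL (Fin c) F) :
    colPart X D * colPart X D = 0 := by
  refine Matrix.ext fun a b => ?_
  rw [Matrix.mul_apply, Matrix.zero_apply]
  refine Finset.sum_eq_zero fun j _ => ?_
  by_cases hj : j = Fin.last m₂ <;> simp [colPart, hj]

theorem isBlockUnipotent_rowPart (X : BlockMat F c (Fin (m₂ + 1)) (Fin (m₁ + 1))) :
    IsBlockUnipotent (oneAddUnit (rowPart X) (rowPart_sq X)).1 := by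
  constructor
  · intro a
    by_cases ha : a = 0 <;> simp [oneAddUnit, rowPart, ha]
  · intro a b hab
    have ha : a ≠ 0 := Fin.ne_zero_of_lt hab
    simp [oneAddUnit, rowPart, ha, Matrix.one_apply_ne hab.ne']

theorem isBlockUnipotent_colPart (X : BlockMat F c (Fin (m₂ + 1)) (Fin (m₁ + 1))) (D : GL (Fin c) F) :
    IsBlockUnipotent (oneAddUnit (colPart X D) (colPart_sq X D)).1 := by
  constructor
  · intro a
    by_cases ha : a = Fin.last m₂ <;> simp [oneAddUnit, colPart, ha]
  · intro a b hab
    have hb : b ≠ Fin.last m₂ := Fin.ne_last_of_lt hab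
    simp [oneAddUnit, colPart, hb, Matrix.one_apply_ne hab.ne']

end Voronoi

/-! ### Explicit decomposition of `(0 I; I X) (0 I; h 0)` in the open cell. -/

section CellDecomposition

variable {F : Type*} [Field F] {c m₁ m₂ : ℕ}

theorem superTrace_fin_one (u : BlockMat F c (Fin (0 + 1)) (Fin (0 + 1))) : superTrace u = 0 := by
  refine Finset.sum_eq_zero fun a _ => Finset.sum_eq_zero fun b _ => if_neg ?_
  omega

theorem superTrace_eq_single {m : ℕ} {u : BlockMat F c (Fin (m + 1)) (Fin (m + 1))} (i : Fin m)
    (hu : ∀ a : Fin m, a ≠ i → u a.castSucc a.succ = 0) :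
    superTrace u = (u i.castSucc i.succ).trace := by
  have h : ∀ a b : Fin (m + 1), (a : ℕ) + 1 = b → ∃ j : Fin m, a = j.castSucc ∧ b = j.succ := by
    intro a b hab
    exact ⟨⟨a, by omega⟩, rfl, Fin.ext hab.symm⟩
  rw [superTrace, Finset.sum_eq_single i.castSucc, Finset.sum_eq_single i.succ]
  · rw [if_pos (by simp)]
  · intro b _ hb
    refine if_neg fun e => hb (Fin.ext ?_)
    rw [← e]
    simp
  · simp
  · intro a _ ha
    refine Finset.sum_eq_zero fun b _ => ?_
    split_ifs with e
    · obtain ⟨j, rfl, rfl⟩ := h a b e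
      rw [hu j fun hj => ha (hj ▸ rfl), Matrix.trace_zero]
    · rfl
  · simp

theorem superTrace_rowPart (X : BlockMat F c (Fin (m₂ + 1)) (Fin (m₁ + 1 + 1))) :
    superTrace (oneAddUnit (rowPart X) (rowPart_sq X)).1 = (X (Fin.last m₂) 0).trace := by
  rw [superTrace_eq_single 0]
  · have : (0 : Fin (m₁ + 1)).succ = 1 := rfl
    simp [oneAddUnit, rowPart, cornerBlock_one]
  · intro a ha
    have h1 : (a.castSucc : Fin (m₁ + 1 + 1)) ≠ 0 := by simpa [Fin.castSucc_eq_zero_iff] using ha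
    simp [oneAddUnit, rowPart, ha, Matrix.one_apply_ne (Fin.castSucc_lt_succ (i := a)).ne]

theorem superTrace_colPart (X : BlockMat F c (Fin (m₂ + 1 + 1)) (Fin (m₁ + 1))) (D : GL (Fin c) F) :
    superTrace (oneAddUnit (colPart X D) (colPart_sq X D)).1 =
      (X (Fin.last m₂).castSucc (Fin.last m₁) * D⁻¹.1).trace := by
  rw [superTrace_eq_single (Fin.last m₂)]
  · have h1 : (Fin.last m₂).castSucc ≠ Fin.last (m₂ + 1) := (Fin.castSucc_lt_last _).ne
    simp [oneAddUnit, colPart, h1,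
      Matrix.one_apply_ne (Fin.castSucc_lt_last (Fin.last m₂)).ne]
  · intro a ha
    have h2 : a.succ ≠ Fin.last (m₂ + 1) := by
      rw [← Fin.succ_last]
      exact fun e => ha (Fin.succ_injective _ e)
    simp [oneAddUnit, colPart, h2, Matrix.one_apply_ne (Fin.castSucc_lt_succ (i := a)).ne]

theorem mul_single_mul_apply {ι : Type*} (X : BlockMat F c ι (Fin (m₁ + 1)))
    (h : Matrix (Fin c) (Fin c) F) {κ : Type*} (T : BlockMat F c (Fin (m₂ + 1)) κ) (a : ι) (b : κ) :
    (X * (Matrix.single (Fin.last m₁) (0 : Fin (m₂ + 1)) h * T)) a b = X a (Fin.last m₁) * (h * T 0 b) := by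
  rw [Matrix.mul_apply, Finset.sum_eq_single (Fin.last m₁)]
  · rw [Matrix.single_mul_apply_same]
  · intro j _ hj
    rw [Matrix.single_mul_apply_of_ne _ _ _ _ _ hj, mul_zero]
  · simp

/-- The Levi part in `GL_{k₂c}`. -/
def lowerLevi (X : BlockMat F c (Fin (m₂ + 1)) (Fin (m₁ + 1))) (D h : GL (Fin c) F) :
    (BlockMat F c (Fin (m₂ + 1)) (Fin (m₂ + 1)))ˣ :=
  oneAddUnit (colPart X D) (colPart_sq X D) * voronoiUnit (m₂ + 1) (D * h)

/-- The Levi part in `GL_{k₁c}`. -/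
def upperLevi (X : BlockMat F c (Fin (m₂ + 1)) (Fin (m₁ + 1))) (D : GL (Fin c) F) :
    (BlockMat F c (Fin (m₁ + 1)) (Fin (m₁ + 1)))ˣ :=
  voronoiUnit (m₁ + 1) (-D⁻¹) * oneAddUnit (rowPart X) (rowPart_sq X)

/-- The right side is the shift with the last column of `X`, times `h`, placed in column `0`. Its
bottom block `D h` completes the shift to a Voronoi matrix, and the other blocks of the column are
produced by `colPart`. -/
theorem lowerLevi_val {X : BlockMat F c (Fin (m₂ + 1)) (Fin (m₁ + 1))} {D : GL (Fin c) F}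
    (hD : X (Fin.last m₂) (Fin.last m₁) = D.1) (h : GL (Fin c) F) :
    (lowerLevi X D h).1 = voronoiBlocks (m₂ + 1) 0 + X * Matrix.single (Fin.last m₁) 0 h.1 := by
  have e : (lowerLevi X D h).1 = voronoiBlocks (m₂ + 1) (D.1 * h.1) +
      colPart X D * voronoiBlocks (m₂ + 1) (D.1 * h.1) := by
    change (1 + colPart X D) * voronoiBlocks (m₂ + 1) (D.1 * h.1) = _
    rw [add_mul, one_mul]
  have h₁ : ∀ a b, (colPart X D * voronoiBlocks (m₂ + 1) (D.1 * h.1)) a b =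
      colPart X D a (Fin.last m₂) * if b = 0 then D.1 * h.1 else 0 := by
    intro a b
    rw [Matrix.mul_apply, Finset.sum_eq_single (Fin.last m₂), voronoiBlocks_last]
    · intro j _ hj
      simp [colPart, hj]
    · simp
  have h₂ : ∀ a b, (X * Matrix.single (Fin.last m₁) (0 : Fin (m₂ + 1)) h.1) a b =
      if b = 0 then X a (Fin.last m₁) * h.1 else 0 := by
    intro a b
    split_ifs with hb
    · rw [hb, Matrix.mul_single_apply_same]
    · rw [Matrix.mul_single_apply_of_ne _ _ _ _ _ hb]
  rw [e]
  refine Matrix.ext fun a b => ?_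
  rw [Matrix.add_apply, Matrix.add_apply, h₁, h₂]
  induction a using Fin.lastCases with
  | last =>
    rw [voronoiBlocks_last, voronoiBlocks_last, hD]
    simp [colPart]
  | cast a =>
    rw [voronoiBlocks_castSucc, voronoiBlocks_castSucc]
    by_cases hb : b = 0
    · simp [colPart, hb, (Fin.castSucc_lt_last a).ne, mul_assoc]
    · simp [hb]

/-- The block of the unipotent part. -/
def cellPart (X : BlockMat F c (Fin (m₂ + 1)) (Fin (m₁ + 1))) (D h : GL (Fin c) F) :
    BlockMat F c (Fin (m₂ + 1)) (Fin (m₁ + 1)) :=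
  (lowerLevi X D h)⁻¹.1 * cornerBlock X

theorem lowerLevi_mul_cellPart (X : BlockMat F c (Fin (m₂ + 1)) (Fin (m₁ + 1))) (D h : GL (Fin c) F) :
    (lowerLevi X D h).1 * cellPart X D h = cornerBlock X := by
  rw [cellPart, ← Matrix.mul_assoc, (lowerLevi X D h).mul_inv, Matrix.one_mul]

theorem cellPart_row {X : BlockMat F c (Fin (m₂ + 1)) (Fin (m₁ + 1))} {D : GL (Fin c) F}
    (hD : X (Fin.last m₂) (Fin.last m₁) = D.1) (h : GL (Fin c) F) (a : Fin (m₂ + 1))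
    (b : Fin (m₁ + 1)) : (voronoiBlocks (m₂ + 1) (0 : Matrix (Fin c) (Fin c) F) * cellPart X D h) a b +
      X a (Fin.last m₁) * (h.1 * cellPart X D h 0 b) = cornerBlock X a b := by
  rw [← mul_single_mul_apply, ← lowerLevi_mul_cellPart X D h, lowerLevi_val hD, Matrix.add_mul,
    Matrix.mul_assoc]
  rfl

theorem mul_cellPart_zero {X : BlockMat F c (Fin (m₂ + 1)) (Fin (m₁ + 1))} {D : GL (Fin c) F}
    (hD : X (Fin.last m₂) (Fin.last m₁) = D.1) (h : GL (Fin c) F) (b : Fin (m₁ + 1)) :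
    h.1 * cellPart X D h 0 b = D⁻¹.1 * cornerBlock X (Fin.last m₂) b := by
  have := cellPart_row hD h (Fin.last m₂) b
  rw [voronoiBlocks_mul_last, zero_mul, zero_add, hD] at this
  rw [← this, ← mul_assoc D⁻¹.1, D.inv_mul, one_mul]

/-- This is the comparison of upper right blocks. The second summand lives in the last row, where it
equals `D⁻¹` times the last row of `cornerBlock X`; this cancels the last row of `upperLevi`, whose
leading coefficient is `-D⁻¹`. -/
theorem upperLevi_add {X : BlockMat F c (Fin (m₂ + 1)) (Fin (m₁ + 1))} {D : GL (Fin c) F}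
    (hD : X (Fin.last m₂) (Fin.last m₁) = D.1) (h : GL (Fin c) F) :
    (upperLevi X D).1 + Matrix.single (Fin.last m₁) (0 : Fin (m₂ + 1)) h.1 * cellPart X D h =
      voronoiBlocks (m₁ + 1) 0 := by
  have e : (upperLevi X D).1 = voronoiBlocks (m₁ + 1) (-D⁻¹.1) * (1 + rowPart X) := rfl
  have hrow : ∀ b, (1 + rowPart X) 0 b = cornerBlock X (Fin.last m₂) b := by
    intro b
    by_cases hb : b = 0
    · simp [rowPart, hb, cornerBlock_last_zero]
    · simp [rowPart, hb, Matrix.one_apply_ne (Ne.symm hb)]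
  have hs : ∀ a b, (Matrix.single (Fin.last m₁) (0 : Fin (m₂ + 1)) h.1 * cellPart X D h) a b =
      if a = Fin.last m₁ then h.1 * cellPart X D h 0 b else 0 := by
    intro a b
    split_ifs with ha
    · rw [ha, Matrix.single_mul_apply_same]
    · rw [Matrix.single_mul_apply_of_ne _ _ _ _ _ ha]
  rw [e]
  refine Matrix.ext fun a b => ?_
  rw [Matrix.add_apply, hs]
  induction a using Fin.lastCases with
  | last =>
    rw [voronoiBlocks_mul_last, if_pos rfl, mul_cellPart_zero hD, hrow,
      voronoiBlocks_last, ite_self, neg_mul, neg_add_cancel]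
  | cast a =>
    rw [voronoiBlocks_mul_castSucc, if_neg (Fin.castSucc_lt_last a).ne,
      voronoiBlocks_castSucc, add_zero, Matrix.add_apply]
    simp [rowPart, Matrix.one_apply]

theorem cellUnit_mul_voronoiUnit {X : BlockMat F c (Fin (m₂ + 1)) (Fin (m₁ + 1))} {D : GL (Fin c) F}
    (hD : X (Fin.last m₂) (Fin.last m₁) = D.1) (h : GL (Fin c) F) :
    cellUnit X * voronoiUnit (m₁ + 1 + (m₂ + 1)) h =
      upperUnit rfl (upperLevi X D) (Matrix.single (Fin.last m₁) 0 h.1) (lowerLevi X D h) *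
        cellUnit (cellPart X D h) := by
  ext1
  rw [upperUnit_mul_cellUnit, lowerLevi_mul_cellPart, upperLevi_add hD, lowerLevi_val hD,
    Units.val_mul, cellUnit_mul X (voronoiUnit _ h).1 (voronoiBlocks_fromBlocks m₁ m₂ h.1)]
  rfl

/-- The last diagonal block of `C C⁻¹ = 1` exhibits a right inverse of the corner block, because the
last row of the shift is zero. -/
theorem cellUnit_mul_voronoiUnit_isUnit {X : BlockMat F c (Fin (m₂ + 1)) (Fin (m₁ + 1))}
    {h : GL (Fin c) F} (hX : ∀ {A : BlockMat F c (Fin (m₁ + 1)) (Fin (m₂ + 1))}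
      {B : BlockMat F c (Fin (m₁ + 1)) (Fin (m₁ + 1))} {C : BlockMat F c (Fin (m₂ + 1)) (Fin (m₂ + 1))}
      {D : BlockMat F c (Fin (m₂ + 1)) (Fin (m₁ + 1))},
      (cellUnit X * voronoiUnit (m₁ + 1 + (m₂ + 1)) h).1 =
        Matrix.reindex (sumEquiv rfl) (sumEquiv (add_comm (m₂ + 1) (m₁ + 1)))
          (Matrix.fromBlocks A B C D) → IsUnit C) :
    IsUnit (X (Fin.last m₂) (Fin.last m₁)) := by
  obtain ⟨g, hg⟩ := hX (cellUnit_mul X (voronoiUnit _ h).1 (voronoiBlocks_fromBlocks m₁ m₂ h.1))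
  have h₁ := congrArg (fun M : BlockMat F c (Fin (m₂ + 1)) (Fin (m₂ + 1)) => M (Fin.last m₂) (Fin.last m₂))
    g.mul_inv
  rw [hg, add_mul, Matrix.mul_assoc] at h₁
  have h₂ : X (Fin.last m₂) (Fin.last m₁) * (h.1 * g⁻¹.1 0 (Fin.last m₂)) = 1 := by
    rw [← mul_single_mul_apply]
    refine Eq.trans ?_ (h₁.trans (Matrix.one_apply_eq _))
    change _ = (voronoiBlocks (m₂ + 1) (0 : Matrix (Fin c) (Fin c) F) * g⁻¹.1) (Fin.last m₂) (Fin.last m₂) + _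
    rw [voronoiBlocks_mul_last, zero_mul, zero_add]
  exact ⟨⟨_, _, h₂, mul_eq_one_comm.1 h₂⟩, rfl⟩

/-- For `k₁ ≥ 2` the superdiagonal block of `rowPart` is the block of `X` at `(last, 0)`, and the
traces cancel. For `k₁ = 1` that block is `D` itself, which leaves the correction term of the
special value at `-D⁻¹`. -/
theorem trace_upper {X : BlockMat F c (Fin (m₂ + 1)) (Fin (m₁ + 1))} {D : GL (Fin c) F}
    (hD : X (Fin.last m₂) (Fin.last m₁) = D.1) :
    -(X (Fin.last m₂) 0).trace + superTrace (oneAddUnit (rowPart X) (rowPart_sq X)).1 =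
      if m₁ + 1 = 1 then ((-D⁻¹)⁻¹.1).trace else 0 := by
  rcases m₁ with _ | m₁
  · rw [if_pos rfl, superTrace_fin_one, add_zero, inv_neg, inv_inv, Units.val_neg, ← hD,
      Matrix.trace_neg]
    rfl
  · rw [if_neg (by omega), superTrace_rowPart, neg_add_cancel]

/-- For `k₂ ≥ 2` the next to last row of the equation defining `cellPart` makes the two traces
cancel. For `k₂ = 1` the block of `cellPart` is `h⁻¹ D⁻¹`, which gives the correction term at `D h`.
-/
theorem trace_lower {X : BlockMat F c (Fin (m₂ + 1)) (Fin (m₁ + 1))} {D : GL (Fin c) F}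
    (hD : X (Fin.last m₂) (Fin.last m₁) = D.1) (h : GL (Fin c) F) :
    (cellPart X D h (Fin.last m₂) 0).trace +
        superTrace (oneAddUnit (colPart X D) (colPart_sq X D)).1 =
      if m₂ + 1 = 1 then ((D * h)⁻¹.1).trace else 0 := by
  have h₀ := mul_cellPart_zero hD h 0
  rw [cornerBlock_last_zero, mul_one] at h₀
  rcases m₂ with _ | m₂
  · rw [if_pos rfl, superTrace_fin_one, add_zero, mul_inv_rev, Units.val_mul, ← h₀, ← mul_assoc,
      h.inv_mul, one_mul]
    rfl
  · rw [if_neg (by omega), superTrace_colPart]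
    have h₁ := cellPart_row hD h (Fin.last m₂).castSucc 0
    rw [voronoiBlocks_mul_castSucc, h₀, cornerBlock_castSucc_zero, Fin.succ_last] at h₁
    rw [← Matrix.trace_add, h₁, Matrix.trace_zero]

end CellDecomposition

/-! ### Summation over the open cell. -/

section Convolution

/-- Translating the one entry by all `D` and exchanging the sums shows that each value of the entry
is taken equally often. -/
theorem sum_apply_entry {ι κ R : Type*} [Fintype ι] [Fintype κ] [DecidableEq ι] [DecidableEq κ]
    [Fintype R] [AddCommGroup R] (Φ : R → ℂ) (i : ι) (j : κ) :
    (Fintype.card R : ℂ) * ∑ X : Matrix ι κ R, Φ (X i j) =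
      (Fintype.card (Matrix ι κ R) : ℂ) * ∑ D : R, Φ D := by
  have h : ∀ D : R, ∑ X : Matrix ι κ R, Φ (X i j) = ∑ X : Matrix ι κ R, Φ (X i j + D) := by
    intro D
    refine (Fintype.sum_equiv (Equiv.addRight (Matrix.single i j D)) _ _ fun X => ?_).symm
    change Φ (X i j + D) = Φ ((X + Matrix.single i j D) i j)
    rw [Matrix.add_apply, Matrix.single_apply_same]
  have h₁ : (Fintype.card R : ℂ) * ∑ X : Matrix ι κ R, Φ (X i j) =
      ∑ D : R, ∑ X : Matrix ι κ R, Φ (X i j + D) := by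
    rw [← Finset.sum_congr rfl fun D _ => h D, Finset.sum_const, Finset.card_univ, nsmul_eq_mul]
  rw [h₁, Finset.sum_comm]
  have h₂ : ∀ X : Matrix ι κ R, ∑ D : R, Φ (X i j + D) = ∑ D : R, Φ D := fun X =>
    Fintype.sum_equiv (Equiv.addLeft (X i j)) _ _ fun D => rfl
  rw [Finset.sum_congr rfl fun X _ => h₂ X, Finset.sum_const, Finset.card_univ, nsmul_eq_mul]

theorem sum_dite_isUnit {M : Type*} [Monoid M] [Fintype M] [Fintype Mˣ]
    [DecidablePred (IsUnit : M → Prop)] (Φ : Mˣ → ℂ) :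
    (∑ x : M, if h : IsUnit x then Φ h.unit else 0) = ∑ u : Mˣ, Φ u := by
  symm
  refine Finset.sum_of_injOn (fun u : Mˣ => (u : M)) (fun _ _ _ _ h => Units.ext h)
    (fun _ _ => Finset.mem_coe.2 (Finset.mem_univ _)) (fun x _ hx => dif_neg ?_) fun u _ => ?_
  · rintro ⟨u, rfl⟩
    exact hx ⟨u, by simp, rfl⟩
  · rw [dif_pos u.isUnit]
    exact congrArg Φ (Units.ext rfl)

theorem sum_mul_eq_neg {A : Type*} [Ring A] [Fintype Aˣ] [DecidableEq Aˣ] (a b : Aˣ → ℂ) (h : Aˣ) :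
    ∑ p : Aˣ × Aˣ with p.1 * p.2 = -h, a p.1 * b p.2 = ∑ D : Aˣ, a (-D⁻¹) * b (D * h) := by
  symm
  refine Finset.sum_bij (fun D _ => (-D⁻¹, D * h)) (fun D _ => ?_) (fun D _ D' _ e => ?_)
    (fun p hp => ?_) fun _ _ => rfl
  · simp
  · simpa using congrArg Prod.fst e
  · obtain ⟨x, y⟩ := p
    have hp : x * y = -h := by simpa using hp
    refine ⟨-x⁻¹, Finset.mem_univ _, ?_⟩
    have hy : y = -(x⁻¹ * h) := by
      rw [← mul_neg, ← hp, inv_mul_cancel_left]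
    rw [hy]
    simp [inv_neg]

variable {F : Type*} [Field F] {c m₁ m₂ : ℕ} {ψ : AddChar F ℂ}

theorem specialValue_eq {k : ℕ} (J : GL (Fin (k * c)) F → ℂ) (h : GL (Fin c) F) :
    specialValue ψ J h = J (voronoi k h) * ψ (if k = 1 then (h⁻¹.1).trace else 0) := by
  unfold specialValue
  split_ifs
  · rfl
  · rw [AddChar.map_zero_eq_one, mul_one]

variable [Fintype F]
  {V₁ V₂ : Type*} [AddCommGroup V₁] [Module ℂ V₁] [AddCommGroup V₂] [Module ℂ V₂]
  {σ₁ : Representation ℂ (GL (Fin ((m₁ + 1) * c)) F) V₁}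
  {σ₂ : Representation ℂ (GL (Fin ((m₂ + 1) * c)) F) V₂} {v₁ : V₁} {v₂ : V₂} {e₁ : V₁ →ₗ[ℂ] ℂ}
  {e₂ : V₂ →ₗ[ℂ] ℂ} {J₁ : GL (Fin ((m₁ + 1) * c)) F → ℂ} {J₂ : GL (Fin ((m₂ + 1) * c)) F → ℂ}

theorem tensorEv_cellUnit_mul_voronoi (h₁ : IsBesselFunctional ψ σ₁ v₁ e₁)
    (h₂ : IsBesselFunctional ψ σ₂ v₂ e₂) (hJ₁ : ∀ g, e₁ (σ₁ g v₁) = J₁ g)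
    (hJ₂ : ∀ g, e₂ (σ₂ g v₂) = J₂ g)
    {f : parabolicSpace (Nat.add_mul (m₁ + 1) (m₂ + 1) c).symm σ₁ σ₂}
    (hf : f ∈ kcSpace ψ (parabolicInduction (Nat.add_mul (m₁ + 1) (m₂ + 1) c).symm σ₁ σ₂))
    {X : BlockMat F c (Fin (m₂ + 1)) (Fin (m₁ + 1))} {D : GL (Fin c) F}
    (hD : X (Fin.last m₂) (Fin.last m₁) = D.1) (h : GL (Fin c) F) :
    ψ (-(X (Fin.last m₂) 0).trace) *
        tensorEv e₁ e₂ (f.1 (blk (cellUnit X * voronoiUnit (m₁ + 1 + (m₂ + 1)) h))) =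
      tensorEv e₁ e₂ (f.1 (blk (cellUnit 0))) *
        (specialValue ψ J₁ (-D⁻¹) * specialValue ψ J₂ (D * h)) := by
  have hu : e₁ (σ₁ (blk (upperLevi X D)) v₁) =
      ψ (superTrace (oneAddUnit (rowPart X) (rowPart_sq X)).1) * J₁ (voronoi (m₁ + 1) (-D⁻¹)) := by
    rw [upperLevi, map_mul, map_mul, Module.End.mul_apply, h₁.map_self (isBlockUnipotent_rowPart X),
      map_smul, map_smul, hJ₁, blk_voronoiUnit, smul_eq_mul]
  have hl : e₂ (σ₂ (blk (lowerLevi X D h)) v₂) =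
      ψ (superTrace (oneAddUnit (colPart X D) (colPart_sq X D)).1) * J₂ (voronoi (m₂ + 1) (D * h)) := by
    rw [lowerLevi, map_mul, map_mul, Module.End.mul_apply, h₂.apply_map (isBlockUnipotent_colPart X D),
      hJ₂, blk_voronoiUnit]
  rw [cellUnit_mul_voronoiUnit hD, tensorEv_bigCell h₁ h₂ hf, hu, hl, specialValue_eq, specialValue_eq,
    ← trace_upper hD, ← trace_lower hD h, AddChar.map_add_eq_mul, AddChar.map_add_eq_mul]
  ring

theorem specialValue_formula [DecidableEq F] (h₁ : IsBesselFunctional ψ σ₁ v₁ e₁)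
    (h₂ : IsBesselFunctional ψ σ₂ v₂ e₂) (hJ₁ : ∀ g, e₁ (σ₁ g v₁) = J₁ g)
    (hJ₂ : ∀ g, e₂ (σ₂ g v₂) = J₂ g) (h : GL (Fin c) F) :
    cellFunctional ψ e₁ e₂ σ₁ σ₂ (parabolicInduction _ σ₁ σ₂ (voronoi (m₁ + 1 + (m₂ + 1)) h)
      (cellVector ψ v₁ v₂ σ₁ σ₂)) = (Fintype.card F : ℂ) ^ (-(c : ℤ) ^ 2) *
        ∑ p : GL (Fin c) F × GL (Fin c) F with p.1 * p.2 = -h,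
          specialValue ψ J₁ p.1 * specialValue ψ J₂ p.2 := by
  classical
  let Φ : GL (Fin c) F → ℂ := fun D => specialValue ψ J₁ (-D⁻¹) * specialValue ψ J₂ (D * h)
  let t := tensorEv e₁ e₂ ((cellVector ψ v₁ v₂ σ₁ σ₂).1 (blk (cellUnit 0)))
  have hX : ∀ X : BlockMat F c (Fin (m₂ + 1)) (Fin (m₁ + 1)),
      ψ (-(X (Fin.last m₂) 0).trace) * tensorEv e₁ e₂
        ((parabolicInduction _ σ₁ σ₂ (voronoi (m₁ + 1 + (m₂ + 1)) h)
          (cellVector ψ v₁ v₂ σ₁ σ₂)).1 (blk (cellUnit X))) =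
      t * if hX : IsUnit (X (Fin.last m₂) (Fin.last m₁)) then Φ hX.unit else 0 := by
    intro X
    rw [parabolicInduction_apply, ← blk_voronoiUnit, ← map_mul]
    split_ifs with hu
    · exact tensorEv_cellUnit_mul_voronoi h₁ h₂ hJ₁ hJ₂ cellVector_mem hu.unit_spec.symm h
    -- With a singular corner block the point lies outside the support of the cell vector.
    · have : (cellVector ψ v₁ v₂ σ₁ σ₂).1 (blk (cellUnit X * voronoiUnit _ h)) = 0 := by
        by_contra hne
        exact hu (cellUnit_mul_voronoiUnit_isUnit (exists_unit_of_cellVector_ne_zero hne))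
      rw [this, map_zero, mul_zero, mul_zero]
  have ht : (Fintype.card (BlockMat F c (Fin (m₂ + 1)) (Fin (m₁ + 1))) : ℂ) * t = 1 :=
    card_mul_tensorEv_cellVector h₁ h₂
  have hcard : (Fintype.card (Matrix (Fin c) (Fin c) F) : ℂ) = (Fintype.card F : ℂ) ^ ((c : ℤ) ^ 2) := by
    rw [Fintype.card_congr Matrix.of.symm, Fintype.card_fun, Fintype.card_fun, Fintype.card_fin, ← pow_mul,
      Nat.cast_pow, ← zpow_natCast, Nat.cast_mul, sq]
  have hq : (Fintype.card F : ℂ) ≠ 0 := Nat.cast_ne_zero.2 Fintype.card_ne_zero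
  have hs := sum_apply_entry (fun D : Matrix (Fin c) (Fin c) F => if hD : IsUnit D then Φ hD.unit else 0)
    (Fin.last m₂) (Fin.last m₁)
  -- Here `t` is the inverse of the number of all `X`, and each corner block occurs in a fraction
  -- `q^{-c²}` of them.
  rw [cellFunctional_apply, Finset.sum_congr rfl fun X _ => hX X, ← Finset.mul_sum, sum_mul_eq_neg,
    ← sum_dite_isUnit Φ, zpow_neg, eq_inv_mul_iff_mul_eq₀ (zpow_ne_zero _ hq), ← hcard,
    mul_left_comm, hs, ← mul_assoc, mul_comm t, ht, one_mul]

/-- By multiplicity one, a multiple of the vector of `ρ` embeds as the cell vector. Averaging its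
translate gives `J g` times it, and the functional ignores the averaging and is `1` on the cell
vector. -/
theorem apply_voronoi_eq [DecidableEq F] {V : Type*} [AddCommGroup V] [Module ℂ V]
    {ρ : Representation ℂ (GL (Fin ((m₁ + 1 + (m₂ + 1)) * c)) F) V}
    (incl : Representation.IntertwiningMap ρ
      (parabolicInduction (Nat.add_mul (m₁ + 1) (m₂ + 1) c).symm σ₁ σ₂))
    (hincl : Function.Injective incl) (hv : ∃ v ∈ kcSpace ψ ρ, v ≠ 0)
    (hρ : ∀ v ∈ kcSpace ψ ρ, v ≠ 0 → ∀ x ∈ kcSpace ψ ρ, ∃ r : ℂ, r • v = x)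
    (hI : ∀ v ∈ kcSpace ψ (parabolicInduction (Nat.add_mul (m₁ + 1) (m₂ + 1) c).symm σ₁ σ₂), v ≠ 0 →
      ∀ x ∈ kcSpace ψ (parabolicInduction (Nat.add_mul (m₁ + 1) (m₂ + 1) c).symm σ₁ σ₂),
        ∃ r : ℂ, r • v = x)
    (h₁ : IsBesselFunctional ψ σ₁ v₁ e₁) (h₂ : IsBesselFunctional ψ σ₂ v₂ e₂)
    {J : GL (Fin ((m₁ + 1 + (m₂ + 1)) * c)) F → ℂ} (hJ : IsBesselSpehFunction ψ ρ J)
    (g : GL (Fin ((m₁ + 1 + (m₂ + 1)) * c)) F) :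
    J g = cellFunctional ψ e₁ e₂ σ₁ σ₂ (parabolicInduction _ σ₁ σ₂ g
      (cellVector ψ v₁ v₂ σ₁ σ₂)) := by
  have hmem : ∀ v ∈ kcSpace ψ ρ, incl v ∈
      kcSpace ψ (parabolicInduction (Nat.add_mul (m₁ + 1) (m₂ + 1) c).symm σ₁ σ₂) := by
    intro v hv u hu
    rw [← incl.isIntertwining, hv u hu, map_smul]
  obtain ⟨v, hv, h₀⟩ := hv
  obtain ⟨s, hs⟩ := hI _ (hmem v hv) (fun e => h₀ (hincl (e.trans (map_zero incl).symm))) _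
    (cellVector_mem (σ₁ := σ₁) (σ₂ := σ₂) (v₁ := v₁) (v₂ := v₂))
  rw [← map_smul] at hs
  have havg : ∀ x, charAvg (parabolicInduction (Nat.add_mul (m₁ + 1) (m₂ + 1) c).symm σ₁ σ₂)
      (kcHom ψ _ c) (incl x) = incl (charAvg ρ (kcHom ψ _ c) x) := by
    intro x
    rw [charAvg_apply, charAvg_apply, map_smul, map_sum]
    simp only [map_smul, incl.isIntertwining]
  rw [← apply_charAvg fun u => cellFunctional_map h₁ h₂ u _, ← hs, ← incl.isIntertwining, havg,
    hJ.charAvg_eq hρ ((kcSpace ψ ρ).smul_mem s hv), map_smul incl, hs, map_smul,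
    cellFunctional_cellVector h₁ h₂, smul_eq_mul, mul_one]

end Convolution

end BesselSpeh

/-! ### Uniqueness and the convolution formula. -/

theorem mainTheorem4 {F : Type*} [Field F] [Fintype F] [DecidableEq F]
    (ψ : AddChar F ℂ) (hψ : ψ ≠ 1)
    (k₁ k₂ c : ℕ) (hk₁ : 1 ≤ k₁) (hk₂ : 1 ≤ k₂) (hc : 1 ≤ c)
    {V₁ V₂ : Type*} [AddCommGroup V₁] [Module ℂ V₁] [FiniteDimensional ℂ V₁]
    [AddCommGroup V₂] [Module ℂ V₂] [FiniteDimensional ℂ V₂]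
    (Sigma₁ : Representation ℂ (GL (Fin (k₁ * c)) F) V₁)
    (Sigma₂ : Representation ℂ (GL (Fin (k₂ * c)) F) V₂)
    (hirr₁ : Sigma₁.IsIrreducible) (hirr₂ : Sigma₂.IsIrreducible)
    (htype₁ : BesselSpeh.IsKCType ψ k₁ c Sigma₁) (htype₂ : BesselSpeh.IsKCType ψ k₂ c Sigma₂)
    {V : Type*} [AddCommGroup V] [Module ℂ V]
    (Sigma : Representation ℂ (GL (Fin ((k₁ + k₂) * c)) F) V) (hirr : Sigma.IsIrreducible)
    (incl : Representation.IntertwiningMap Sigma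
      (BesselSpeh.parabolicInduction (Nat.add_mul k₁ k₂ c).symm Sigma₁ Sigma₂))
    (hincl : Function.Injective incl)
    (hvec : ∃ v ∈ BesselSpeh.kcSpace ψ Sigma, v ≠ 0) :
    (∃! J₁, BesselSpeh.IsBesselSpehFunction ψ Sigma₁ J₁) ∧
    (∃! J₂, BesselSpeh.IsBesselSpehFunction ψ Sigma₂ J₂) ∧
    (∃! J, BesselSpeh.IsBesselSpehFunction ψ Sigma J) ∧
    ∀ J₁ J₂ J,
      BesselSpeh.IsBesselSpehFunction ψ Sigma₁ J₁ →
      BesselSpeh.IsBesselSpehFunction ψ Sigma₂ J₂ →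
      BesselSpeh.IsBesselSpehFunction ψ Sigma J →
      ∀ h : GL (Fin c) F,
        BesselSpeh.specialValue ψ J h =
          (Fintype.card F : ℂ) ^ (-(c : ℤ) ^ 2) *
            ∑ p : GL (Fin c) F × GL (Fin c) F with p.1 * p.2 = -h,
              BesselSpeh.specialValue ψ J₁ p.1 * BesselSpeh.specialValue ψ J₂ p.2 := by
  obtain ⟨m₁, rfl⟩ := Nat.exists_eq_add_of_le' hk₁
  obtain ⟨m₂, rfl⟩ := Nat.exists_eq_add_of_le' hk₂
  have hr₁ := htype₁.runVanish hc
  have hr₂ := htype₂.runVanish hc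
  have hz₁ := htype₁.1
  have hz₂ := htype₂.1
  rw [BesselSpeh.zelevinskySpace_replicate] at hz₁ hz₂
  have hf₁ := BesselSpeh.finrank_kcSpace hψ hk₁ hr₁
  have hf₂ := BesselSpeh.finrank_kcSpace hψ hk₂ hr₂
  have hf := BesselSpeh.finrank_kcSpace (c := c) (ρ := BesselSpeh.parabolicInduction
    (Nat.add_mul (m₁ + 1) (m₂ + 1) c).symm Sigma₁ Sigma₂) hψ (by omega)
    (BesselSpeh.runVanish_parabolicInduction hψ hr₁ hr₂)
  have hfle := hf.trans_le
    (BesselSpeh.finrank_zelevinsky_parabolicInduction_le hψ hr₁ hr₂ hz₁ hz₂)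
  rw [hz₁] at hf₁
  rw [hz₂] at hf₂
  have hex₁ : ∃ v ∈ BesselSpeh.kcSpace ψ Sigma₁, v ≠ 0 :=
    Submodule.exists_mem_ne_zero_of_ne_bot fun h => by
      rw [h, finrank_bot] at hf₁
      exact zero_ne_one hf₁
  have hex₂ : ∃ v ∈ BesselSpeh.kcSpace ψ Sigma₂, v ≠ 0 :=
    Submodule.exists_mem_ne_zero_of_ne_bot fun h => by
      rw [h, finrank_bot] at hf₂
      exact zero_ne_one hf₂
  have hl₁ : ∀ v ∈ BesselSpeh.kcSpace ψ Sigma₁, v ≠ 0 → ∀ x ∈ BesselSpeh.kcSpace ψ Sigma₁,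
      ∃ r : ℂ, r • v = x :=
    fun v hv h₀ x hx => BesselSpeh.exists_smul_eq_of_finrank_le_one hf₁.le hv h₀ x hx
  have hl₂ : ∀ v ∈ BesselSpeh.kcSpace ψ Sigma₂, v ≠ 0 → ∀ x ∈ BesselSpeh.kcSpace ψ Sigma₂,
      ∃ r : ℂ, r • v = x :=
    fun v hv h₀ x hx => BesselSpeh.exists_smul_eq_of_finrank_le_one hf₂.le hv h₀ x hx
  have hI : ∀ v ∈ BesselSpeh.kcSpace ψ (BesselSpeh.parabolicInduction
      (Nat.add_mul (m₁ + 1) (m₂ + 1) c).symm Sigma₁ Sigma₂), v ≠ 0 →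
      ∀ x ∈ BesselSpeh.kcSpace ψ (BesselSpeh.parabolicInduction
        (Nat.add_mul (m₁ + 1) (m₂ + 1) c).symm Sigma₁ Sigma₂), ∃ r : ℂ, r • v = x :=
    fun v hv h₀ x hx => BesselSpeh.exists_smul_eq_of_finrank_le_one hfle hv h₀ x hx
  -- Multiplicity one descends from the induction along the injective intertwining map.
  have hl : ∀ v ∈ BesselSpeh.kcSpace ψ Sigma, v ≠ 0 → ∀ x ∈ BesselSpeh.kcSpace ψ Sigma,
      ∃ r : ℂ, r • v = x := by
    have hmem : ∀ v ∈ BesselSpeh.kcSpace ψ Sigma, incl v ∈ BesselSpeh.kcSpace ψ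
        (BesselSpeh.parabolicInduction (Nat.add_mul (m₁ + 1) (m₂ + 1) c).symm Sigma₁ Sigma₂) := by
      intro v hv u hu
      rw [← incl.isIntertwining, hv u hu, map_smul]
    intro v hv h₀ x hx
    obtain ⟨r, hr⟩ := hI _ (hmem v hv) (fun e => h₀ (hincl (e.trans (map_zero incl).symm))) _
      (hmem x hx)
    exact ⟨r, hincl ((map_smul incl r v).trans hr)⟩
  have : FiniteDimensional ℂ V :=
    Module.Finite.of_injective incl.toLinearMap hincl
  refine ⟨BesselSpeh.existsUnique_isBesselSpehFunction hl₁ hex₁,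
    BesselSpeh.existsUnique_isBesselSpehFunction hl₂ hex₂,
    BesselSpeh.existsUnique_isBesselSpehFunction hl hvec, ?_⟩
  intro J₁ J₂ J hJ₁ hJ₂ hJ h
  obtain ⟨v₁, e₁, h₁⟩ := BesselSpeh.exists_isBesselFunctional hl₁ hex₁
  obtain ⟨v₂, e₂, h₂⟩ := BesselSpeh.exists_isBesselFunctional hl₂ hex₂
  -- Since `k₁ + k₂ ≥ 2`, the special value on the left carries no correction factor.
  rw [BesselSpeh.specialValue, if_neg (by omega),
    BesselSpeh.apply_voronoi_eq incl hincl hvec hl hI h₁ h₂ hJ]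
  exact BesselSpeh.specialValue_formula h₁ h₂ (h₁.apply_besselSpeh hl₁ hJ₁)
    (h₂.apply_besselSpeh hl₂ hJ₂) h
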